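/- Let $n\ge 0$ be an integer and let $\mathcal U^n=\{z=(z',z_{n+1})\in\mathbb C^n\times\mathbb C:\ \mathrm{Im}\,z_{n+1}>|z'|^2\}$ be the Siegel upper half-space, with boundary $b\mathcal U^n$. Let $\boldsymbol\beta$ be the measure on $b\mathcal U^n$ that is the image of Lebesgue measure on $\mathbb C^n\times\mathbb R$ under $(\zeta,t)\mapsto(\zeta,t+i|\zeta|^2)$, and put $\mathbf i=(0',i)$. For $1<p<\infty$ and $F$ holomorphic on $\mathcal U^n$ let $$\|F\|_{H^p}=\sup_{t>0}\Big(\int_{b\mathcal U^n}|F(u+t\mathbf i)|^p\,d\boldsymbol\beta(u)\Big)^{1/p},$$ and let $H^p(\mathcal U^n)$ be the space of holomorphic $F$ on $\mathcal U^n$ with $\|F\|_{H^p}<\infty$. Identify $F\in H^2(\mathcal U^n)$ with its boundary value, the limit in $L^2(b\mathcal U^n)=L^2(\boldsymbol\beta)$ of $F(\cdot+t\mathbf i)$ as $t\to0^+$. The Cauchy--Szegő projection $C_{\mathcal U^n}$ is the orthogonal projection of $L^2(b\mathcal U^n)$ onto $H^2(\mathcal U^n)$; for $1<p<\infty$ the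 same symbol denotes its continuous extension from $L^2\cap L^p$ to an operator from $L^p(b\mathcal U^n)=L^p(\boldsymbol\beta)$ to $H^p(\mathcal U^n)$. Then for every $1<p<\infty$, with $q=p/(p-1)$, $$\|C_{\mathcal U^n}\|_{L^p(b\mathcal U^n)\to H^p(\mathcal U^n)}:=\sup_{0\ne f\in L^p(b\mathcal U^n)}\frac{\|C_{\mathcal U^n}f\|_{H^p}}{\|f\|_{L^p(b\mathcal U^n)}}\ \ge\ \frac{\Gamma\!\left(\frac{n+1}{p}\right)\Gamma\!\left(\frac{n+1}{q}\right)}{\Gamma^2\!\left(\frac{n+1}{2}\right)}.$$ -/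

import Mathlib

open MeasureTheory Filter Topology
open scoped ENNReal

namespace Siegel

/-- `ℂⁿ⁺¹`, with points written `z = (z', z_{n+1})`. -/
abbrev Space (n : ℕ) : Type := (Fin n → ℂ) × ℂ

/-- The squared Euclidean length `|z'|²` of a point of `ℂⁿ`. -/
noncomputable def sqNorm {n : ℕ} (w : Fin n → ℂ) : ℝ := ∑ j, ‖w j‖ ^ 2

/-- The Siegel upper half-space `{z : Im z_{n+1} > |z'|²}`. -/
def upperHalfSpace (n : ℕ) : Set (Space n) := {z | sqNorm z.1 < z.2.im}

/-- The parametrization `(ζ, t) ↦ (ζ, t + i|ζ|²)` of the boundary by `ℂⁿ × ℝ`. -/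
noncomputable def boundaryMap (n : ℕ) (h : (Fin n → ℂ) × ℝ) : Space n :=
  (h.1, (h.2 : ℂ) + (sqNorm h.1 : ℂ) * Complex.I)

theorem measurable_boundaryMap (n : ℕ) : Measurable (boundaryMap n) := by
  refine Continuous.measurable ?_
  unfold boundaryMap sqNorm
  fun_prop

/-- The measure `β` on the boundary: the push-forward of Lebesgue measure on `ℂⁿ × ℝ`, regarded
as a measure on `ℂⁿ⁺¹` carried by the boundary. Functions on the boundary are represented by
functions on `ℂⁿ⁺¹`, considered up to equality `β`-almost everywhere. -/
noncomputable def boundaryMeasure (n : ℕ) : Measure (Space n) :=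
  Measure.map (boundaryMap n) volume

/-- The vertical translate `u + t𝐢`, with `𝐢 = (0', i)`. -/
noncomputable def shift {n : ℕ} (t : ℝ) (u : Space n) : Space n :=
  (u.1, u.2 + (t : ℂ) * Complex.I)

/-- The quantity `‖F‖_{H^p} = sup_{t > 0} (∫ |F(u + t𝐢)|^p dβ(u))^{1/p}`, in `[0, ∞]`. -/
noncomputable def hardyNorm {n : ℕ} (p : ℝ) (F : Space n → ℂ) : ℝ≥0∞ :=
  ⨆ (t : ℝ) (_ : 0 < t),
    eLpNorm (fun u => F (shift t u)) (ENNReal.ofReal p) (boundaryMeasure n)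

/-- Membership in the Hardy space `H^p` of the Siegel upper half-space. Only the values of `F` on
the half-space matter. -/
def MemHardy {n : ℕ} (p : ℝ) (F : Space n → ℂ) : Prop :=
  DifferentiableOn ℂ F (upperHalfSpace n) ∧ hardyNorm p F < ∞

/-- `g ∈ L²(β)` is the boundary value of `F`: the limit in `L²(β)` of `F(· + t𝐢)` as `t → 0+`. -/
def IsBoundaryValue {n : ℕ} (F g : Space n → ℂ) : Prop :=
  MemLp g 2 (boundaryMeasure n) ∧
    Tendsto (fun t : ℝ => eLpNorm (fun u => F (shift t u) - g u) 2 (boundaryMeasure n))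
      (𝓝[>] 0) (𝓝 0)

/-- `F ∈ H²` is the image of `f ∈ L²(β)` under the orthogonal projection of `L²(β)` onto `H²`,
where `H²` is identified with the space of boundary values of its elements: the difference of `f`
and the boundary value of `F` is orthogonal to the boundary value of every element of `H²`. -/
def IsSzegoProjection {n : ℕ} (f F : Space n → ℂ) : Prop :=
  MemLp f 2 (boundaryMeasure n) ∧ MemHardy 2 F ∧
    ∃ b, IsBoundaryValue F b ∧
      ∀ G g : Space n → ℂ, MemHardy 2 G → IsBoundaryValue G g →
        ∫ u, (f u - b u) * (starRingEnd ℂ) (g u) ∂(boundaryMeasure n) = 0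

/-- `F` is the image of `f ∈ L^p(β)` under the extension to `L^p(β)` of the Cauchy-Szegő
projection: there are `f_k ∈ L² ∩ L^p` converging to `f` in `L^p(β)` whose orthogonal projections
`F_k` converge to the holomorphic function `F` in the `H^p` norm. -/
def IsCauchySzego {n : ℕ} (p : ℝ) (f F : Space n → ℂ) : Prop :=
  MemLp f (ENNReal.ofReal p) (boundaryMeasure n) ∧
    DifferentiableOn ℂ F (upperHalfSpace n) ∧
    ∃ fk Fk : ℕ → Space n → ℂ,
      (∀ k, MemLp (fk k) (ENNReal.ofReal p) (boundaryMeasure n)) ∧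
      (∀ k, IsSzegoProjection (fk k) (Fk k)) ∧
      Tendsto (fun k => eLpNorm (fun u => fk k u - f u) (ENNReal.ofReal p) (boundaryMeasure n))
        atTop (𝓝 0) ∧
      Tendsto (fun k => hardyNorm p (fun z => Fk k z - F z)) atTop (𝓝 0)

/-- The norm of the Cauchy-Szegő projection from `L^p(β)` to `H^p`: the supremum of
`‖Cf‖_{H^p} / ‖f‖_p` over the nonzero `f ∈ L^p(β)`. -/
noncomputable def cauchySzegoNorm (n : ℕ) (p : ℝ) : ℝ≥0∞ :=
  ⨆ (f : Space n → ℂ) (F : Space n → ℂ)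
    (_ : eLpNorm f (ENNReal.ofReal p) (boundaryMeasure n) ≠ 0) (_ : IsCauchySzego p f F),
    hardyNorm p F / eLpNorm f (ENNReal.ofReal p) (boundaryMeasure n)

end Siegel

namespace Siegel

open Set Complex

/-! ### Stieltjes-type transforms -/

/-! Write v = -i u_{n+1}, s = (n+1)/p, a = (n+1)/2 and c_b = Γ(b)Γ(n+1-b)/Γ(n+1). The bound to be
proved is c_s/c_a. Formally it is the factor by which the projection multiplies the modulus of
v^{-a} · conj(v^{a-s}), which is sent to (c_s/c_a) v^{-s}. The modulus |v|^{-s} is the critical one: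
its p-th power |v|^{-(n+1)} fails to be β-integrable only logarithmically, at 0 and at ∞.

The formal computation rests on two facts. The Beta integral v^{-a} = c_a^{-1} ∫₀^∞ y^{n-a}
(y+v)^{-n-1} dy writes v^{-a} as a superposition of Cauchy–Szegő kernels K_w with poles w on the
axis {(0, iy)}. For B holomorphic, the projection of conj(B) K_w is conj(B(w)) K_w, because the
reproducing property gives ⟨G, conj(B) K_w⟩ = (GB)(w) up to a constant. So the projection replaces
conj(B) under the integral by its value at the pole. With B(y) = y^{a-s}, the integral becomes
c_a^{-1} ∫ y^{n-s} (y+v)^{-n-1} dy = (c_s/c_a) v^{-s}. Any a in (0, n+1) would do; a = (n+1)/2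
minimizes c_a by log-convexity of Γ.

To make this rigorous, B is multiplied by v^τ (1+v)^{-2τ}, which restores p-integrability, v is
translated by ε, and a factor (1+εv)^{-2n-3} gives the decay needed in L². The exact projection is
then `isSzegoProjection_testFun`, resting on the reproducing formulas `integral_mul_mul_kern` and
`integral_mul_kern`. The test functions are at most 4^τ · `profile` pointwise, uniformly in ε
(`norm_testFun_le`). As ε → 0 the projections tend to an integral that is at least (c_s -
`deviation`)/c_a times the same profile (`le_norm_limProj`), because the extra factor varies slowly.
Two applications of Fatou's lemma and cancellation of the common, never computed, norm of the
profile give (c_s - `deviation`)/c_a ≤ 4^τ ‖C‖. Finally τ → 0. -/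

theorem le_norm_ofReal_add {r : ℝ} {v : ℂ} : r + v.re ≤ ‖(r : ℂ) + v‖ := by
  have := Complex.re_le_norm ((r : ℂ) + v)
  simpa using this

theorem ofReal_add_ne_zero {r : ℝ} {v : ℂ} (hr : 0 ≤ r) (hv : 0 < v.re) : (r : ℂ) + v ≠ 0 := by
  intro h
  have := congrArg Complex.re h
  simp at this
  linarith

theorem norm_le_norm_ofReal_add {r : ℝ} {v : ℂ} (hr : 0 ≤ r) (hv : 0 ≤ v.re) :
    ‖v‖ ≤ ‖(r : ℂ) + v‖ := by
  rw [Complex.norm_eq_sqrt_sq_add_sq, Complex.norm_eq_sqrt_sq_add_sq]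
  apply Real.sqrt_le_sqrt
  simp
  nlinarith

theorem min_mul_le_norm_ofReal_add {r δ : ℝ} {v : ℂ} (hr : 0 ≤ r) (hv : δ ≤ v.re) :
    min 1 δ * (1 + r) ≤ ‖(r : ℂ) + v‖ := by
  refine le_trans ?_ (le_norm_ofReal_add (r := r) (v := v))
  have h1 := min_le_left 1 δ
  have h2 := min_le_right 1 δ
  nlinarith

theorem norm_inv_pow_le {N : ℕ} {r δ : ℝ} {v : ℂ} (hr : 0 ≤ r) (hδ : 0 < δ) (hv : δ ≤ v.re) :
    ‖(((r : ℂ) + v) ^ N)⁻¹‖ ≤ ((min 1 δ) ^ N)⁻¹ * ((1 + r) ^ N)⁻¹ := by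
  rw [norm_inv, norm_pow, ← mul_inv, ← mul_pow]
  have h0 : 0 < min 1 δ * (1 + r) := by positivity
  gcongr
  exact min_mul_le_norm_ofReal_add hr hv

theorem integrable_stieltjes {X : Type*} [MeasurableSpace X] {μ : Measure X} {ρ : X → ℝ}
    (hρ : Measurable ρ) (hρ0 : ∀ᵐ x ∂μ, 0 ≤ ρ x) {m : X → ℂ} (hm : AEStronglyMeasurable m μ)
    {N : ℕ} (hi : Integrable (fun x => ‖m x‖ * ((1 + ρ x) ^ N)⁻¹) μ) {v : ℂ} (hv : 0 < v.re) :
    Integrable (fun x => m x * (((ρ x : ℂ) + v) ^ N)⁻¹) μ := by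
  refine (hi.const_mul ((min 1 v.re) ^ N)⁻¹).mono' ?_ ?_
  · refine hm.mul (Measurable.aestronglyMeasurable ?_)
    fun_prop
  · filter_upwards [hρ0] with x hx
    rw [norm_mul]
    calc _ ≤ ‖m x‖ * (((min 1 v.re) ^ N)⁻¹ * ((1 + ρ x) ^ N)⁻¹) := by
          gcongr; exact norm_inv_pow_le hx hv le_rfl
      _ = _ := by ring

theorem differentiableOn_stieltjes {X : Type*} [MeasurableSpace X] {μ : Measure X} {ρ : X → ℝ}
    (hρ : Measurable ρ) (hρ0 : ∀ᵐ x ∂μ, 0 ≤ ρ x) {m : X → ℂ} (hm : AEStronglyMeasurable m μ)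
    {N : ℕ} (hi : Integrable (fun x => ‖m x‖ * ((1 + ρ x) ^ N)⁻¹) μ) :
    DifferentiableOn ℂ (fun v : ℂ => ∫ x, m x * (((ρ x : ℂ) + v) ^ N)⁻¹ ∂μ) {v | 0 < v.re} := by
  intro v₀ hv₀
  have hv₀' : 0 < v₀.re := hv₀
  set δ := v₀.re / 2 with hδ
  have hδ0 : 0 < δ := by positivity
  have hs : {v : ℂ | δ < v.re} ∈ 𝓝 v₀ := by
    refine (isOpen_lt continuous_const Complex.continuous_re).mem_nhds ?_
    simp [hδ]; linarith
  have key := hasDerivAt_integral_of_dominated_loc_of_deriv_le (μ := μ) (x₀ := v₀)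
    (F := fun v x => m x * (((ρ x : ℂ) + v) ^ N)⁻¹)
    (F' := fun v x => m x * (-(N * ((ρ x : ℂ) + v) ^ (N - 1)) / (((ρ x : ℂ) + v) ^ N) ^ 2))
    (bound := fun x => N * δ⁻¹ * ((min 1 δ) ^ N)⁻¹ * (‖m x‖ * ((1 + ρ x) ^ N)⁻¹)) hs ?_ ?_ ?_ ?_ ?_ ?_
  · exact key.2.differentiableAt.differentiableWithinAt
  · refine Eventually.of_forall fun v => hm.mul (Measurable.aestronglyMeasurable ?_)
    fun_prop
  · exact integrable_stieltjes hρ hρ0 hm hi hv₀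
  · refine hm.mul (Measurable.aestronglyMeasurable ?_)
    fun_prop
  · filter_upwards [hρ0] with x hx v hv
    have hv' : δ < v.re := hv
    have hne := ofReal_add_ne_zero hx (hδ0.trans hv')
    have h1 : δ ≤ ‖(ρ x : ℂ) + v‖ := by
      have := le_norm_ofReal_add (r := ρ x) (v := v); linarith
    have h2 := norm_inv_pow_le (N := N) hx hδ0 hv'.le
    have e : (-(N * ((ρ x : ℂ) + v) ^ (N - 1)) / (((ρ x : ℂ) + v) ^ N) ^ 2)
        = -(N * (((ρ x : ℂ) + v)⁻¹ * (((ρ x : ℂ) + v) ^ N)⁻¹)) := by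
      -- For N = 0 the truncated exponent N - 1 is harmless, since the factor N vanishes.
      rcases N with _ | N
      · simp
      · simp only [Nat.add_sub_cancel]
        field_simp
        ring
    rw [e, norm_mul, norm_neg, norm_mul, norm_mul, Complex.norm_natCast, norm_inv]
    calc ‖m x‖ * (N * (‖(ρ x : ℂ) + v‖⁻¹ * ‖(((ρ x : ℂ) + v) ^ N)⁻¹‖))
        ≤ ‖m x‖ * (N * (δ⁻¹ * (((min 1 δ) ^ N)⁻¹ * ((1 + ρ x) ^ N)⁻¹))) := by gcongr
      _ = _ := by ring
  · exact hi.const_mul _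
  · filter_upwards [hρ0] with x hx v hv
    have hv' : δ < v.re := hv
    have hne := ofReal_add_ne_zero hx (hδ0.trans hv')
    refine HasDerivAt.const_mul _ ?_
    have h : HasDerivAt (fun v : ℂ => ((ρ x : ℂ) + v) ^ N) (N * ((ρ x : ℂ) + v) ^ (N - 1)) v := by
      have := ((hasDerivAt_id v).const_add (ρ x : ℂ)).fun_pow N
      simpa using this
    exact h.inv (pow_ne_zero _ hne)

/-- Identity theorem, with the points 1 + 1/(k+1) accumulating at 1. It carries formulas obtained by
real scaling over to complex parameters, with no rotation of contours. -/
theorem eqOn_re_pos_of_eq_ofReal {f g : ℂ → ℂ} (hf : DifferentiableOn ℂ f {v | 0 < v.re})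
    (hg : DifferentiableOn ℂ g {v | 0 < v.re}) (h : ∀ r : ℝ, 0 < r → f r = g r) :
    EqOn f g {v | 0 < v.re} := by
  have ho : IsOpen {v : ℂ | 0 < v.re} := isOpen_lt continuous_const Complex.continuous_re
  have hc : IsPreconnected {v : ℂ | 0 < v.re} :=
    (convex_halfSpace_re_gt 0).isPreconnected
  refine (hf.analyticOnNhd ho).eqOn_of_preconnected_of_frequently_eq (hg.analyticOnNhd ho) hc
    (z₀ := 1) (by simp) ?_
  have ht : Tendsto (fun k : ℕ => ((1 + 1 / ((k : ℝ) + 1) : ℝ) : ℂ)) atTop (𝓝[≠] 1) := by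
    refine tendsto_nhdsWithin_iff.2 ⟨?_, Eventually.of_forall fun k => ?_⟩
    · have h1 : Tendsto (fun k : ℕ => (1 + 1 / ((k : ℝ) + 1) : ℝ)) atTop (𝓝 (1 + 0)) :=
        tendsto_const_nhds.add tendsto_one_div_add_atTop_nhds_zero_nat
      have := (Complex.continuous_ofReal.tendsto _).comp h1
      simpa [Function.comp_def] using this
    · simp only [mem_compl_iff, mem_singleton_iff]
      intro hk
      have : (1 + 1 / ((k : ℝ) + 1) : ℝ) = 1 := by exact_mod_cast hk
      have h2 : (0 : ℝ) < 1 / ((k : ℝ) + 1) := by positivity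
      linarith
  exact ht.frequently (Frequently.of_forall fun k => h _ (by positivity))

/-! ### The Beta integral over the half-line -/

theorem integrableOn_rpow_mul_inv_pow {x : ℝ} {N : ℕ} (hx : -1 < x) (hN : x + 1 < N) :
    IntegrableOn (fun y : ℝ => y ^ x * ((1 + y) ^ N)⁻¹) (Ioi 0) := by
  have hm : Measurable (fun y : ℝ => y ^ x * ((1 + y) ^ N)⁻¹) := by fun_prop
  rw [← Ioc_union_Ioi_eq_Ioi (zero_le_one' ℝ)]
  refine IntegrableOn.union ?_ ?_
  · have h : IntegrableOn (fun y : ℝ => y ^ x) (Ioc 0 1) :=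
      (intervalIntegrable_iff_integrableOn_Ioc_of_le zero_le_one).1
        (intervalIntegral.intervalIntegrable_rpow' hx)
    refine h.mono' hm.aestronglyMeasurable ?_
    refine (ae_restrict_mem measurableSet_Ioc).mono fun y hy => ?_
    have hy0 : 0 < y := hy.1
    rw [Real.norm_of_nonneg (by positivity)]
    refine mul_le_of_le_one_right (by positivity) (inv_le_one_of_one_le₀ ?_)
    exact one_le_pow₀ (by linarith)
  · have h := integrableOn_Ioi_rpow_of_lt (a := x - N) (c := 1) (by linarith) one_pos
    refine h.mono' hm.aestronglyMeasurable ?_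
    refine (ae_restrict_mem measurableSet_Ioi).mono fun y hy => ?_
    have hy0 : 0 < y := one_pos.trans hy
    rw [Real.norm_of_nonneg (by positivity), Real.rpow_sub hy0, Real.rpow_natCast, div_eq_mul_inv]
    gcongr
    linarith

/-- The value `Γ(a)Γ(N-a)/Γ(N)` of the Beta integral `∫₀^∞ y^{N-1-a} (y+1)^{-N} dy`. -/
noncomputable def betaConst (N : ℕ) (a : ℝ) : ℝ := Real.Gamma a * Real.Gamma (N - a) / Real.Gamma N

/-- Γ(N) (1+y)^{-N} = ∫₀^∞ l^{N-1} e^{-(1+y)l} dl. Integrating in y before l leaves the product of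
two Gamma integrals. -/
theorem integral_rpow_mul_inv_pow {a : ℝ} {N : ℕ} (ha : 0 < a) (haN : a < N) :
    ∫ y in Ioi (0 : ℝ), y ^ ((N : ℝ) - 1 - a) * ((1 + y) ^ N)⁻¹ = betaConst N a := by
  have hN : (0 : ℝ) < N := ha.trans haN
  have hG : 0 < Real.Gamma N := Real.Gamma_pos_of_pos hN
  rw [betaConst, eq_div_iff hG.ne']
  have hmeas : Measurable (fun z : ℝ × ℝ =>
      z.1 ^ ((N : ℝ) - 1 - a) * (z.2 ^ ((N : ℝ) - 1) * Real.exp (-((1 + z.1) * z.2)))) := by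
    fun_prop
  have inner1 : ∀ y : ℝ, 0 < y → ∫ l in Ioi (0 : ℝ),
      y ^ ((N : ℝ) - 1 - a) * (l ^ ((N : ℝ) - 1) * Real.exp (-((1 + y) * l))) =
      y ^ ((N : ℝ) - 1 - a) * ((1 + y) ^ N)⁻¹ * Real.Gamma N := by
    intro y hy
    rw [integral_const_mul, Real.integral_rpow_mul_exp_neg_mul_Ioi hN (by positivity)]
    rw [Real.rpow_natCast]
    simp [mul_assoc]
  have inner2 : ∀ l : ℝ, 0 < l → ∫ y in Ioi (0 : ℝ),
      y ^ ((N : ℝ) - 1 - a) * (l ^ ((N : ℝ) - 1) * Real.exp (-((1 + y) * l))) =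
      (l ^ (a - 1) * Real.exp (-(1 * l))) * Real.Gamma (N - a) := by
    intro l hl
    have : ∀ y : ℝ, y ^ ((N : ℝ) - 1 - a) * (l ^ ((N : ℝ) - 1) * Real.exp (-((1 + y) * l))) =
        (l ^ ((N : ℝ) - 1) * Real.exp (-l)) * (y ^ ((N : ℝ) - a - 1) * Real.exp (-(l * y))) := by
      intro y
      rw [show -((1 + y) * l) = -l + -(l * y) by ring, Real.exp_add,
        show (N : ℝ) - a - 1 = N - 1 - a by ring]
      ring
    simp_rw [this]
    rw [integral_const_mul, Real.integral_rpow_mul_exp_neg_mul_Ioi (by linarith) hl]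
    rw [one_div, Real.inv_rpow hl.le, ← Real.rpow_neg hl.le, one_mul,
      show a - 1 = ((N : ℝ) - 1) + (-((N : ℝ) - a)) by ring, Real.rpow_add hl]
    ring
  have hint : Integrable (fun z : ℝ × ℝ =>
      z.1 ^ ((N : ℝ) - 1 - a) * (z.2 ^ ((N : ℝ) - 1) * Real.exp (-((1 + z.1) * z.2))))
      ((volume.restrict (Ioi 0)).prod (volume.restrict (Ioi 0))) := by
    rw [integrable_prod_iff hmeas.aestronglyMeasurable]
    constructor
    · refine (ae_restrict_mem measurableSet_Ioi).mono fun y (hy : 0 < y) => ?_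
      refine Integrable.const_mul (c := y ^ ((N : ℝ) - 1 - a)) (f := fun l : ℝ =>
        l ^ ((N : ℝ) - 1) * Real.exp (-((1 + y) * l))) ?_
      -- The integral of a non-integrable function is 0 by convention, whereas the Gamma formula
      -- gives a positive value.
      by_contra hni
      have h := Real.integral_rpow_mul_exp_neg_mul_Ioi hN (show 0 < 1 + y by positivity)
      rw [integral_undef hni] at h
      have : 0 < (1 / (1 + y)) ^ (N : ℝ) * Real.Gamma N := by positivity
      linarith
    · refine ((integrableOn_rpow_mul_inv_pow (x := (N : ℝ) - 1 - a) (N := N) (by linarith)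
        (by linarith)).mul_const (Real.Gamma N)).congr ?_
      refine (ae_restrict_mem measurableSet_Ioi).mono fun y (hy : 0 < y) => ?_
      beta_reduce
      rw [← inner1 y hy]
      refine setIntegral_congr_fun measurableSet_Ioi fun l (hl : 0 < l) => ?_
      rw [Real.norm_of_nonneg (by positivity)]
  have hswap := integral_integral_swap (f := fun y l : ℝ => 
      y ^ ((N : ℝ) - 1 - a) * (l ^ ((N : ℝ) - 1) * Real.exp (-((1 + y) * l)))) hint
  rw [setIntegral_congr_fun measurableSet_Ioi fun y hy => inner1 y hy,
    setIntegral_congr_fun measurableSet_Ioi fun y hy => inner2 y hy, integral_mul_const,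
    integral_mul_const, Real.integral_rpow_mul_exp_neg_mul_Ioi ha one_pos] at hswap
  simpa using hswap

theorem betaConst_pos {a : ℝ} {N : ℕ} (ha : 0 < a) (haN : a < N) : 0 < betaConst N a := by
  have h1 := Real.Gamma_pos_of_pos ha
  have h2 := Real.Gamma_pos_of_pos (sub_pos.2 haN)
  have h3 := Real.Gamma_pos_of_pos (ha.trans haN)
  unfold betaConst
  positivity

theorem integral_rpow_mul_inv_pow_of_pos {a : ℝ} {N : ℕ} (ha : 0 < a) (haN : a < N) {r : ℝ}
    (hr : 0 < r) :
    ∫ y in Ioi (0 : ℝ), y ^ ((N : ℝ) - 1 - a) * ((y + r) ^ N)⁻¹ = betaConst N a * r ^ (-a) := by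
  have h := integral_comp_mul_left_Ioi
    (fun y : ℝ => y ^ ((N : ℝ) - 1 - a) * ((y + r) ^ N)⁻¹) 0 hr
  rw [mul_zero, smul_eq_mul] at h
  have e : ∫ x in Ioi (0 : ℝ), (r * x) ^ ((N : ℝ) - 1 - a) * ((r * x + r) ^ N)⁻¹ =
      ∫ x in Ioi (0 : ℝ), (r ^ (-1 - a)) * (x ^ ((N : ℝ) - 1 - a) * ((1 + x) ^ N)⁻¹) := by
    refine setIntegral_congr_fun measurableSet_Ioi fun x (hx : 0 < x) => ?_
    rw [Real.mul_rpow hr.le hx.le, show r * x + r = r * (1 + x) by ring, mul_pow, mul_inv,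
      show (N : ℝ) - 1 - a = (-1 - a) + N by ring, Real.rpow_add hr, Real.rpow_natCast]
    have : r ^ N ≠ 0 := by positivity
    field_simp
  rw [e, integral_const_mul, integral_rpow_mul_inv_pow ha haN] at h
  have h2 : r ^ (-1 - a) = r⁻¹ * r ^ (-a) := by
    rw [show -1 - a = -1 + -a by ring, Real.rpow_add hr, Real.rpow_neg_one]
  rw [h2] at h
  have hr' : r⁻¹ ≠ 0 := by positivity
  apply mul_left_cancel₀ hr'
  rw [← h]; ring

/-- With N = n+1 this exhibits v^{-a} as a superposition of Cauchy–Szegő kernels with poles on the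
axis. -/
theorem integral_rpow_mul_inv_pow_complex {a : ℝ} {N : ℕ} (ha : 0 < a) (haN : a < N) {v : ℂ}
    (hv : 0 < v.re) :
    ∫ y in Ioi (0 : ℝ), ((y ^ ((N : ℝ) - 1 - a) : ℝ) : ℂ) * (((y : ℂ) + v) ^ N)⁻¹ =
      betaConst N a * v ^ (-a : ℂ) := by
  have hi : IntegrableOn (fun y : ℝ => ‖((y ^ ((N : ℝ) - 1 - a) : ℝ) : ℂ)‖ * ((1 + y) ^ N)⁻¹)
      (Ioi 0) := by
    refine (integrableOn_rpow_mul_inv_pow (x := (N : ℝ) - 1 - a) (N := N) (by linarith)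
      (by linarith)).congr_fun (fun y (hy : 0 < y) => ?_) measurableSet_Ioi
    simp only [Complex.norm_real]
    rw [Real.norm_of_nonneg (by positivity)]
  refine eqOn_re_pos_of_eq_ofReal (f := fun v : ℂ => ∫ y in Ioi (0 : ℝ),
    ((y ^ ((N : ℝ) - 1 - a) : ℝ) : ℂ) * (((y : ℂ) + v) ^ N)⁻¹)
    (g := fun v => betaConst N a * v ^ (-a : ℂ)) ?_ ?_ ?_ hv
  · refine differentiableOn_stieltjes measurable_id ?_ ?_ hi
    · exact (ae_restrict_mem measurableSet_Ioi).mono fun y (hy : 0 < y) => hy.le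
    · exact (by fun_prop : Measurable fun y : ℝ =>
        ((y ^ ((N : ℝ) - 1 - a) : ℝ) : ℂ)).aestronglyMeasurable
  · intro v hv
    refine (DifferentiableAt.const_mul ?_ _).differentiableWithinAt
    exact differentiableAt_id.cpow_const (Or.inl hv)
  · intro r hr
    rw [show (-a : ℂ) = ((-a : ℝ) : ℂ) by push_cast; rfl, ← Complex.ofReal_cpow hr.le,
      ← Complex.ofReal_mul, ← integral_rpow_mul_inv_pow_of_pos ha haN hr, ← integral_complex_ofReal]
    refine setIntegral_congr_fun measurableSet_Ioi fun x hx => ?_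
    push_cast
    rfl

/-! ### The integral of `(Y + 2|ζ|²)^{-n-1}` -/

theorem sqNorm_nonneg {n : ℕ} (w : Fin n → ℂ) : 0 ≤ sqNorm w :=
  Finset.sum_nonneg fun _ _ => by positivity

theorem sqNorm_smul {n : ℕ} (c : ℂ) (w : Fin n → ℂ) : sqNorm (c • w) = ‖c‖ ^ 2 * sqNorm w := by
  simp [sqNorm, Finset.mul_sum, mul_pow]

theorem sqNorm_real_smul {n : ℕ} (c : ℝ) (w : Fin n → ℂ) :
    sqNorm (c • w) = c ^ 2 * sqNorm w := by
  simp [sqNorm, Finset.mul_sum, mul_pow]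

@[simp] theorem sqNorm_zero {n : ℕ} : sqNorm (0 : Fin n → ℂ) = 0 := by simp [sqNorm]

theorem continuous_sqNorm {n : ℕ} : Continuous (sqNorm (n := n)) := by
  unfold sqNorm; fun_prop

theorem norm_sq_le_sqNorm {n : ℕ} (w : Fin n → ℂ) : ‖w‖ ^ 2 ≤ sqNorm w := by
  rw [← Real.sqrt_le_sqrt_iff (sqNorm_nonneg w), Real.sqrt_sq (norm_nonneg _)]
  refine (pi_norm_le_iff_of_nonneg (Real.sqrt_nonneg _)).2 fun i => ?_
  apply Real.le_sqrt_of_sq_le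
  exact Finset.single_le_sum (f := fun j => ‖w j‖ ^ 2) (fun _ _ => by positivity)
    (Finset.mem_univ i)

theorem sqNorm_le {n : ℕ} (w : Fin n → ℂ) : sqNorm w ≤ n * ‖w‖ ^ 2 := by
  refine (Finset.sum_le_card_nsmul Finset.univ _ (‖w‖ ^ 2) fun i _ => ?_).trans (by simp)
  gcongr
  exact norm_le_pi_norm w i

/-- The decay has order 2n+2, above the real dimension 2n. -/
theorem integrable_inv_one_add_sqNorm_pow (n : ℕ) :
    Integrable (fun ζ : Fin n → ℂ => ((1 + 2 * sqNorm ζ) ^ (n + 1))⁻¹) := by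
  have h : Integrable (fun ζ : Fin n → ℂ => (1 + ‖ζ‖ ^ 2) ^ (-(2 * n + 2 : ℝ) / 2)) := by
    apply integrable_rpow_neg_one_add_norm_sq
    simp [Module.finrank_pi_fintype, Complex.finrank_real_complex]
    linarith
  refine h.mono' ?_ (Eventually.of_forall fun ζ => ?_)
  · have := continuous_sqNorm (n := n)
    exact (by fun_prop : Measurable _).aestronglyMeasurable
  · have h0 := sqNorm_nonneg ζ
    have h1 := norm_sq_le_sqNorm ζ
    rw [Real.norm_of_nonneg (by positivity), show -(2 * n + 2 : ℝ) / 2 = -((n + 1 : ℕ) : ℝ) by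
      push_cast; ring, Real.rpow_neg (by positivity), Real.rpow_natCast]
    gcongr
    linarith

/-- The normalization of the Cauchy–Szegő kernel, up to 2π. Its value is never needed: it enters
both pairings compared in `isSzegoProjection_testFun` in the same way. -/
noncomputable def fiberConst (n : ℕ) : ℂ :=
  ∫ ζ : Fin n → ℂ, ((((2 * sqNorm ζ : ℝ) : ℂ) + 1) ^ (n + 1))⁻¹

/-- For Y = r > 0, the scaling ζ ↦ √r ζ produces r^{-n-1} from the integrand and r^n from the
volume. Integrating over the fibre thus turns the kernel into the one-variable Cauchy kernel. -/
theorem integral_inv_add_sqNorm_pow (n : ℕ) {Y : ℂ} (hY : 0 < Y.re) :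
    ∫ ζ : Fin n → ℂ, ((((2 * sqNorm ζ : ℝ) : ℂ) + Y) ^ (n + 1))⁻¹ = fiberConst n * Y⁻¹ := by
  have hρ : Measurable fun ζ : Fin n → ℂ => 2 * sqNorm ζ := by
    have := continuous_sqNorm (n := n); fun_prop
  have := eqOn_re_pos_of_eq_ofReal
    (f := fun Y : ℂ => ∫ ζ : Fin n → ℂ, (1 : ℂ) * ((((2 * sqNorm ζ : ℝ) : ℂ) + Y) ^ (n + 1))⁻¹)
    (g := fun Y => fiberConst n * Y⁻¹) ?_ ?_ ?_ hY
  · simpa using this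
  · refine differentiableOn_stieltjes hρ (Eventually.of_forall fun ζ => ?_)
      aestronglyMeasurable_const ?_
    · have := sqNorm_nonneg ζ; positivity
    · simpa using integrable_inv_one_add_sqNorm_pow n
  · intro Y hY
    refine (DifferentiableAt.const_mul ?_ _).differentiableWithinAt
    refine differentiableAt_inv ?_
    rintro rfl
    simp at hY
  · intro r hr
    simp only [one_mul]
    have h := Measure.integral_comp_smul (volume : Measure (Fin n → ℂ))
      (fun ζ : Fin n → ℂ => ((((2 * sqNorm ζ : ℝ) : ℂ) + r) ^ (n + 1))⁻¹) (Real.sqrt r)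
    have hs : 0 < Real.sqrt r := Real.sqrt_pos.2 hr
    have e : ∀ ζ : Fin n → ℂ, ((((2 * sqNorm (Real.sqrt r • ζ) : ℝ) : ℂ) + r) ^ (n + 1))⁻¹ =
        ((r : ℂ) ^ (n + 1))⁻¹ * ((((2 * sqNorm ζ : ℝ) : ℂ) + 1) ^ (n + 1))⁻¹ := by
      intro ζ
      rw [sqNorm_real_smul, Real.sq_sqrt hr.le, ← mul_inv, ← mul_pow]
      congr 2
      push_cast; ring
    simp_rw [e] at h
    rw [integral_const_mul] at h
    have hf : Module.finrank ℝ (Fin n → ℂ) = 2 * n := by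
      simp [Module.finrank_pi_fintype, Complex.finrank_real_complex, mul_comm]
    rw [hf, pow_mul, Real.sq_sqrt hr.le, abs_of_pos (by positivity), Complex.real_smul] at h
    have hrn : (r : ℂ) ≠ 0 := by exact_mod_cast hr.ne'
    unfold fiberConst
    have h' := congrArg (fun z => (r : ℂ) ^ n * z) h
    beta_reduce at h'
    push_cast at h' ⊢
    rw [mul_inv_cancel_left₀ (pow_ne_zero _ hrn)] at h'
    rw [← h', pow_succ]
    field_simp

/-! ### Averaging over a measure-preserving circle action -/

/-- Fubini on circle × X: the integral of Φ ∘ R θ does not depend on θ. It is used twice, to reduce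
to the axis ζ = 0 and to get a mean value property. Integrability of Ψ is part of the conclusion
because a further Fubini argument needs it. -/
theorem integral_eq_of_rotation {X : Type*} [MeasurableSpace X] {μ : Measure X} [SFinite μ]
    {R : ℝ → X → X} (hR : Measurable (Function.uncurry R))
    (hμ : ∀ θ, MeasurePreserving (R θ) μ μ) {Φ Ψ : X → ℂ} (hΦ : Integrable Φ μ)
    (h : ∀ᵐ x ∂μ, ∫ θ in (0 : ℝ)..2 * Real.pi, Φ (R θ x) = 2 * Real.pi * Ψ x) :
    Integrable Ψ μ ∧ ∫ x, Φ x ∂μ = ∫ x, Ψ x ∂μ := by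
  have hpi : (0 : ℝ) ≤ 2 * Real.pi := by positivity
  set ν : Measure ℝ := volume.restrict (Ioc 0 (2 * Real.pi)) with hν
  have mp : MeasurePreserving (fun p : ℝ × X => (p.1, R p.1 p.2)) (ν.prod μ) (ν.prod μ) :=
    (MeasurePreserving.id ν).skew_product (f := id) hR (ae_of_all _ fun θ => (hμ θ).map_eq)
  have hI : Integrable (fun p : ℝ × X => Φ (R p.1 p.2)) (ν.prod μ) :=
    mp.integrable_comp_of_integrable (hΦ.comp_snd ν)
  have hsw := integral_integral_swap (f := fun θ x => Φ (R θ x)) hI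
  have h1 : ∀ θ, ∫ x, Φ (R θ x) ∂μ = ∫ x, Φ x ∂μ := by
    intro θ
    have := integral_map (μ := μ) (hμ θ).measurable.aemeasurable (f := Φ)
      (by rw [(hμ θ).map_eq]; exact hΦ.1)
    rw [← this, (hμ θ).map_eq]
  have h2 : ∀ᵐ x ∂μ, ∫ θ, Φ (R θ x) ∂ν = 2 * Real.pi * Ψ x := by
    filter_upwards [h] with x hx
    rw [← hx, intervalIntegral.integral_of_le hpi]
  have hπ : (2 * Real.pi : ℂ) ≠ 0 := by
    simp [Real.pi_ne_zero]
  constructor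
  · have := hI.integral_prod_right
    have h3 := (this.congr h2).const_mul ((2 * Real.pi : ℂ)⁻¹)
    refine h3.congr (ae_of_all _ fun x => ?_)
    exact inv_mul_cancel_left₀ hπ _
  · simp_rw [h1] at hsw
    rw [integral_congr_ae h2, integral_const_mul] at hsw
    simp only [integral_const, hν, measureReal_restrict_apply_univ, Real.volume_real_Ioc_of_le hpi,
      sub_zero, Complex.real_smul] at hsw
    push_cast at hsw
    exact mul_left_cancel₀ hπ hsw

/-! ### Contour integrals over horizontal lines -/

theorem integral_line_shift {Q : ℂ → ℂ} {c C : ℝ} (hc : 0 ≤ c)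
    (hQ : DifferentiableOn ℂ Q {w | 0 ≤ w.im ∧ w.im ≤ c})
    (hb : ∀ w : ℂ, 0 ≤ w.im → w.im ≤ c → ‖Q w‖ ≤ C * (1 + w.re ^ 2)⁻¹) :
    ∫ x : ℝ, Q (x + c * I) = ∫ x : ℝ, Q x := by
  have hint : ∀ d : ℝ, 0 ≤ d → d ≤ c → Integrable (fun x : ℝ => Q (x + d * I)) := by
    intro d hd hdc
    refine (integrable_inv_one_add_sq.const_mul C).mono' ?_ (ae_of_all _ fun x => ?_)
    · refine (continuousOn_univ.1 ?_ : Continuous fun x : ℝ => Q (x + d * I)).aestronglyMeasurable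
      refine hQ.continuousOn.comp (by fun_prop) fun x _ => ?_
      simp [hd, hdc]
    · simpa using hb (x + d * I) (by simpa using hd) (by simpa using hdc)
  have hrect : ∀ T : ℝ, 0 ≤ T → (∫ x : ℝ in -T..T, Q x) - (∫ x : ℝ in -T..T, Q (x + c * I)) +
      I • (∫ y : ℝ in 0..c, Q (T + y * I)) - I • (∫ y : ℝ in 0..c, Q (-T + y * I)) = 0 := by
    intro T hT
    have := Complex.integral_boundary_rect_eq_zero_of_differentiableOn Q (-T : ℂ) (T + c * I)
      (hQ.mono ?_)
    · simpa using this
    · intro w hw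
      have h2 := hw.2
      simp [uIcc_of_le hc] at h2
      exact h2
  have hside : ∀ s : ℝ → ℝ, (∀ T, (s T) ^ 2 = T ^ 2) →
      Tendsto (fun T : ℝ => ∫ y : ℝ in 0..c, Q ((s T : ℝ) + y * I)) atTop (𝓝 0) := by
    intro s hs
    have hlim : Tendsto (fun T : ℝ => C * (1 + T ^ 2)⁻¹ * |c - 0|) atTop (𝓝 0) := by
      have h1 : Tendsto (fun T : ℝ => 1 + T ^ 2) atTop atTop :=
        tendsto_atTop_add_const_left _ _ (tendsto_pow_atTop two_ne_zero)
      have := (h1.inv_tendsto_atTop.const_mul C).mul_const |c - 0|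
      simpa using this
    refine squeeze_zero_norm (fun T => ?_) hlim
    refine intervalIntegral.norm_integral_le_of_norm_le_const fun y hy => ?_
    rw [uIoc_of_le hc] at hy
    have := hb ((s T : ℝ) + y * I) (by simpa using hy.1.le) (by simpa using hy.2)
    simpa [hs] using this
  have l1 := intervalIntegral_tendsto_integral (hint 0 le_rfl hc) tendsto_neg_atTop_atBot tendsto_id
  have l2 := intervalIntegral_tendsto_integral (hint c hc le_rfl) tendsto_neg_atTop_atBot tendsto_id
  have l3 := hside id fun T => rfl
  have l4 := hside (fun T => -T) fun T => by ring
  have l := ((l1.sub l2).add (l3.const_smul I)).sub (l4.const_smul I)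
  have l0 : Tendsto (fun _ : ℝ => (0 : ℂ)) atTop (𝓝 0) := tendsto_const_nhds
  have := tendsto_nhds_unique (l.congr' ?_) l0
  · simp only [ofReal_zero, zero_mul, add_zero, smul_zero, sub_zero] at this
    exact (sub_eq_zero.1 this).symm
  · filter_upwards [eventually_ge_atTop 0] with T hT
    have := hrect T hT
    simpa using this

/-- The line is pushed up to height k → ∞, where quadratic decay in the full modulus makes the
integral vanish. -/
theorem integral_line_eq_zero {Q : ℂ → ℂ} {C : ℝ} (hQ : DifferentiableOn ℂ Q {w | 0 ≤ w.im})
    (hb : ∀ w : ℂ, 0 ≤ w.im → ‖Q w‖ ≤ C * (1 + ‖w‖ ^ 2)⁻¹) :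
    ∫ x : ℝ, Q x = 0 := by
  have hb' : ∀ w : ℂ, 0 ≤ w.im → ‖Q w‖ ≤ C * (1 + w.re ^ 2)⁻¹ := by
    intro w hw
    have hC : 0 ≤ C := by
      have := (norm_nonneg _).trans (hb w hw)
      exact nonneg_of_mul_nonneg_left this (by positivity)
    refine (hb w hw).trans ?_
    have : w.re ^ 2 ≤ ‖w‖ ^ 2 := by
      rw [← sq_abs w.re]; gcongr; exact Complex.abs_re_le_norm w
    gcongr
  have hshift : ∀ k : ℕ, ∫ x : ℝ, Q (x + (k : ℝ) * I) = ∫ x : ℝ, Q x := fun k =>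
    integral_line_shift (C := C) (Nat.cast_nonneg k) (hQ.mono fun w hw => hw.1)
      fun w hw _ => hb' w hw
  have hlim : Tendsto (fun k : ℕ => ∫ x : ℝ, Q (x + (k : ℝ) * I)) atTop (𝓝 (∫ _ : ℝ, 0)) := by
    refine tendsto_integral_of_dominated_convergence (fun x => C * (1 + x ^ 2)⁻¹) (fun k => ?_)
      (integrable_inv_one_add_sq.const_mul C) (fun k => ae_of_all _ fun x => ?_)
      (ae_of_all _ fun x => ?_)
    · refine (continuousOn_univ.1 ?_ : Continuous fun x : ℝ => Q (x + (k : ℝ) * I)).aestronglyMeasurable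
      refine hQ.continuousOn.comp (by fun_prop) fun x _ => ?_
      simp
    · simpa using hb' (x + (k : ℝ) * I) (by simp)
    · have hl : Tendsto (fun k : ℕ => C * (1 + (k : ℝ) ^ 2)⁻¹) atTop (𝓝 0) := by
        have h1 : Tendsto (fun k : ℕ => 1 + (k : ℝ) ^ 2) atTop atTop :=
          tendsto_atTop_add_const_left _ _
            ((tendsto_pow_atTop two_ne_zero).comp tendsto_natCast_atTop_atTop)
        simpa using h1.inv_tendsto_atTop.const_mul C
      refine squeeze_zero_norm (fun k => ?_) hl
      have h0 : (0 : ℝ) ≤ ((x : ℂ) + (k : ℝ) * I).im := by simp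
      refine (hb _ h0).trans ?_
      have hC : 0 ≤ C := by
        have := (norm_nonneg _).trans (hb _ h0)
        exact nonneg_of_mul_nonneg_left this (by positivity)
      have : (k : ℝ) ≤ ‖(x : ℂ) + (k : ℝ) * I‖ := by
        have := Complex.abs_im_le_norm ((x : ℂ) + (k : ℝ) * I)
        simpa using this
      gcongr
  simp_rw [hshift] at hlim
  have := tendsto_nhds_unique hlim tendsto_const_nhds
  simpa using this.symm

/-- H(w)/(w-c) with c = iy has a pole at c. The pole is removed by subtracting a multiple of the
Poisson kernel, whose integral is known; the remainder is holomorphic with quadratic decay, so its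
integral is 0. -/
theorem integral_cauchy_halfPlane {H : ℂ → ℂ} {C δ y : ℝ} (hδ : 0 < δ) (hy : 0 < y)
    (hH : DifferentiableOn ℂ H {w | -δ < w.im})
    (hb : ∀ w : ℂ, 0 ≤ w.im → ‖H w‖ ≤ C * (1 + ‖w‖ ^ 2)⁻¹) :
    ∫ x : ℝ, H x * ((y : ℂ) + I * x)⁻¹ = 2 * Real.pi * H (y * I) := by
  -- With ε ≤ y the reflected point -c stays outside {Im w > -ε}.
  set ε := min δ y with hε
  have hε0 : 0 < ε := lt_min hδ hy
  have hεδ : ε ≤ δ := min_le_left _ _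
  have hεy : ε ≤ y := min_le_right _ _
  set S : Set ℂ := {w | -ε < w.im} with hS
  have hSo : IsOpen S := isOpen_lt continuous_const Complex.continuous_im
  set c : ℂ := y * I with hc
  have hcS : S ∈ 𝓝 c := hSo.mem_nhds (by simp [hS, hc]; linarith)
  have hne : ∀ w ∈ S, w + c ≠ 0 := by
    intro w hw h
    have := congrArg Complex.im h
    simp [hc] at this
    have hw' : -ε < w.im := hw
    linarith
  -- The factor 2c/(w+c) equals 1 at c, is holomorphic on S and decays like 1/|w|. Divided by w - c
  -- it becomes 2iy/(w²+y²), a multiple of the Poisson kernel. Hence `dslope P c` is the holomorphic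
  -- remainder.
  set P : ℂ → ℂ := fun w => H w - H c * (2 * c / (w + c)) with hP
  have hc0 : c ≠ 0 := by simp [hc, hy.ne']
  have hPc : P c = 0 := by
    simp only [hP]
    rw [← two_mul, div_self (by simpa using hc0)]; ring
  have hPd : DifferentiableOn ℂ P S := by
    refine DifferentiableOn.sub (hH.mono fun w (hw : -ε < w.im) => show -δ < w.im by linarith) ?_
    refine DifferentiableOn.const_mul (DifferentiableOn.div (by fun_prop) (by fun_prop) hne) _
  have hQd : DifferentiableOn ℂ (dslope P c) S := (Complex.differentiableOn_dslope hcS).2 hPd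
  have hQne : ∀ w, w ≠ c → dslope P c w = (w - c)⁻¹ * P w := by
    intro w hw
    rw [dslope_of_ne _ hw, slope_def_module, hPc]
    simp
  have hC : 0 ≤ C := by
    have := (norm_nonneg _).trans (hb 0 (by simp))
    exact nonneg_of_mul_nonneg_left this (by positivity)
  have him0 : {w : ℂ | 0 ≤ w.im} ⊆ S := fun w (hw : 0 ≤ w.im) => show -ε < w.im by linarith
  -- the bound for the difference quotient
  obtain ⟨C', hC'⟩ : ∃ C' : ℝ, ∀ w : ℂ, 0 ≤ w.im → ‖dslope P c w‖ ≤ C' * (1 + ‖w‖ ^ 2)⁻¹ := by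
    have hK : IsCompact (Metric.closedBall c (y / 2)) := isCompact_closedBall _ _
    have hKS : Metric.closedBall c (y / 2) ⊆ S := by
      intro w hw
      rw [Metric.mem_closedBall, Complex.dist_eq] at hw
      have h1 := (Complex.abs_im_le_norm (w - c)).trans hw
      simp [hc] at h1
      have := (abs_le.1 h1).1
      show -ε < w.im
      linarith
    obtain ⟨M, hM⟩ := hK.exists_bound_of_continuousOn (hQd.continuousOn.mono hKS)
    have hM0 : 0 ≤ M := (norm_nonneg _).trans (hM c (Metric.mem_closedBall_self (by positivity)))
    set D := ‖H c‖ * ‖2 * c‖ with hD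
    set A : ℝ := 3 + 2 / y with hA
    refine ⟨max (M * (1 + (2 * y) ^ 2)) (2 * (A * C + A * (D * (1 + y⁻¹)))), fun w hw => ?_⟩
    by_cases hwK : w ∈ Metric.closedBall c (y / 2)
    · have hn : ‖w‖ ≤ 2 * y := by
        rw [Metric.mem_closedBall, Complex.dist_eq] at hwK
        have h1 : ‖c‖ = y := by simp [hc, abs_of_pos hy]
        calc ‖w‖ = ‖(w - c) + c‖ := by ring_nf
          _ ≤ ‖w - c‖ + ‖c‖ := norm_add_le _ _
          _ ≤ 2 * y := by linarith
      refine (hM w hwK).trans ?_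
      rw [← div_eq_mul_inv, le_div_iff₀ (by positivity)]
      exact le_max_of_le_left (by gcongr)
    · rw [Metric.mem_closedBall, Complex.dist_eq, not_le] at hwK
      have hwc : w ≠ c := by rintro rfl; simp at hwK; linarith
      rw [hQne w hwc, norm_mul, norm_inv]
      have hcn : ‖c‖ = y := by simp [hc, abs_of_pos hy]
      have h1 : 1 + ‖w‖ ≤ A * ‖w - c‖ := by
        have h2 : ‖w‖ ≤ ‖w - c‖ + y := by
          calc ‖w‖ = ‖(w - c) + c‖ := by ring_nf
            _ ≤ ‖w - c‖ + ‖c‖ := norm_add_le _ _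
            _ = _ := by rw [hcn]
        have h3 : 1 ≤ 2 / y * ‖w - c‖ := by
          rw [div_mul_eq_mul_div, le_div_iff₀ hy]; linarith
        rw [hA, add_mul]; linarith
      have h2 : 1 + ‖w‖ ≤ (1 + y⁻¹) * ‖w + c‖ := by
        have e1 : ‖w‖ ≤ ‖w + c‖ := by
          rw [Complex.norm_eq_sqrt_sq_add_sq, Complex.norm_eq_sqrt_sq_add_sq]
          apply Real.sqrt_le_sqrt
          simp [hc]; nlinarith
        have e2 : y ≤ ‖w + c‖ := by
          have := Complex.abs_im_le_norm (w + c)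
          simp [hc] at this
          exact le_trans (by linarith [le_abs_self (w.im + y)]) this
        have e3 : 1 ≤ y⁻¹ * ‖w + c‖ := by
          rw [inv_mul_eq_div, le_div_iff₀ hy]; linarith
        rw [add_mul]; linarith
      have hwc0 : 0 < ‖w - c‖ := by linarith
      have hwpc0 : 0 < ‖w + c‖ := norm_pos_iff.2 (hne w (him0 hw))
      set N := ‖w‖ with hN
      have hN0 : 0 ≤ N := norm_nonneg _
      have i1 : ‖w - c‖⁻¹ ≤ A * (1 + N)⁻¹ := by
        rw [← div_eq_mul_inv, le_div_iff₀ (by positivity), inv_mul_eq_div, div_le_iff₀ hwc0]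
        exact h1
      have i2 : ‖w + c‖⁻¹ ≤ (1 + y⁻¹) * (1 + N)⁻¹ := by
        rw [← div_eq_mul_inv, le_div_iff₀ (by positivity), inv_mul_eq_div, div_le_iff₀ hwpc0]
        exact h2
      have i3 : (1 + N)⁻¹ * (1 + N)⁻¹ ≤ (1 + N ^ 2)⁻¹ := by
        rw [← mul_inv]; gcongr; nlinarith
      have i4 : (1 + N)⁻¹ ≤ 1 := inv_le_one_of_one_le₀ (by linarith)
      have hPb : ‖P w‖ ≤ C * (1 + N ^ 2)⁻¹ + D * ((1 + y⁻¹) * (1 + N)⁻¹) := by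
        refine (norm_sub_le _ _).trans ?_
        rw [norm_mul, norm_div, div_eq_mul_inv, ← mul_assoc]
        refine add_le_add (hb w hw) ?_
        rw [hD]; gcongr
      have hA0 : 0 ≤ A := by rw [hA]; positivity
      have hD0 : 0 ≤ D := by rw [hD]; positivity
      calc ‖w - c‖⁻¹ * ‖P w‖
          ≤ A * (1 + N)⁻¹ * (C * (1 + N ^ 2)⁻¹ + D * ((1 + y⁻¹) * (1 + N)⁻¹)) := by gcongr
        _ = A * C * ((1 + N)⁻¹ * (1 + N ^ 2)⁻¹) +
            A * (D * (1 + y⁻¹)) * ((1 + N)⁻¹ * (1 + N)⁻¹) := by ring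
        _ ≤ A * C * (1 * (1 + N ^ 2)⁻¹) + A * (D * (1 + y⁻¹)) * (1 + N ^ 2)⁻¹ := by gcongr
        _ = (A * C + A * (D * (1 + y⁻¹))) * (1 + N ^ 2)⁻¹ := by ring
        _ ≤ _ := by
          gcongr
          refine le_max_of_le_right ?_
          have : 0 ≤ A * C + A * (D * (1 + y⁻¹)) := by positivity
          linarith
  have hzero := integral_line_eq_zero (hQd.mono him0) hC'
  -- rewrite the vanishing integral
  have hxc : ∀ x : ℝ, (x : ℂ) ≠ c := by
    intro x h
    have := congrArg Complex.im h
    simp [hc] at this; linarith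
  have hyx : ∀ x : ℝ, ((y : ℂ) + I * x) ≠ 0 := by
    intro x h
    have := congrArg Complex.re h
    simp at this; linarith
  have hid : ∀ x : ℝ, dslope P c x =
      I * (H x * ((y : ℂ) + I * x)⁻¹) - I * (H c * ((2 * y : ℝ) * (((y : ℝ) ^ 2 + x ^ 2)⁻¹ : ℝ))) := by
    intro x
    rw [hQne x (hxc x)]
    have e1 : ((x : ℂ) - c) = -I * ((y : ℂ) + I * x) := by
      rw [hc]; linear_combination (x : ℂ) * I_sq
    have e2 : ((y : ℂ) ^ 2 + x ^ 2) = ((x : ℂ) - c) * (x + c) := by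
      rw [hc]; linear_combination (y : ℂ) ^ 2 * I_sq
    have hxc' : (x : ℂ) - c ≠ 0 := sub_ne_zero.2 (hxc x)
    have hxc'' : (x : ℂ) + c ≠ 0 := hne x (him0 (by simp))
    have e3 : ((y : ℂ) + I * x) = I * (x - c) := by
      rw [e1]; linear_combination ((y : ℂ) + I * x) * I_sq
    push_cast
    rw [e2, e3]
    simp only [hP]
    field_simp
    rw [hc]
    ring
  have hI1 : Integrable (fun x : ℝ => H x * ((y : ℂ) + I * x)⁻¹) := by
    refine ((integrable_inv_one_add_sq.const_mul (C * y⁻¹))).mono' ?_ (ae_of_all _ fun x => ?_)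
    · refine (Continuous.mul ?_ (Continuous.inv₀ (by fun_prop) hyx)).aestronglyMeasurable
      refine (continuousOn_univ.1 ?_ : Continuous fun x : ℝ => H x)
      refine hH.continuousOn.comp (by fun_prop) fun x _ => ?_
      simp [hδ]
    · rw [norm_mul, norm_inv]
      have h1 := hb x (by simp)
      have h2 : y ≤ ‖(y : ℂ) + I * x‖ := by
        have := Complex.re_le_norm ((y : ℂ) + I * x)
        simpa using this
      simp only [Complex.norm_real, Real.norm_eq_abs, sq_abs] at h1
      calc _ ≤ (C * (1 + x ^ 2)⁻¹) * y⁻¹ := by gcongr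
        _ = _ := by ring
  have hpois : Integrable (fun x : ℝ => (y ^ 2 + x ^ 2)⁻¹) ∧
      ∫ x : ℝ, (y ^ 2 + x ^ 2)⁻¹ = Real.pi / y := by
    have e : ∀ x : ℝ, (y ^ 2 + x ^ 2)⁻¹ = (y ^ 2)⁻¹ * (1 + (y⁻¹ * x) ^ 2)⁻¹ := by
      intro x
      rw [← mul_inv]; congr 1; field_simp
    simp_rw [e]
    constructor
    · exact (integrable_inv_one_add_sq.comp_mul_left' (inv_ne_zero hy.ne')).const_mul _
    · rw [integral_const_mul, Measure.integral_comp_mul_left (fun x : ℝ => (1 + x ^ 2)⁻¹) y⁻¹,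
        integral_univ_inv_one_add_sq, inv_inv, abs_of_pos hy, smul_eq_mul]
      field_simp
  have hI2 : Integrable (fun x : ℝ => I * (H c * ((2 * y : ℝ) * (((y : ℝ) ^ 2 + x ^ 2)⁻¹ : ℝ) : ℂ))) :=
    ((hpois.1.ofReal.const_mul _).const_mul _).const_mul _
  simp_rw [hid] at hzero
  rw [integral_sub (hI1.const_mul _) hI2, integral_const_mul, integral_const_mul,
    integral_const_mul, integral_const_mul, sub_eq_zero] at hzero
  have := mul_left_cancel₀ I_ne_zero hzero
  rw [this, integral_complex_ofReal, hpois.2]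
  have hyc : (y : ℂ) ≠ 0 := by exact_mod_cast hy.ne'
  push_cast
  field_simp

/-! ### The Cauchy kernel at the points `(0, iy)` -/

/-- The function `u ↦ (y + i \bar u_{n+1})^{-n-1}`, the complex conjugate of the
Cauchy–Szegő kernel at `(0, iy)` up to a constant factor. -/
noncomputable def kern (n : ℕ) (y : ℝ) (u : Space n) : ℂ :=
  (((y : ℂ) + I * (starRingEnd ℂ) u.2) ^ (n + 1))⁻¹

theorem measurable_kern (n : ℕ) (y : ℝ) : Measurable (kern n y) := by
  unfold kern
  have : Measurable fun u : Space n => (starRingEnd ℂ) u.2 := Complex.continuous_conj.measurable.comp measurable_snd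
  fun_prop

theorem boundaryMap_snd_im {n : ℕ} (e : (Fin n → ℂ) × ℝ) :
    (boundaryMap n e).2.im = sqNorm e.1 := by
  simp [boundaryMap]

theorem kern_boundaryMap {n : ℕ} (y : ℝ) (ζ : Fin n → ℂ) (x : ℝ) :
    kern n y (boundaryMap n (ζ, x)) = (((sqNorm ζ : ℂ) + (y + I * x)) ^ (n + 1))⁻¹ := by
  simp only [kern, boundaryMap, map_add, map_mul, conj_ofReal, conj_I]
  congr 2
  linear_combination (-(sqNorm ζ : ℂ)) * I_sq

theorem circle_average_smul {E : Type*} [NormedAddCommGroup E] [NormedSpace ℂ E] {g : E → ℂ}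
    {s : Set E} (hg : DifferentiableOn ℂ g s) {x : E}
    (hx : ∀ c : ℂ, ‖c‖ ≤ 1 → c • x ∈ s) :
    ∫ θ in (0 : ℝ)..2 * Real.pi, g (exp (θ * I) • x) = 2 * Real.pi * g 0 := by
  have hd : DifferentiableOn ℂ (fun c : ℂ => g (c • x)) (Metric.closedBall 0 1) := by
    refine hg.comp (by fun_prop) fun c hc => hx c ?_
    simpa using hc
  have hcl : DiffContOnCl ℂ (fun c : ℂ => g (c • x)) (Metric.ball 0 |1|) := by
    refine DifferentiableOn.diffContOnCl ?_
    rw [abs_one, closure_ball _ one_ne_zero]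
    exact hd
  have h := hcl.circleAverage
  rw [Real.circleAverage_def] at h
  simp only [circleMap, zero_add, ofReal_one, one_mul, zero_smul] at h
  have hπ : (2 * Real.pi : ℂ) ≠ 0 := by
    simp [Real.pi_ne_zero]
  rw [← h, Complex.real_smul]
  push_cast
  rw [mul_inv_cancel_left₀ hπ]

/-- The rotation `(ζ, x) ↦ (e^{iθ}ζ, x)`. -/
noncomputable def rot {n : ℕ} (θ : ℝ) (e : (Fin n → ℂ) × ℝ) : (Fin n → ℂ) × ℝ :=
  (exp (θ * I) • e.1, e.2)

theorem measurePreserving_exp_smul (θ : ℝ) :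
    MeasurePreserving (fun z : ℂ => exp (θ * I) • z) := by
  have e : (fun z : ℂ => exp (θ * I) • z) = rotation (Circle.exp θ) := by
    funext z
    simp [rotation_apply, Circle.coe_exp]
  rw [e]
  exact (rotation (Circle.exp θ)).measurePreserving

theorem measurePreserving_exp_smul_pi {n : ℕ} (θ : ℝ) :
    MeasurePreserving (fun ζ : Fin n → ℂ => exp (θ * I) • ζ) :=
  volume_preserving_pi (fun _ => measurePreserving_exp_smul θ)

theorem measurePreserving_rot {n : ℕ} (θ : ℝ) : MeasurePreserving (rot (n := n) θ) :=
  (measurePreserving_exp_smul_pi θ).prod (MeasurePreserving.id _)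

/-- The kernel depends on u_{n+1} only, so averaging over ζ ↦ e^{iθ}ζ replaces H(ζ, w) by H(0, w).
Shifting the x-contour by |ζ|² frees H from ζ, the ζ-integral then yields a Cauchy kernel, and
Cauchy's formula in the half-plane finishes. -/
theorem integral_mul_kern_of_decay {n : ℕ} {H : Space n → ℂ} {t y C : ℝ} (ht : 0 < t) (hy : 0 < y)
    (hH : DifferentiableOn ℂ H {z | sqNorm z.1 < z.2.im + t})
    (hint : Integrable (fun u => H u * kern n y u) (boundaryMeasure n))
    (hb : ∀ w : ℂ, 0 ≤ w.im → ‖H (0, w)‖ ≤ C * (1 + ‖w‖ ^ 2)⁻¹) :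
    ∫ u, H u * kern n y u ∂(boundaryMeasure n) =
      2 * Real.pi * fiberConst n * H (0, y * I) := by
  have hC : 0 ≤ C := by
    have := (norm_nonneg _).trans (hb 0 (by simp))
    exact nonneg_of_mul_nonneg_left this (by positivity)
  unfold boundaryMeasure at hint ⊢
  rw [integral_map (measurable_boundaryMap n).aemeasurable hint.1]
  rw [integrable_map_measure hint.1 (measurable_boundaryMap n).aemeasurable] at hint
  -- averaging over rotations
  have hrot := integral_eq_of_rotation (μ := volume) (R := rot (n := n))
    (Φ := (fun u => H u * kern n y u) ∘ boundaryMap n)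
    (Ψ := fun e => H (0, (boundaryMap n e).2) * kern n y (boundaryMap n e))
    (by unfold rot Function.uncurry; exact (by fun_prop : Continuous _).measurable)
    measurePreserving_rot hint (ae_of_all _ ?_)
  swap
  · intro e
    have e1 : ∀ θ, ((fun u => H u * kern n y u) ∘ boundaryMap n) (rot θ e) =
        H (exp (θ * I) • e.1, (boundaryMap n e).2) * kern n y (boundaryMap n e) := by
      intro θ
      have hn : ‖exp (θ * I)‖ = 1 := Complex.norm_exp_ofReal_mul_I θ
      simp [rot, boundaryMap, kern, sqNorm_smul, hn]
    simp_rw [e1]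
    rw [intervalIntegral.integral_mul_const,
      circle_average_smul (g := fun ζ : Fin n → ℂ => H (ζ, (boundaryMap n e).2))
        (s := {ζ | sqNorm ζ < (boundaryMap n e).2.im + t})]
    · ring
    · exact hH.comp (by fun_prop) fun ζ hζ => hζ
    · intro c hc
      simp only [mem_ofPred_eq, sqNorm_smul, boundaryMap_snd_im]
      have h0 := sqNorm_nonneg e.1
      have : ‖c‖ ^ 2 ≤ 1 := pow_le_one₀ (norm_nonneg _) hc
      nlinarith
  obtain ⟨hΨ, hΦΨ⟩ := hrot
  simp only [Function.comp_def] at hΦΨ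
  rw [hΦΨ]
  -- contour shift
  set H0 : ℂ → ℂ := fun w => H (0, w) with hH0
  have hH0d : DifferentiableOn ℂ H0 {w | -t < w.im} := by
    refine hH.comp (by fun_prop) fun w (hw : -t < w.im) => ?_
    simp only [mem_ofPred_eq, sqNorm_zero]; linarith
  rw [Measure.volume_eq_prod] at hΨ ⊢
  rw [integral_prod _ hΨ]
  -- At w = x + i|ζ|² the term 2|ζ|² + y + iw equals |ζ|² + y + ix, which is the base of the kernel.
  -- The pole w = i(2|ζ|² + y) lies above the strip that is crossed.
  have hline : ∀ ζ : Fin n → ℂ,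
      ∫ x : ℝ, H (0, (boundaryMap n (ζ, x)).2) * kern n y (boundaryMap n (ζ, x)) =
      ∫ x : ℝ, H0 x * ((((2 * sqNorm ζ : ℝ) : ℂ) + (y + I * x)) ^ (n + 1))⁻¹ := by
    intro ζ
    have hq := sqNorm_nonneg ζ
    have key := integral_line_shift (c := sqNorm ζ) (C := C * ((y ^ (n + 1))⁻¹))
      (Q := fun w => H0 w * ((((2 * sqNorm ζ : ℝ) : ℂ) + (y + I * w)) ^ (n + 1))⁻¹) hq ?_ ?_
    · rw [← key]
      refine integral_congr_ae (ae_of_all _ fun x => ?_)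
      beta_reduce
      rw [kern_boundaryMap]
      simp only [hH0, boundaryMap]
      congr 3
      push_cast
      linear_combination (-(sqNorm ζ : ℂ)) * I_sq
    · refine DifferentiableOn.mul (hH0d.mono fun w hw => ?_) ?_
      · show -t < w.im
        linarith [hw.1]
      · refine DifferentiableOn.inv (by fun_prop) fun w hw => pow_ne_zero _ fun h => ?_
        have := congrArg Complex.re h
        simp at this
        linarith [hw.2]
    · intro w hw hwc
      have h1 : y ≤ ‖((2 * sqNorm ζ : ℝ) : ℂ) + (y + I * w)‖ := by
        have := Complex.re_le_norm (((2 * sqNorm ζ : ℝ) : ℂ) + (y + I * w))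
        simp only [add_re, ofReal_re, mul_re, I_re, I_im, zero_mul, one_mul, zero_sub] at this
        linarith
      have h2 : w.re ^ 2 ≤ ‖w‖ ^ 2 := by
        rw [← sq_abs w.re]; gcongr; exact Complex.abs_re_le_norm w
      rw [norm_mul, norm_inv, norm_pow]
      calc _ ≤ C * (1 + ‖w‖ ^ 2)⁻¹ * (y ^ (n + 1))⁻¹ := by
            gcongr; exact hb w hw
        _ ≤ C * (1 + w.re ^ 2)⁻¹ * (y ^ (n + 1))⁻¹ := by gcongr
        _ = _ := by ring
  simp_rw [hline]
  rw [integral_integral_swap]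
  · have hfib : ∀ x : ℝ, ∫ ζ : Fin n → ℂ,
        H0 x * ((((2 * sqNorm ζ : ℝ) : ℂ) + (y + I * x)) ^ (n + 1))⁻¹ =
        fiberConst n * (H0 x * ((y : ℂ) + I * x)⁻¹) := by
      intro x
      rw [integral_const_mul, integral_inv_add_sqNorm_pow n (by simpa using hy)]
      ring
    simp_rw [hfib]
    rw [integral_const_mul, integral_cauchy_halfPlane ht hy hH0d hb]
    ring
  · have hi := ((integrable_inv_one_add_sqNorm_pow n).const_mul ((min 1 y ^ (n + 1))⁻¹)).mul_prod
      (integrable_inv_one_add_sq.const_mul C)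
    refine hi.mono' ?_ (ae_of_all _ fun z => ?_)
    · refine Continuous.aestronglyMeasurable ?_
      have h1 : Continuous fun x : ℝ => H0 x := by
        refine continuousOn_univ.1 (hH0d.continuousOn.comp (by fun_prop) fun x _ => ?_)
        simp [ht]
      have h2 := continuous_sqNorm (n := n)
      refine Continuous.mul (h1.comp continuous_snd) (Continuous.inv₀ (by fun_prop) fun z => ?_)
      refine pow_ne_zero _ (ofReal_add_ne_zero ?_ (by simpa using hy))
      have := sqNorm_nonneg z.1
      positivity
    · have h1 := norm_inv_pow_le (N := n + 1) (r := 2 * sqNorm z.1) (δ := y)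
        (v := y + I * z.2) (by have := sqNorm_nonneg z.1; positivity) hy (by simp)
      have h2 := hb z.2 (by simp)
      simp only [Complex.norm_real, Real.norm_eq_abs, sq_abs] at h2
      simp only [Function.uncurry]
      rw [norm_mul, mul_comm]
      have h3 := sqNorm_nonneg z.1
      have h4 : 0 < min 1 y := by positivity
      exact mul_le_mul h1 h2 (norm_nonneg _) (by positivity)

/-! ### Measurability on the boundary -/

theorem isClosed_boundary (n : ℕ) : IsClosed {u : Space n | u.2.im = sqNorm u.1} := by
  have := continuous_sqNorm (n := n)
  exact isClosed_eq (by fun_prop) (by fun_prop)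

theorem isOpen_upperHalfSpace (n : ℕ) : IsOpen (upperHalfSpace n) := by
  have := continuous_sqNorm (n := n)
  exact isOpen_lt (by fun_prop) (by fun_prop)

theorem ae_boundary (n : ℕ) : ∀ᵐ u ∂(boundaryMeasure n), u.2.im = sqNorm u.1 := by
  unfold boundaryMeasure
  rw [ae_map_iff (measurable_boundaryMap n).aemeasurable (isClosed_boundary n).measurableSet]
  exact ae_of_all _ fun e => boundaryMap_snd_im e

theorem aestronglyMeasurable_boundary {n : ℕ} {f : Space n → ℂ}
    (hf : ContinuousOn f {u | u.2.im = sqNorm u.1}) :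
    AEStronglyMeasurable f (boundaryMeasure n) := by
  have := hf.aestronglyMeasurable (μ := boundaryMeasure n) (isClosed_boundary n).measurableSet
  have e : (boundaryMeasure n).restrict {u | u.2.im = sqNorm u.1} = boundaryMeasure n :=
    Measure.restrict_eq_self_of_ae_mem (ae_boundary n)
  rwa [e] at this

theorem continuous_shift {n : ℕ} (t : ℝ) : Continuous (shift (n := n) t) := by
  unfold shift; fun_prop

theorem shift_mem {n : ℕ} {t : ℝ} (ht : 0 < t) {u : Space n} (hu : u.2.im = sqNorm u.1) :
    shift t u ∈ upperHalfSpace n := by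
  simp [shift, upperHalfSpace, hu, ht]

theorem continuousOn_comp_shift {n : ℕ} {G : Space n → ℂ} (hG : ContinuousOn G (upperHalfSpace n))
    {t : ℝ} (ht : 0 < t) : ContinuousOn (fun u => G (shift t u)) {u | u.2.im = sqNorm u.1} :=
  hG.comp (continuous_shift t).continuousOn fun _ hu => shift_mem ht hu

theorem eLpNorm_shift_le_hardyNorm {n : ℕ} (p : ℝ) (G : Space n → ℂ) {t : ℝ} (ht : 0 < t) :
    eLpNorm (fun u => G (shift t u)) (ENNReal.ofReal p) (boundaryMeasure n) ≤ hardyNorm p G :=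
  le_iSup₂ (f := fun (t : ℝ) (_ : 0 < t) =>
    eLpNorm (fun u => G (shift t u)) (ENNReal.ofReal p) (boundaryMeasure n)) t ht

theorem memLp_shift {n : ℕ} {G : Space n → ℂ} (hG : MemHardy 2 G) {t : ℝ} (ht : 0 < t) :
    MemLp (fun u => G (shift t u)) 2 (boundaryMeasure n) := by
  refine ⟨aestronglyMeasurable_boundary (continuousOn_comp_shift hG.1.continuousOn ht), ?_⟩
  refine lt_of_le_of_lt ?_ hG.2
  simpa using eLpNorm_shift_le_hardyNorm 2 G ht

theorem lintegral_sq_le_hardyNorm {n : ℕ} {G : Space n → ℂ} (hG : MemHardy 2 G) {t : ℝ}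
    (ht : 0 < t) :
    ∫⁻ e, ‖G (shift t (boundaryMap n e))‖ₑ ^ 2 ≤ hardyNorm 2 G ^ 2 := by
  have h1 : eLpNorm (fun u => G (shift t u)) 2 (boundaryMeasure n) ≤ hardyNorm 2 G := by
    simpa using eLpNorm_shift_le_hardyNorm 2 G ht
  have h2 := eLpNorm_nnreal_pow_eq_lintegral (f := fun u => G (shift t u)) (p := 2)
    (μ := boundaryMeasure n) two_ne_zero
  have h3 : ∫⁻ u, ‖G (shift t u)‖ₑ ^ 2 ∂(boundaryMeasure n) =
      ∫⁻ e, ‖G (shift t (boundaryMap n e))‖ₑ ^ 2 := by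
    refine lintegral_map' ?_ (measurable_boundaryMap n).aemeasurable
    exact ((memLp_shift hG ht).1.enorm).pow_const 2
  have h4 : eLpNorm (fun u => G (shift t u)) 2 (boundaryMeasure n) ^ 2 =
      ∫⁻ u, ‖G (shift t u)‖ₑ ^ 2 ∂(boundaryMeasure n) := by
    simpa using h2
  rw [← h3, ← h4]
  gcongr

/-! ### Boundedness on the axis -/

/-- In the coordinates (ζ, x, height above the boundary) the half-space differs from a product by a
shear. -/
theorem measurePreserving_shift_boundaryMap (n : ℕ) :
    MeasurePreserving (fun p : ((Fin n → ℂ) × ℝ) × ℝ => shift p.2 (boundaryMap n p.1))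
      (volume.prod volume) volume := by
  have h1 : MeasurePreserving (fun p : ((Fin n → ℂ) × ℝ) × ℝ => (p.1, sqNorm p.1.1 + p.2))
      (volume.prod volume) (volume.prod volume) := by
    refine (MeasurePreserving.id (volume : Measure ((Fin n → ℂ) × ℝ))).skew_product (f := id)
      (g := fun e τ => sqNorm e.1 + τ) ?_ (ae_of_all _ fun e => ?_)
    · have := continuous_sqNorm (n := n)
      unfold Function.uncurry
      exact (by fun_prop : Continuous _).measurable
    · exact (measurePreserving_add_left volume _).map_eq
  have h2 : MeasurePreserving (MeasurableEquiv.prodAssoc : ((Fin n → ℂ) × ℝ) × ℝ ≃ᵐ _)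
      (volume.prod volume) (volume.prod volume) :=
    measurePreserving_prodAssoc volume volume volume
  have h3 : MeasurePreserving (Prod.map id Complex.measurableEquivRealProd.symm :
      (Fin n → ℂ) × (ℝ × ℝ) → Space n) (volume.prod volume) (volume.prod volume) :=
    (MeasurePreserving.id volume).prod Complex.volume_preserving_equiv_real_prod.symm
  have h := h3.comp (h2.comp h1)
  have e : (fun p : ((Fin n → ℂ) × ℝ) × ℝ => shift p.2 (boundaryMap n p.1)) =
      Prod.map id Complex.measurableEquivRealProd.symm ∘
        ((MeasurableEquiv.prodAssoc : ((Fin n → ℂ) × ℝ) × ℝ ≃ᵐ _) ∘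
          fun p : ((Fin n → ℂ) × ℝ) × ℝ => (p.1, sqNorm p.1.1 + p.2)) := by
    funext p
    refine Prod.ext rfl ?_
    apply Complex.ext <;>
    simp [shift, boundaryMap, MeasurableEquiv.prodAssoc]
  rw [e]
  exact h

theorem measurableSet_slab (n : ℕ) (a b : ℝ) : MeasurableSet
    {z : Space n | a ≤ z.2.im - sqNorm z.1 ∧ z.2.im - sqNorm z.1 ≤ b} := by
  have hcs := continuous_sqNorm (n := n)
  have h : Measurable fun z : Space n => z.2.im - sqNorm z.1 :=
    (by fun_prop : Continuous fun z : Space n => z.2.im - sqNorm z.1).measurable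
  exact h (measurableSet_Icc (a := a) (b := b))

/-- Tonelli in the height above the boundary: each level contributes at most the square of the H²
norm. -/
theorem lintegral_slab_le {n : ℕ} {G : Space n → ℂ} (hG : MemHardy 2 G) {a b : ℝ} (ha : 0 < a) :
    ∫⁻ z in {z : Space n | a ≤ z.2.im - sqNorm z.1 ∧ z.2.im - sqNorm z.1 ≤ b}, ‖G z‖ₑ ^ 2 ≤
      ENNReal.ofReal (b - a) * hardyNorm 2 G ^ 2 := by
  have hcs := continuous_sqNorm (n := n)
  set T : Set (Space n) := {z | a ≤ z.2.im - sqNorm z.1 ∧ z.2.im - sqNorm z.1 ≤ b} with hT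
  have hTm : MeasurableSet T := measurableSet_slab _ _ _
  have hTU : T ⊆ upperHalfSpace n := fun z hz => by
    have : a ≤ z.2.im - sqNorm z.1 := hz.1
    show sqNorm z.1 < z.2.im
    linarith
  have hg : Measurable (T.indicator fun z => ‖G z‖ₑ ^ 2) := by
    have hc : ContinuousOn G T := hG.1.continuousOn.mono hTU
    have h1 : Measurable (T.indicator G) := by
      classical
      have := hc.measurable_piecewise (continuousOn_const (c := (0 : ℂ))) hTm
      have e : T.piecewise G (fun _ => 0) = T.indicator G := Set.piecewise_eq_indicator
      rwa [e] at this
    have e : (T.indicator fun z => ‖G z‖ₑ ^ 2) = fun z => ‖T.indicator G z‖ₑ ^ 2 := by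
      funext z
      by_cases hz : z ∈ T <;> simp [hz]
    rw [e]
    exact h1.enorm.pow_const 2
  have hcomp := (measurePreserving_shift_boundaryMap n).lintegral_comp hg
  rw [← lintegral_indicator hTm, ← hcomp]
  rw [lintegral_prod_symm' (fun p : ((Fin n → ℂ) × ℝ) × ℝ =>
    T.indicator (fun z => ‖G z‖ₑ ^ 2) (shift p.2 (boundaryMap n p.1)))
    (hg.comp (measurePreserving_shift_boundaryMap n).measurable)]
  have hmem : ∀ (e : (Fin n → ℂ) × ℝ) (τ : ℝ), shift τ (boundaryMap n e) ∈ T ↔ τ ∈ Icc a b := by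
    intro e τ
    have : (shift τ (boundaryMap n e)).2.im - sqNorm (shift τ (boundaryMap n e)).1 = τ := by
      simp [shift, boundaryMap]
    simp only [hT, mem_ofPred_eq, this, mem_Icc]
  calc ∫⁻ τ, ∫⁻ e, T.indicator (fun z => ‖G z‖ₑ ^ 2) (shift τ (boundaryMap n e))
      ≤ ∫⁻ τ, (Icc a b).indicator (fun _ => hardyNorm 2 G ^ 2) τ := by
        refine lintegral_mono fun τ => ?_
        by_cases hτ : τ ∈ Icc a b
        · simp only [Set.indicator_of_mem hτ, Set.indicator_of_mem ((hmem _ τ).2 hτ)]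
          exact lintegral_sq_le_hardyNorm hG (ha.trans_le hτ.1)
        · simp [Set.indicator_of_notMem hτ, Set.indicator_of_notMem (fun h => hτ ((hmem _ τ).1 h))]
    _ = _ := by
        rw [lintegral_indicator measurableSet_Icc, lintegral_const, Measure.restrict_apply_univ,
          Real.volume_Icc, mul_comm]

/-- Mean value property over a small polydisc around (0, w), together with the L² bound on a slab of
thickness t. Both the polydisc's size and the slab's thickness are independent of w, which makes the
bound uniform. -/
theorem exists_bound_axis {n : ℕ} {G : Space n → ℂ} (hG : MemHardy 2 G) {t : ℝ} (ht : 0 < t) :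
    ∃ C : ℝ, ∀ w : ℂ, t ≤ w.im → ‖G (0, w)‖ ≤ C := by
  have hcs := continuous_sqNorm (n := n)
  -- Within the polydisc, Im z_{n+1} - |z'|² varies by at most r + n r², and this r keeps that below
  -- t/2.
  set r : ℝ := min 1 (t / (2 * (n + 1))) with hr
  have hr0 : 0 < r := by positivity
  have hrn : r + n * r ^ 2 ≤ t / 2 := by
    have h1 : r ≤ 1 := min_le_left _ _
    have h2 : r ≤ t / (2 * (n + 1)) := min_le_right _ _
    rw [le_div_iff₀ (by positivity)] at h2
    have h3 : (n : ℝ) * r ^ 2 ≤ n * r := by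
      gcongr; nlinarith
    linarith
  set D : Set (Space n) := Metric.closedBall 0 r with hD
  have hDm : MeasurableSet D := Metric.isClosed_closedBall.measurableSet
  have hDv : volume D ≠ ∞ := (isCompact_closedBall _ _).measure_lt_top.ne
  have hDv0 : volume D ≠ 0 := (Metric.measure_closedBall_pos volume _ hr0).ne'
  have hDz : ∀ z ∈ D, sqNorm z.1 ≤ n * r ^ 2 ∧ |z.2.im| ≤ r := by
    intro z hz
    rw [hD, mem_closedBall_zero_iff, Prod.norm_def, max_le_iff] at hz
    exact ⟨(sqNorm_le _).trans (by gcongr; exact hz.1), (Complex.abs_im_le_norm _).trans hz.2⟩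
  set B : ℝ≥0∞ := volume D + ENNReal.ofReal t * hardyNorm 2 G ^ 2 with hB
  have hBt : B ≠ ∞ := by
    refine ENNReal.add_ne_top.2 ⟨hDv, ENNReal.mul_ne_top ENNReal.ofReal_ne_top ?_⟩
    exact ENNReal.pow_ne_top hG.2.ne
  refine ⟨(B / volume D).toReal, fun w hw => ?_⟩
  suffices h : ‖G (0, w)‖ₑ * volume D ≤ B by
    have h2 : ‖G (0, w)‖ₑ ≤ B / volume D := ENNReal.le_div_iff_mul_le (Or.inl hDv0) (Or.inl hDv) |>.2 h
    have := ENNReal.toReal_mono (ENNReal.div_ne_top hBt hDv0) h2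
    simpa using this
  have hDU : ∀ z ∈ D, ((0, w) : Space n) + z ∈ upperHalfSpace n := by
    intro z hz
    have := hDz z hz
    have h1 := (abs_le.1 this.2).1
    show sqNorm (0 + z.1) < (w + z.2).im
    rw [zero_add, add_im]
    linarith
  have hcont : ContinuousOn (fun z => G ((0, w) + z)) D :=
    hG.1.continuousOn.comp (by fun_prop) hDU
  have hrotD : ∀ θ : ℝ, MeasurePreserving (fun z : Space n => exp (θ * I) • z)
      (volume.restrict D) (volume.restrict D) := by
    intro θ
    have h1 : MeasurePreserving (fun z : Space n => exp (θ * I) • z) volume volume :=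
      (measurePreserving_exp_smul_pi θ).prod (measurePreserving_exp_smul θ)
    have h2 := h1.restrict_preimage hDm
    have h3 : (fun z : Space n => exp (θ * I) • z) ⁻¹' D = D := by
      ext z
      simp only [mem_preimage, hD, mem_closedBall_zero_iff, norm_smul,
        Complex.norm_exp_ofReal_mul_I, one_mul]
    rwa [h3] at h2
  have hmean := integral_eq_of_rotation (μ := volume.restrict D)
    (R := fun θ (z : Space n) => exp (θ * I) • z)
    (Φ := fun z => G ((0, w) + z)) (Ψ := fun _ => G (0, w))
    (by unfold Function.uncurry; exact (by fun_prop : Continuous _).measurable) hrotD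
    (hcont.integrableOn_compact (isCompact_closedBall _ _)) ?_
  swap
  · refine (ae_restrict_mem hDm).mono fun z hz => ?_
    have := circle_average_smul (g := fun z => G ((0, w) + z)) (x := z)
      (s := {z | ((0, w) : Space n) + z ∈ upperHalfSpace n}) ?_ ?_
    · rw [this, add_zero]
    · exact hG.1.comp (by fun_prop) fun z hz => hz
    · intro c hc
      refine hDU _ ?_
      rw [hD, mem_closedBall_zero_iff] at hz ⊢
      rw [norm_smul]
      exact (mul_le_of_le_one_left (norm_nonneg _) hc).trans hz
  have h1 : ‖G (0, w)‖ₑ * volume D = ‖∫ z in D, G ((0, w) + z)‖ₑ := by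
    rw [hmean.2, integral_const, measureReal_restrict_apply_univ, enorm_smul, mul_comm,
      Measure.real, Real.enorm_of_nonneg ENNReal.toReal_nonneg, ENNReal.ofReal_toReal hDv]
  rw [h1]
  set T : Set (Space n) := {z | w.im - t / 2 ≤ z.2.im - sqNorm z.1 ∧
    z.2.im - sqNorm z.1 ≤ w.im + t / 2} with hT
  have hTm : MeasurableSet T := measurableSet_slab _ _ _
  calc ‖∫ z in D, G ((0, w) + z)‖ₑ ≤ ∫⁻ z in D, ‖G ((0, w) + z)‖ₑ := enorm_integral_le_lintegral_enorm _
    -- The inequality x ≤ 1 + x² replaces Cauchy–Schwarz, since only finiteness matters.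
    _ ≤ ∫⁻ z in D, (1 + ‖G ((0, w) + z)‖ₑ ^ 2) := by
        refine lintegral_mono fun z => ?_
        rcases le_total (‖G ((0, w) + z)‖ₑ) 1 with h | h
        · exact h.trans le_self_add
        · refine le_trans ?_ le_add_self
          rw [pow_two]
          exact le_mul_of_one_le_left' h
    _ = volume D + ∫⁻ z in D, ‖G ((0, w) + z)‖ₑ ^ 2 := by
        rw [lintegral_add_left measurable_const, lintegral_const, Measure.restrict_apply_univ, one_mul]
    _ ≤ volume D + ∫⁻ z in T, ‖G z‖ₑ ^ 2 := by
        refine add_le_add le_rfl ?_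
        have hinv : (volume : Measure (Space n)).IsAddLeftInvariant := by
          exact Measure.prod.instIsAddLeftInvariant
        rw [← lintegral_indicator hDm, ← lintegral_indicator hTm,
          ← lintegral_add_left_eq_self (T.indicator fun z => ‖G z‖ₑ ^ 2) (0, w)]
        refine lintegral_mono fun z => ?_
        by_cases hz : z ∈ D
        · have hzT : ((0, w) : Space n) + z ∈ T := by
            have h := hDz z hz
            have h1 := abs_le.1 h.2
            have h0 := sqNorm_nonneg z.1
            show w.im - t / 2 ≤ (w + z.2).im - sqNorm (0 + z.1) ∧
              (w + z.2).im - sqNorm (0 + z.1) ≤ w.im + t / 2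
            rw [zero_add, add_im]
            have : 0 ≤ n * r ^ 2 := by positivity
            constructor <;> linarith
          rw [Set.indicator_of_mem hz, Set.indicator_of_mem hzT]
        · rw [Set.indicator_of_notMem hz]
          exact zero_le
    _ ≤ B := by
        rw [hB]
        gcongr
        refine (lintegral_slab_le hG (by linarith)).trans ?_
        rw [show w.im + t / 2 - (w.im - t / 2) = t by ring]

/-! ### Growth of the boundary measure and integrability -/

/-- On the boundary |u_{n+1}| ≤ r forces |ζ|² ≤ r and |x| ≤ r, a set of volume O(r^n · r). The
exponent n+1 is what makes s = (n+1)/p critical. -/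
theorem exists_boundaryMeasure_le (n : ℕ) : ∃ C : ℝ≥0∞, C ≠ ∞ ∧ ∀ r : ℝ, 0 ≤ r →
    boundaryMeasure n {u | ‖u.2‖ ≤ r} ≤ C * ENNReal.ofReal (r ^ (n + 1)) := by
  refine ⟨2 * volume (Metric.closedBall (0 : Fin n → ℂ) 1), ?_, fun r hr => ?_⟩
  · exact ENNReal.mul_ne_top (by simp) (isCompact_closedBall _ _).measure_lt_top.ne
  · unfold boundaryMeasure
    have hm : MeasurableSet {u : Space n | ‖u.2‖ ≤ r} :=
      (isClosed_le (by fun_prop) continuous_const).measurableSet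
    rw [Measure.map_apply (measurable_boundaryMap n) hm]
    have hsub : boundaryMap n ⁻¹' {u : Space n | ‖u.2‖ ≤ r} ⊆
        Metric.closedBall (0 : Fin n → ℂ) (Real.sqrt r) ×ˢ Icc (-r) r := by
      rintro ⟨ζ, x⟩ h
      simp only [mem_preimage, mem_ofPred_eq] at h
      have h1 := (Complex.abs_im_le_norm _).trans h
      have h2 := (Complex.abs_re_le_norm _).trans h
      rw [boundaryMap_snd_im, abs_of_nonneg (sqNorm_nonneg _)] at h1
      simp only [boundaryMap, add_re, ofReal_re, mul_re, I_re, mul_zero, ofReal_im, I_im, zero_mul,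
        sub_zero, add_zero] at h2
      refine ⟨?_, abs_le.1 h2⟩
      rw [mem_closedBall_zero_iff]
      exact Real.le_sqrt_of_sq_le ((norm_sq_le_sqNorm ζ).trans h1)
    refine (measure_mono hsub).trans ?_
    rw [Measure.volume_eq_prod, Measure.prod_prod, Real.volume_Icc,
      Measure.addHaar_closedBall' _ _ (Real.sqrt_nonneg r)]
    have hf : Module.finrank ℝ (Fin n → ℂ) = 2 * n := by
      simp [Module.finrank_pi_fintype, Complex.finrank_real_complex, mul_comm]
    rw [hf, pow_mul, Real.sq_sqrt hr, show r - -r = 2 * r by ring,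
      ENNReal.ofReal_mul (by norm_num), pow_succ, ENNReal.ofReal_mul (by positivity)]
    rw [ENNReal.ofReal_ofNat]
    apply le_of_eq
    ring

theorem integrableOn_rpow_mul_one_add_rpow {x c : ℝ} (hx : -1 < x) (hxc : x + 1 < c) :
    IntegrableOn (fun y : ℝ => y ^ x * (1 + y) ^ (-c)) (Ioi 0) := by
  have hm : Measurable (fun y : ℝ => y ^ x * (1 + y) ^ (-c)) := by fun_prop
  rw [← Ioc_union_Ioi_eq_Ioi (zero_le_one' ℝ)]
  refine IntegrableOn.union ?_ ?_
  · have h : IntegrableOn (fun y : ℝ => y ^ x) (Ioc 0 1) :=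
      (intervalIntegrable_iff_integrableOn_Ioc_of_le zero_le_one).1
        (intervalIntegral.intervalIntegrable_rpow' hx)
    refine h.mono' hm.aestronglyMeasurable ?_
    refine (ae_restrict_mem measurableSet_Ioc).mono fun y hy => ?_
    have hy0 : 0 < y := hy.1
    rw [Real.norm_of_nonneg (by positivity)]
    refine mul_le_of_le_one_right (by positivity) ?_
    exact Real.rpow_le_one_of_one_le_of_nonpos (by linarith) (by linarith)
  · have h := integrableOn_Ioi_rpow_of_lt (a := x - c) (c := 1) (by linarith) one_pos
    refine h.mono' hm.aestronglyMeasurable ?_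
    refine (ae_restrict_mem measurableSet_Ioi).mono fun y hy => ?_
    have hy0 : 0 < y := one_pos.trans hy
    rw [Real.norm_of_nonneg (by positivity), sub_eq_add_neg, Real.rpow_add hy0]
    gcongr y ^ x * ?_
    exact Real.rpow_le_rpow_of_nonpos hy0 (by linarith) (by linarith)

/-- The radial profile `ρ^{τ-s} (1+ρ)^{-2τ}`. -/
noncomputable def profile (s τ ρ : ℝ) : ℝ := ρ ^ (τ - s) * (1 + ρ) ^ (-(2 * τ))

theorem profile_nonneg {s τ ρ : ℝ} (hρ : 0 ≤ ρ) : 0 ≤ profile s τ ρ := by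
  unfold profile; positivity

theorem profile_pos {s τ ρ : ℝ} (hρ : 0 < ρ) : 0 < profile s τ ρ := by
  unfold profile; positivity

theorem profile_rpow {s τ ρ p : ℝ} (hρ : 0 ≤ ρ) :
    profile s τ ρ ^ p = profile (s * p) (τ * p) ρ := by
  unfold profile
  rw [Real.mul_rpow (by positivity) (by positivity), ← Real.rpow_mul hρ,
    ← Real.rpow_mul (by positivity)]
  congr 2 <;> ring

theorem ae_norm_snd_pos (n : ℕ) : ∀ᵐ u ∂(boundaryMeasure n), 0 < ‖u.2‖ := by
  obtain ⟨C, hC, h⟩ := exists_boundaryMeasure_le n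
  have h0 := h 0 le_rfl
  rw [ae_iff]
  refine le_antisymm ?_ zero_le
  refine le_trans (measure_mono fun u hu => ?_) (h0.trans ?_)
  · exact not_lt.1 hu
  · simp

/-- The profile is dominated by an average of k over r ∈ [ρ, 2ρ]. After Tonelli, the growth bound
β{ρ ≤ r} ≤ C r^{n+1} reduces the claim to the convergence of ∫ r^{δ-1} (1+r)^{-2δ} dr, which holds
at both ends because δ > 0. -/
theorem lintegral_profile_lt_top {n : ℕ} {δ : ℝ} (hδ : 0 < δ) (hδn : δ ≤ n + 1) :
    ∫⁻ u, ENNReal.ofReal (profile (n + 1) δ ‖u.2‖) ∂(boundaryMeasure n) < ∞ := by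
  obtain ⟨C, hC, hβ⟩ := exists_boundaryMeasure_le n
  -- One power of r below the profile, to compensate the length ρ of [ρ, 2ρ].
  set k : ℝ → ℝ := fun r => r ^ (δ - (n + 2)) * (1 + r) ^ (-(2 * δ)) with hk
  have hkm : Measurable k := by fun_prop
  -- The constant from (2ρ)^{δ-n-2} (2(1+ρ))^{-2δ}, the lower bound for k on [ρ, 2ρ].
  set c : ℝ := 2 ^ (-δ - (n + 2)) with hc
  have hc0 : 0 < c := by positivity
  have step1 : ∀ ρ : ℝ, 0 < ρ → ENNReal.ofReal c * ENNReal.ofReal (profile (n + 1) δ ρ) ≤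
      ∫⁻ r in Ioi 0, (Icc ρ (2 * ρ)).indicator (fun r => ENNReal.ofReal (k r)) r := by
    intro ρ hρ
    rw [← ENNReal.ofReal_mul hc0.le, lintegral_indicator measurableSet_Icc,
      Measure.restrict_restrict measurableSet_Icc]
    have e : Icc ρ (2 * ρ) ∩ Ioi 0 = Icc ρ (2 * ρ) :=
      inter_eq_left.2 fun r hr => hρ.trans_le hr.1
    rw [e]
    have h1 : ∀ r ∈ Icc ρ (2 * ρ), ENNReal.ofReal (c * profile (n + 1) δ ρ * ρ⁻¹) ≤
        ENNReal.ofReal (k r) := by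
      intro r hr
      apply ENNReal.ofReal_le_ofReal
      have hr0 : 0 < r := hρ.trans_le hr.1
      have i1 : (2 * ρ) ^ (δ - (n + 2)) ≤ r ^ (δ - (n + 2)) :=
        Real.rpow_le_rpow_of_nonpos hr0 hr.2 (by linarith)
      have i2 : (2 * (1 + ρ)) ^ (-(2 * δ)) ≤ (1 + r) ^ (-(2 * δ)) :=
        Real.rpow_le_rpow_of_nonpos (by linarith) (by linarith [hr.2]) (by linarith)
      calc c * profile (n + 1) δ ρ * ρ⁻¹
          = (2 * ρ) ^ (δ - (n + 2)) * (2 * (1 + ρ)) ^ (-(2 * δ)) := by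
            rw [Real.mul_rpow (by norm_num) hρ.le, Real.mul_rpow (by norm_num) (by linarith), hc,
              profile, show (-δ - ((n : ℝ) + 2)) = (δ - (n + 2)) + (-(2 * δ)) by ring,
              Real.rpow_add (by norm_num), show δ - ((n : ℝ) + 2) = (δ - (n + 1)) - 1 by ring,
              Real.rpow_sub_one hρ.ne']
            ring
        _ ≤ k r := mul_le_mul i1 i2 (by positivity) (by positivity)
    calc ENNReal.ofReal (c * profile (n + 1) δ ρ)
        = ∫⁻ _ in Icc ρ (2 * ρ), ENNReal.ofReal (c * profile (n + 1) δ ρ * ρ⁻¹) := by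
          rw [lintegral_const, Measure.restrict_apply_univ, Real.volume_Icc,
            ← ENNReal.ofReal_mul (by have := profile_nonneg (s := n + 1) (τ := δ) hρ.le; positivity)]
          congr 1
          field_simp
          ring
      _ ≤ _ := setLIntegral_mono' measurableSet_Icc h1
  have hmeas : Measurable fun z : Space n × ℝ =>
      (Icc ‖z.1.2‖ (2 * ‖z.1.2‖)).indicator (fun r => ENNReal.ofReal (k r)) z.2 := by
    have hs : MeasurableSet {z : Space n × ℝ | ‖z.1.2‖ ≤ z.2 ∧ z.2 ≤ 2 * ‖z.1.2‖} := by
      refine IsClosed.measurableSet (IsClosed.and ?_ ?_)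
      · exact isClosed_le (by fun_prop) (by fun_prop)
      · exact isClosed_le (by fun_prop) (by fun_prop)
    exact ((hkm.comp measurable_snd).ennreal_ofReal.indicator hs)
  have step2 : ENNReal.ofReal c * ∫⁻ u, ENNReal.ofReal (profile (n + 1) δ ‖u.2‖) ∂(boundaryMeasure n)
      ≤ ∫⁻ r in Ioi 0, ENNReal.ofReal (k r) * (C * ENNReal.ofReal (r ^ (n + 1))) := by
    rw [← lintegral_const_mul' _ _ ENNReal.ofReal_ne_top]
    calc _ ≤ ∫⁻ u : Space n, (∫⁻ r in Ioi (0 : ℝ), (Icc ‖u.2‖ (2 * ‖u.2‖)).indicator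
            (fun r => ENNReal.ofReal (k r)) r) ∂(boundaryMeasure n) := by
          refine lintegral_mono_ae ?_
          filter_upwards [ae_norm_snd_pos n] with u hu
          exact step1 _ hu
      _ = ∫⁻ r in Ioi (0 : ℝ), ∫⁻ u : Space n, (Icc ‖u.2‖ (2 * ‖u.2‖)).indicator
            (fun r => ENNReal.ofReal (k r)) r ∂(boundaryMeasure n) := by
          have : SFinite (boundaryMeasure n) := by unfold boundaryMeasure; infer_instance
          exact lintegral_lintegral_swap (f := fun (u : Space n) (r : ℝ) =>
            (Icc ‖u.2‖ (2 * ‖u.2‖)).indicator (fun r => ENNReal.ofReal (k r)) r) hmeas.aemeasurable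
      _ ≤ _ := by
          refine setLIntegral_mono' measurableSet_Ioi fun r hr => ?_
          refine le_trans ?_ (mul_le_mul_right (hβ r (le_of_lt hr)) (ENNReal.ofReal (k r)))
          rw [← setLIntegral_const, ← lintegral_indicator
            ((isClosed_le (by fun_prop) continuous_const).measurableSet)]
          refine lintegral_mono fun u => ?_
          by_cases h : r ∈ Icc ‖u.2‖ (2 * ‖u.2‖)
          · rw [Set.indicator_of_mem h, Set.indicator_of_mem (show u ∈ {u : Space n | ‖u.2‖ ≤ r} from h.1)]
          · rw [Set.indicator_of_notMem h]; exact zero_le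
  have step3 : ∫⁻ r in Ioi 0, ENNReal.ofReal (k r) * (C * ENNReal.ofReal (r ^ (n + 1))) < ∞ := by
    have e : ∀ r ∈ Ioi (0 : ℝ), ENNReal.ofReal (k r) * (C * ENNReal.ofReal (r ^ (n + 1))) =
        C * ENNReal.ofReal (r ^ (δ - 1) * (1 + r) ^ (-(2 * δ))) := by
      intro r hr
      have hr0 : 0 < r := hr
      rw [mul_left_comm, ← ENNReal.ofReal_mul (by positivity)]
      congr 2
      rw [hk]
      rw [show δ - 1 = (δ - (n + 2)) + ((n + 1 : ℕ) : ℝ) by push_cast; ring, Real.rpow_add hr0,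
        Real.rpow_natCast]
      ring
    rw [setLIntegral_congr_fun measurableSet_Ioi e, lintegral_const_mul' _ _ hC]
    refine ENNReal.mul_lt_top hC.lt_top ?_
    have hi := integrableOn_rpow_mul_one_add_rpow (x := δ - 1) (c := 2 * δ) (by linarith)
      (by linarith)
    have := hi.2
    rw [hasFiniteIntegral_iff_ofReal] at this
    · exact this
    · refine (ae_restrict_mem measurableSet_Ioi).mono fun r (hr : 0 < r) => ?_
      show 0 ≤ r ^ (δ - 1) * (1 + r) ^ (-(2 * δ))
      positivity
  have := lt_of_le_of_lt step2 step3
  by_contra hcon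
  rw [not_lt, top_le_iff] at hcon
  rw [hcon, ENNReal.mul_top (by simpa using hc0)] at this
  exact lt_irrefl _ this

theorem measurable_profile (s τ : ℝ) : Measurable (profile s τ) := by
  unfold profile; fun_prop

theorem memLp_profile {n : ℕ} {p s τ : ℝ} (hp : 0 < p) (hs : s * p = n + 1) (hτ : 0 < τ)
    (hτs : τ ≤ s) :
    MemLp (fun u : Space n => profile s τ ‖u.2‖) (ENNReal.ofReal p) (boundaryMeasure n) := by
  have hm : Measurable (fun u : Space n => profile s τ ‖u.2‖) :=
    (measurable_profile s τ).comp (by fun_prop)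
  refine ⟨hm.aestronglyMeasurable, ?_⟩
  rw [eLpNorm_lt_top_iff_lintegral_rpow_enorm_lt_top (by simpa using hp) ENNReal.ofReal_ne_top,
    ENNReal.toReal_ofReal hp.le]
  refine lt_of_le_of_lt (lintegral_mono fun u => ?_) (lintegral_profile_lt_top (n := n)
    (δ := τ * p) (by positivity) (by rw [← hs]; gcongr))
  have h0 := profile_nonneg (s := s) (τ := τ) (norm_nonneg u.2)
  rw [Real.enorm_of_nonneg h0, ENNReal.ofReal_rpow_of_nonneg h0 hp.le, profile_rpow (norm_nonneg _),
    hs]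

theorem memLp_inv_one_add_pow (n : ℕ) :
    MemLp (fun u : Space n => ((1 + ‖u.2‖) ^ (n + 1))⁻¹) 2 (boundaryMeasure n) := by
  -- With τ = s the power of ρ disappears and only (1+ρ)^{-(n+1)} remains.
  have h := memLp_profile (n := n) (p := 2) (s := (n + 1) / 2) (τ := (n + 1) / 2) two_pos (by ring)
    (by positivity) le_rfl
  rw [ENNReal.ofReal_ofNat] at h
  convert h using 2 with u
  rw [profile, sub_self, Real.rpow_zero, one_mul, Real.rpow_neg (by positivity),
    show 2 * (((n : ℝ) + 1) / 2) = ((n + 1 : ℕ) : ℝ) by push_cast; ring, Real.rpow_natCast]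

/-! ### The reproducing formula in `H²` -/

theorem enorm_integral_mul_le {X : Type*} [MeasurableSpace X] {μ : Measure X} {f g : X → ℂ}
    (hf : AEStronglyMeasurable f μ) (hg : AEStronglyMeasurable g μ) :
    ‖∫ x, f x * g x ∂μ‖ₑ ≤ eLpNorm f 2 μ * eLpNorm g 2 μ := by
  have h := eLpNorm_smul_le_mul_eLpNorm (p := 2) (q := 2) (r := 1) hg hf
  refine (enorm_integral_le_lintegral_enorm _).trans ?_
  rw [eLpNorm_one_eq_lintegral_enorm] at h
  exact h

theorem norm_neg_I_mul (w : ℂ) : ‖-I * w‖ = ‖w‖ := by simp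

theorem kern_eq_conj (n : ℕ) (y : ℝ) (u : Space n) :
    kern n y u = (starRingEnd ℂ) ((((y : ℂ) + -I * u.2) ^ (n + 1))⁻¹) := by
  simp [kern]

theorem one_add_le_of_le {a N M : ℝ} (ha : 0 < a) (h1 : a ≤ M) (h2 : N ≤ M) :
    1 + N ≤ (1 + a⁻¹) * M := by
  have : 1 ≤ a⁻¹ * M := by rw [inv_mul_eq_div, le_div_iff₀ ha]; linarith
  linarith

theorem norm_kern_le {n : ℕ} {y : ℝ} (hy : 0 < y) {u : Space n} (hu : 0 ≤ u.2.im) :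
    ‖kern n y u‖ ≤ (1 + y⁻¹) ^ (n + 1) * ((1 + ‖u.2‖) ^ (n + 1))⁻¹ := by
  rw [kern_eq_conj, RCLike.norm_conj, norm_inv, norm_pow]
  have hre : (-I * u.2).re = u.2.im := by simp
  have h1 := norm_le_norm_ofReal_add (r := y) (v := -I * u.2) hy.le (by rw [hre]; exact hu)
  have h2 := le_norm_ofReal_add (r := y) (v := -I * u.2)
  rw [norm_neg_I_mul] at h1
  rw [hre] at h2
  have h3 := one_add_le_of_le hy (show y ≤ ‖(y : ℂ) + -I * u.2‖ by linarith) h1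
  have h4 : 0 < ‖(y : ℂ) + -I * u.2‖ := by linarith
  rw [← div_eq_mul_inv, ← div_pow, ← inv_pow]
  gcongr
  rw [le_div_iff₀ (by positivity), inv_mul_eq_div, div_le_iff₀ h4]
  exact h3

theorem ae_im_nonneg (n : ℕ) : ∀ᵐ u ∂(boundaryMeasure n), 0 ≤ u.2.im := by
  filter_upwards [ae_boundary n] with u hu
  rw [hu]; exact sqNorm_nonneg _

theorem memLp_kern (n : ℕ) {y : ℝ} (hy : 0 < y) : MemLp (kern n y) 2 (boundaryMeasure n) := by
  refine ((memLp_inv_one_add_pow n).const_mul ((1 + y⁻¹) ^ (n + 1))).of_le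
    (measurable_kern n y).aestronglyMeasurable ?_
  filter_upwards [ae_im_nonneg n] with u hu
  refine (norm_kern_le hy hu).trans (le_abs_self _)

/-- For t > 0 the function G(· + t𝐢) B is holomorphic past the boundary and decays quadratically on
the axis, G being bounded there by `exists_bound_axis`. The formula for it passes to t → 0 by
convergence in L². The factor B is what determines the projection of conj(B) times a kernel. -/
theorem integral_mul_mul_kern {n : ℕ} {G g : Space n → ℂ} (hG : MemHardy 2 G)
    (hg : IsBoundaryValue G g) {y : ℝ} (hy : 0 < y) {B : ℂ → ℂ} {δ C : ℝ} (hδ : 0 < δ)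
    (hB : DifferentiableOn ℂ B {w | -δ < w.im})
    (hBb : ∀ w : ℂ, 0 ≤ w.im → ‖B w‖ ≤ C * (1 + ‖w‖ ^ 2)⁻¹) :
    ∫ u, g u * (B u.2 * kern n y u) ∂(boundaryMeasure n) =
      2 * Real.pi * fiberConst n * (G (0, y * I) * B (y * I)) := by
  have hC : 0 ≤ C := by
    have := (norm_nonneg _).trans (hBb 0 (by simp))
    exact nonneg_of_mul_nonneg_left this (by positivity)
  have hBc : ∀ w : ℂ, 0 ≤ w.im → ‖B w‖ ≤ C := fun w hw =>
    (hBb w hw).trans (mul_le_of_le_one_right hC (inv_le_one_of_one_le₀ (by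
      have := sq_nonneg ‖w‖; linarith)))
  have hBm : AEStronglyMeasurable (fun u : Space n => B u.2) (boundaryMeasure n) := by
    refine aestronglyMeasurable_boundary (hB.continuousOn.comp (by fun_prop) fun u hu => ?_)
    have : u.2.im = sqNorm u.1 := hu
    show -δ < u.2.im
    rw [this]; linarith [sqNorm_nonneg u.1]
  have hBk : MemLp (fun u => B u.2 * kern n y u) 2 (boundaryMeasure n) := by
    refine ((memLp_kern n hy).const_mul (C : ℂ)).of_le
      (hBm.mul (measurable_kern n y).aestronglyMeasurable) ?_
    filter_upwards [ae_im_nonneg n] with u hu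
    rw [norm_mul, norm_mul, Complex.norm_of_nonneg hC]
    gcongr
    exact hBc _ hu
  have hval : ∀ t : ℝ, 0 < t → ∫ u, G (shift t u) * (B u.2 * kern n y u) ∂(boundaryMeasure n) =
      2 * Real.pi * fiberConst n * (G (shift t (0, y * I)) * B (y * I)) := by
    intro t ht
    obtain ⟨C₁, hC₁⟩ := exists_bound_axis hG ht
    have hH : DifferentiableOn ℂ (fun u : Space n => G (shift t u) * B u.2)
        {z | sqNorm z.1 < z.2.im + min t δ} := by
      refine DifferentiableOn.mul (hG.1.comp ?_ fun z hz => ?_) (hB.comp (by fun_prop) fun z hz => ?_)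
      · unfold shift; fun_prop
      · have hz' : sqNorm z.1 < z.2.im + min t δ := hz
        show sqNorm z.1 < (z.2 + (t : ℂ) * I).im
        simp only [add_im, mul_im, ofReal_re, I_im, mul_one, ofReal_im, I_re, mul_zero, add_zero]
        linarith [min_le_left t δ]
      · have hz' : sqNorm z.1 < z.2.im + min t δ := hz
        show -δ < z.2.im
        linarith [min_le_right t δ, sqNorm_nonneg z.1]
    have key := integral_mul_kern_of_decay (C := C₁ * C) (lt_min ht hδ) hy hH ?_ ?_
    · rw [← key]
      simp_rw [mul_assoc]
    · simp_rw [mul_assoc]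
      exact (memLp_shift hG ht).integrable_mul hBk
    · intro w hw
      have h1 : ‖G (shift t (0, w))‖ ≤ C₁ := by
        refine hC₁ (w + t * I) ?_
        simpa using hw
      rw [norm_mul, mul_assoc]
      exact mul_le_mul h1 (hBb w hw) (norm_nonneg _) ((norm_nonneg _).trans h1)
  have hlim1 : Tendsto (fun t : ℝ => 2 * Real.pi * fiberConst n *
      (G (shift t (0, y * I)) * B (y * I))) (𝓝[>] 0)
      (𝓝 (2 * Real.pi * fiberConst n * (G (0, y * I) * B (y * I)))) := by
    refine Tendsto.const_mul _ (Tendsto.mul_const _ ?_)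
    have hc : ContinuousAt G (0, y * I) := by
      refine hG.1.continuousOn.continuousAt ((isOpen_upperHalfSpace n).mem_nhds ?_)
      simp [upperHalfSpace, hy]
    have hs : Tendsto (fun t : ℝ => shift t ((0, y * I) : Space n)) (𝓝[>] 0) (𝓝 (0, y * I)) := by
      have : Continuous fun t : ℝ => shift t ((0, y * I) : Space n) := by unfold shift; fun_prop
      have h := this.tendsto 0
      simp only [shift, ofReal_zero, zero_mul, add_zero] at h
      exact h.mono_left nhdsWithin_le_nhds
    exact hc.tendsto.comp hs
  have hlim2 : Tendsto (fun t : ℝ => ∫ u, G (shift t u) * (B u.2 * kern n y u) ∂(boundaryMeasure n))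
      (𝓝[>] 0) (𝓝 (∫ u, g u * (B u.2 * kern n y u) ∂(boundaryMeasure n))) := by
    rw [tendsto_iff_edist_tendsto_0]
    have hz : Tendsto (fun t : ℝ => eLpNorm (fun u => G (shift t u) - g u) 2 (boundaryMeasure n) *
        eLpNorm (fun u => B u.2 * kern n y u) 2 (boundaryMeasure n)) (𝓝[>] 0) (𝓝 0) := by
      have := ENNReal.Tendsto.mul_const hg.2 (Or.inr hBk.2.ne)
      simpa using this
    refine tendsto_of_tendsto_of_tendsto_of_le_of_le' tendsto_const_nhds hz
      (Eventually.of_forall fun _ => zero_le) ?_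
    filter_upwards [self_mem_nhdsWithin] with t ht
    have ht' : 0 < t := ht
    have hsub := integral_sub ((memLp_shift hG ht').integrable_mul hBk) (hg.1.integrable_mul hBk)
    simp only [Pi.mul_apply, ← sub_mul] at hsub
    rw [edist_eq_enorm_sub, ← hsub]
    exact enorm_integral_mul_le ((memLp_shift hG ht').1.sub hg.1.1) hBk.1
  refine tendsto_nhds_unique hlim2 (hlim1.congr' ?_)
  filter_upwards [self_mem_nhdsWithin] with t ht
  exact (hval t ht).symm

/-- The multiplier of `integral_mul_mul_kern` is removed by letting damping factors tend to 1. -/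
theorem integral_mul_kern {n : ℕ} {G g : Space n → ℂ} (hG : MemHardy 2 G)
    (hg : IsBoundaryValue G g) {y : ℝ} (hy : 0 < y) :
    ∫ u, g u * kern n y u ∂(boundaryMeasure n) = 2 * Real.pi * fiberConst n * G (0, y * I) := by
  set η : ℕ → ℝ := fun k => 1 / ((k : ℝ) + 1) with hη
  have hη0 : ∀ k, 0 < η k := fun k => by simp only [hη]; positivity
  have hη1 : ∀ k, η k ≤ 1 := fun k => by
    simp only [hη]
    rw [div_le_one (by positivity)]
    have : (0 : ℝ) ≤ k := Nat.cast_nonneg k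
    linarith
  have hηlim : Tendsto η atTop (𝓝 0) := tendsto_one_div_add_atTop_nhds_zero_nat
  -- Bounded by 1 and quadratically decaying on the closed upper half-plane, with pole at -i/η k,
  -- hence holomorphic on Im w > -1.
  set B : ℕ → ℂ → ℂ := fun k w => ((1 + -I * (η k * w)) ^ 2)⁻¹ with hB
  have hsq : ∀ k (w : ℂ), 0 ≤ w.im → 1 + η k ^ 2 * ‖w‖ ^ 2 ≤ ‖1 + -I * (η k * w)‖ ^ 2 := by
    intro k w hw
    have h0 := hη0 k
    rw [← Complex.normSq_eq_norm_sq, ← Complex.normSq_eq_norm_sq, Complex.normSq_apply,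
      Complex.normSq_apply]
    simp
    nlinarith [mul_nonneg h0.le hw]
  have hval : ∀ k, ∫ u, g u * (B k u.2 * kern n y u) ∂(boundaryMeasure n) =
      2 * Real.pi * fiberConst n * (G (0, y * I) * B k (y * I)) := by
    intro k
    refine integral_mul_mul_kern (δ := 1) (C := (η k ^ 2)⁻¹) hG hg hy one_pos ?_ ?_
    · refine DifferentiableOn.inv (by fun_prop) fun w hw => pow_ne_zero _ fun h => ?_
      have hw' : -1 < w.im := hw
      have := congrArg Complex.re h
      simp only [add_re, one_re, mul_re, neg_re, I_re, neg_zero, zero_mul, neg_im, I_im, mul_im,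
        ofReal_re, ofReal_im, zero_re, add_zero, zero_sub] at this
      nlinarith [hη0 k, hη1 k]
    · intro w hw
      simp only [hB]
      rw [norm_inv, norm_pow, ← mul_inv]
      have h0 := hη0 k
      have h1 : η k ^ 2 ≤ 1 := pow_le_one₀ h0.le (hη1 k)
      gcongr
      refine le_trans ?_ (hsq k w hw)
      nlinarith
  have hlim1 : Tendsto (fun k => 2 * Real.pi * fiberConst n * (G (0, y * I) * B k (y * I))) atTop
      (𝓝 (2 * Real.pi * fiberConst n * G (0, y * I))) := by
    have h1 : Tendsto (fun k => B k (y * I)) atTop (𝓝 (((1 + -I * ((0 : ℝ) * (y * I))) ^ 2)⁻¹)) := by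
      refine Tendsto.inv₀ (Tendsto.pow (Tendsto.const_add _ (Tendsto.const_mul _
        (Tendsto.mul_const _ ?_))) _) (by simp)
      exact (Complex.continuous_ofReal.tendsto _).comp hηlim
    have h2 := ((h1.const_mul (G (0, y * I))).const_mul (2 * Real.pi * fiberConst n : ℂ))
    simpa using h2
  have hlim2 : Tendsto (fun k => ∫ u, g u * (B k u.2 * kern n y u) ∂(boundaryMeasure n)) atTop
      (𝓝 (∫ u, g u * kern n y u ∂(boundaryMeasure n))) := by
    refine tendsto_integral_of_dominated_convergence (fun u => ‖g u * kern n y u‖) (fun k => ?_)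
      (hg.1.integrable_mul (memLp_kern n hy)).norm (fun k => ?_) (ae_of_all _ fun u => ?_)
    · refine hg.1.1.mul (AEStronglyMeasurable.mul ?_ (measurable_kern n y).aestronglyMeasurable)
      exact (by simp only [hB]; fun_prop : Measurable fun u : Space n => B k u.2).aestronglyMeasurable
    · filter_upwards [ae_im_nonneg n] with u hu
      rw [norm_mul, norm_mul, norm_mul]
      refine mul_le_mul_of_nonneg_left (mul_le_of_le_one_left (norm_nonneg _) ?_) (norm_nonneg _)
      simp only [hB]
      rw [norm_inv, norm_pow]
      refine inv_le_one_of_one_le₀ (le_trans ?_ (hsq k _ hu))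
      have : 0 ≤ η k ^ 2 * ‖u.2‖ ^ 2 := by positivity
      linarith
    · have h1 : Tendsto (fun k => B k u.2) atTop (𝓝 (((1 + -I * ((0 : ℝ) * u.2)) ^ 2)⁻¹)) := by
        refine Tendsto.inv₀ (Tendsto.pow (Tendsto.const_add _ (Tendsto.const_mul _
          (Tendsto.mul_const _ ?_))) _) (by simp)
        exact (Complex.continuous_ofReal.tendsto _).comp hηlim
      have h2 := (h1.mul_const (kern n y u)).const_mul (g u)
      simpa using h2
  refine tendsto_nhds_unique hlim2 (hlim1.congr fun k => (hval k).symm)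

/-! ### Test functions and their projections -/

theorem integral_mul_transform {n : ℕ} {ε : ℝ} {φ : ℝ → ℂ} {ψ : Space n → ℂ} {α : ℝ → ℝ}
    {γ : Space n → ℝ} (hφ : AEStronglyMeasurable φ (volume.restrict (Ioi 0)))
    (hψ : AEStronglyMeasurable ψ (boundaryMeasure n)) (hα : IntegrableOn α (Ioi 0))
    (hγ : Integrable γ (boundaryMeasure n))
    (hb : ∀ y : ℝ, 0 < y → ∀ u : Space n, 0 ≤ u.2.im →
      ‖φ y * (ψ u * kern n (ε + y) u)‖ ≤ α y * γ u) :
    ∫ u, ψ u * (∫ y in Ioi (0 : ℝ), φ y * kern n (ε + y) u) ∂(boundaryMeasure n) =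
      ∫ y in Ioi (0 : ℝ), φ y * (∫ u, ψ u * kern n (ε + y) u ∂(boundaryMeasure n)) := by
  have : SFinite (boundaryMeasure n) := by unfold boundaryMeasure; infer_instance
  have hk : Measurable fun p : ℝ × Space n => kern n (ε + p.1) p.2 := by
    unfold kern
    have : Measurable fun p : ℝ × Space n => (starRingEnd ℂ) p.2.2 :=
      Complex.continuous_conj.measurable.comp (measurable_snd.comp measurable_snd)
    fun_prop
  have hint : Integrable (Function.uncurry fun (y : ℝ) (u : Space n) =>
      φ y * (ψ u * kern n (ε + y) u)) ((volume.restrict (Ioi 0)).prod (boundaryMeasure n)) := by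
    refine (Integrable.mul_prod hα hγ).mono' ?_ ?_
    · exact hφ.comp_fst.mul (hψ.comp_snd.mul hk.aestronglyMeasurable)
    · have h1 : ∀ᵐ p : ℝ × Space n ∂((volume.restrict (Ioi 0)).prod (boundaryMeasure n)),
          0 < p.1 := Measure.quasiMeasurePreserving_fst.ae (ae_restrict_mem measurableSet_Ioi)
      have h2 : ∀ᵐ p : ℝ × Space n ∂((volume.restrict (Ioi 0)).prod (boundaryMeasure n)),
          0 ≤ p.2.2.im := Measure.quasiMeasurePreserving_snd.ae (ae_im_nonneg n)
      filter_upwards [h1, h2] with p hp1 hp2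
      exact hb p.1 hp1 p.2 hp2
  have hsw := integral_integral_swap hint
  simp_rw [← integral_const_mul]
  rw [hsw]
  refine integral_congr_ae (ae_of_all _ fun u => ?_)
  refine integral_congr_ae (ae_of_all _ fun y => ?_)
  beta_reduce
  ring

/-- The test function `v^{-a} \bar{B(v)}`, where `v = ε - i u_{n+1}`. -/
noncomputable def testFun {n : ℕ} (a ε : ℝ) (B : ℂ → ℂ) (u : Space n) : ℂ :=
  ((ε : ℂ) + -I * u.2) ^ (-a : ℂ) * (starRingEnd ℂ) (B ((ε : ℂ) + -I * u.2))

/-- The Cauchy–Szegő projection of `testFun a ε B`, as an integral of Cauchy–Szegő kernels. -/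
noncomputable def testProj {n : ℕ} (a ε : ℝ) (B : ℂ → ℂ) (z : Space n) : ℂ :=
  (betaConst (n + 1) a : ℂ)⁻¹ * ∫ y in Ioi (0 : ℝ),
    ((y ^ ((n : ℝ) - a) : ℝ) * (starRingEnd ℂ) (B ((2 * ε + y : ℝ) : ℂ))) *
      (((y : ℂ) + ((ε : ℂ) + -I * z.2)) ^ (n + 1))⁻¹

section

variable {n : ℕ} {a ε C : ℝ} {B : ℂ → ℂ}

theorem re_add_neg_I_mul (ε : ℝ) (w : ℂ) : ((ε : ℂ) + -I * w).re = ε + w.im := by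
  simp

theorem norm_le_norm_add_neg_I_mul (hε : 0 < ε) {w : ℂ} (hw : 0 ≤ w.im) :
    ‖w‖ ≤ ‖(ε : ℂ) + -I * w‖ := by
  have := norm_le_norm_ofReal_add (r := ε) (v := -I * w) hε.le (by simpa using hw)
  rwa [norm_neg_I_mul] at this

theorem le_norm_add_neg_I_mul {w : ℂ} (hw : 0 ≤ w.im) : ε ≤ ‖(ε : ℂ) + -I * w‖ := by
  have := Complex.re_le_norm ((ε : ℂ) + -I * w)
  rw [re_add_neg_I_mul] at this
  linarith

theorem norm_inv_add_pow_le (hε : 0 < ε) {w : ℂ} (hw : 0 ≤ w.im) {y : ℝ} (hy : 0 ≤ y) (N : ℕ) :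
    ‖(((y : ℂ) + ((ε : ℂ) + -I * w)) ^ N)⁻¹‖ ≤ (1 + ε⁻¹) ^ N * ((1 + ‖w‖) ^ N)⁻¹ := by
  have h0 := norm_le_norm_ofReal_add (r := y) (v := (ε : ℂ) + -I * w) hy
    (by rw [re_add_neg_I_mul]; linarith)
  have h1 := norm_le_norm_add_neg_I_mul hε hw
  have h2 := le_norm_add_neg_I_mul (ε := ε) hw
  have h3 := one_add_le_of_le hε (h2.trans h0) (h1.trans h0)
  have h4 : 0 < ‖(y : ℂ) + ((ε : ℂ) + -I * w)‖ := by linarith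
  rw [norm_inv, norm_pow, ← div_eq_mul_inv, ← div_pow, ← inv_pow]
  gcongr
  rw [le_div_iff₀ (by positivity), inv_mul_eq_div, div_le_iff₀ h4]
  exact h3

theorem differentiableOn_comp_neg_I (hB : DifferentiableOn ℂ B {v | 0 < v.re}) :
    DifferentiableOn ℂ (fun w => B ((ε : ℂ) + -I * w)) {w | -ε < w.im} := by
  refine hB.comp (by fun_prop) fun w (hw : -ε < w.im) => ?_
  show 0 < ((ε : ℂ) + -I * w).re
  rw [re_add_neg_I_mul]; linarith

theorem const_nonneg_of_bound
    (hBb : ∀ v : ℂ, ε ≤ v.re → ‖B v‖ ≤ C * ((1 + ‖v‖) ^ (n + 2))⁻¹) : 0 ≤ C := by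
  have := (norm_nonneg _).trans (hBb ε (by simp))
  exact nonneg_of_mul_nonneg_left this (by positivity)

theorem norm_comp_neg_I_le (hε : 0 < ε)
    (hBb : ∀ v : ℂ, ε ≤ v.re → ‖B v‖ ≤ C * ((1 + ‖v‖) ^ (n + 2))⁻¹) {w : ℂ} (hw : 0 ≤ w.im) :
    ‖B ((ε : ℂ) + -I * w)‖ ≤ C * ((1 + ‖w‖) ^ (n + 2))⁻¹ := by
  have hC := const_nonneg_of_bound hBb
  refine (hBb _ (by rw [re_add_neg_I_mul]; linarith)).trans ?_
  gcongr
  exact norm_le_norm_add_neg_I_mul hε hw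

theorem inv_one_add_pow_succ_le {N : ℝ} (hN : 0 ≤ N) (n : ℕ) :
    ((1 + N) ^ (n + 2))⁻¹ ≤ ((1 + N) ^ (n + 1))⁻¹ := by
  gcongr
  · linarith
  · omega

theorem memLp_comp_neg_I (hε : 0 < ε) (hB : DifferentiableOn ℂ B {v | 0 < v.re})
    (hBb : ∀ v : ℂ, ε ≤ v.re → ‖B v‖ ≤ C * ((1 + ‖v‖) ^ (n + 2))⁻¹) :
    MemLp (fun u : Space n => B ((ε : ℂ) + -I * u.2)) 2 (boundaryMeasure n) := by
  have hC := const_nonneg_of_bound hBb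
  refine ((memLp_inv_one_add_pow n).const_mul C).of_le ?_ ?_
  · refine aestronglyMeasurable_boundary ((differentiableOn_comp_neg_I (ε := ε) hB).continuousOn.comp
      (by fun_prop) fun u hu => ?_)
    have : u.2.im = sqNorm u.1 := hu
    show -ε < u.2.im
    rw [this]; linarith [sqNorm_nonneg u.1]
  · filter_upwards [ae_im_nonneg n] with u hu
    refine (norm_comp_neg_I_le hε hBb hu).trans (le_trans ?_ (le_abs_self _))
    exact mul_le_mul_of_nonneg_left (inv_one_add_pow_succ_le (norm_nonneg _) n) hC

theorem continuousOn_testFun (hε : 0 < ε) (hB : DifferentiableOn ℂ B {v | 0 < v.re}) :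
    ContinuousOn (testFun (n := n) a ε B) {u | u.2.im = sqNorm u.1} := by
  have hpos : ∀ u ∈ {u : Space n | u.2.im = sqNorm u.1}, 0 < ((ε : ℂ) + -I * u.2).re := by
    intro u hu
    have : u.2.im = sqNorm u.1 := hu
    rw [re_add_neg_I_mul, this]; linarith [sqNorm_nonneg u.1]
  refine ContinuousOn.mul ?_ (Complex.continuous_conj.comp_continuousOn
    (hB.continuousOn.comp (by fun_prop) hpos))
  exact ContinuousOn.cpow (by fun_prop) continuousOn_const fun u hu => Or.inl (hpos u hu)

theorem memLp_testFun (ha : 0 < a) (hε : 0 < ε) (hB : DifferentiableOn ℂ B {v | 0 < v.re})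
    (hBb : ∀ v : ℂ, ε ≤ v.re → ‖B v‖ ≤ C * ((1 + ‖v‖) ^ (n + 2))⁻¹) :
    MemLp (testFun (n := n) a ε B) 2 (boundaryMeasure n) := by
  refine ((memLp_comp_neg_I (n := n) hε hB hBb).const_mul ((ε ^ (-a) : ℝ) : ℂ)).of_le
    (aestronglyMeasurable_boundary (continuousOn_testFun hε hB)) ?_
  filter_upwards [ae_im_nonneg n] with u hu
  rw [testFun, norm_mul, norm_mul, RCLike.norm_conj, show (-a : ℂ) = ((-a : ℝ) : ℂ) by push_cast; rfl,
    Complex.norm_cpow_real, Complex.norm_of_nonneg (by positivity)]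
  gcongr ?_ * _
  exact Real.rpow_le_rpow_of_nonpos hε (le_norm_add_neg_I_mul hu) (by linarith)

theorem integrableOn_weight (ha : 0 < a) (han : a < n + 1) :
    IntegrableOn (fun y : ℝ => y ^ ((n : ℝ) - a) * ((1 + y) ^ (n + 1))⁻¹) (Ioi 0) :=
  integrableOn_rpow_mul_inv_pow (by linarith) (by push_cast; linarith)

theorem aestronglyMeasurable_symbol (hε : 0 < ε) (hB : DifferentiableOn ℂ B {v | 0 < v.re}) :
    AEStronglyMeasurable (fun y : ℝ => B ((2 * ε + y : ℝ) : ℂ)) (volume.restrict (Ioi 0)) := by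
  refine ContinuousOn.aestronglyMeasurable (hB.continuousOn.comp ?_ fun y hy => ?_) measurableSet_Ioi
  · exact (by fun_prop : Continuous fun y : ℝ => ((2 * ε + y : ℝ) : ℂ)).continuousOn
  · have : 0 < y := hy
    show 0 < ((2 * ε + y : ℝ) : ℂ).re
    rw [ofReal_re]; linarith

theorem norm_symbol_le (hε : 0 < ε)
    (hBb : ∀ v : ℂ, ε ≤ v.re → ‖B v‖ ≤ C * ((1 + ‖v‖) ^ (n + 2))⁻¹) {y : ℝ} (hy : 0 < y) :
    ‖B ((2 * ε + y : ℝ) : ℂ)‖ ≤ C * ((1 + y) ^ (n + 1))⁻¹ := by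
  have hC := const_nonneg_of_bound hBb
  refine (hBb _ (by rw [ofReal_re]; linarith)).trans ?_
  refine mul_le_mul_of_nonneg_left ?_ hC
  refine (inv_one_add_pow_succ_le (norm_nonneg _) n).trans ?_
  rw [Complex.norm_of_nonneg (by linarith)]
  gcongr
  linarith

theorem norm_weight_mul_symbol_le (hε : 0 < ε)
    (hBb : ∀ v : ℂ, ε ≤ v.re → ‖B v‖ ≤ C * ((1 + ‖v‖) ^ (n + 2))⁻¹) {y : ℝ} (hy : 0 < y) :
    ‖((y ^ ((n : ℝ) - a) : ℝ) : ℂ) * B ((2 * ε + y : ℝ) : ℂ)‖ ≤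
      C * (y ^ ((n : ℝ) - a) * ((1 + y) ^ (n + 1))⁻¹) := by
  rw [norm_mul, Complex.norm_of_nonneg (by positivity)]
  calc _ ≤ y ^ ((n : ℝ) - a) * (C * ((1 + y) ^ (n + 1))⁻¹) := by
        gcongr; exact norm_symbol_le hε hBb hy
    _ = _ := by ring

theorem differentiableOn_testProj (ha : 0 < a) (han : a < n + 1) (hε : 0 < ε)
    (hB : DifferentiableOn ℂ B {v | 0 < v.re})
    (hBb : ∀ v : ℂ, ε ≤ v.re → ‖B v‖ ≤ C * ((1 + ‖v‖) ^ (n + 2))⁻¹) :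
    DifferentiableOn ℂ (testProj (n := n) a ε B) {z | -ε < z.2.im} := by
  have hm : AEStronglyMeasurable (fun y : ℝ => ((y ^ ((n : ℝ) - a) : ℝ) : ℂ) *
      (starRingEnd ℂ) (B ((2 * ε + y : ℝ) : ℂ))) (volume.restrict (Ioi 0)) :=
    (by fun_prop : Measurable fun y : ℝ => ((y ^ ((n : ℝ) - a) : ℝ) : ℂ)).aestronglyMeasurable.mul
      (Complex.continuous_conj.comp_aestronglyMeasurable (aestronglyMeasurable_symbol hε hB))
  have h := differentiableOn_stieltjes (μ := volume.restrict (Ioi (0 : ℝ))) (ρ := id) measurable_id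
    ((ae_restrict_mem measurableSet_Ioi).mono fun y (hy : 0 < y) => hy.le) hm (N := n + 1) ?_
  · unfold testProj
    refine DifferentiableOn.const_mul (h.comp (t := {v : ℂ | 0 < v.re})
      (f := fun z : Space n => (ε : ℂ) + -I * z.2) (by fun_prop) fun z hz => ?_) _
    have hz' : -ε < z.2.im := hz
    show 0 < ((ε : ℂ) + -I * z.2).re
    rw [re_add_neg_I_mul]; linarith
  · refine ((integrableOn_weight (n := n) ha han).const_mul C).mono' ?_ ?_
    · exact hm.norm.mul (by fun_prop : Measurable fun y : ℝ =>
        ((1 + id y) ^ (n + 1))⁻¹).aestronglyMeasurable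
    · refine (ae_restrict_mem measurableSet_Ioi).mono fun y (hy : 0 < y) => ?_
      have h1 := norm_weight_mul_symbol_le (a := a) hε hBb hy
      rw [norm_mul, norm_norm, norm_mul, RCLike.norm_conj, ← norm_mul,
        Real.norm_of_nonneg (by simp only [id]; positivity)]
      refine (mul_le_of_le_one_right (norm_nonneg _) (inv_le_one_of_one_le₀ ?_)).trans h1
      exact one_le_pow₀ (by simp only [id]; linarith)

/-- The majorant is in L²(β) and, being decreasing in ‖z.2‖, also dominates all upward translates.
It thus yields both membership in H² and convergence to the boundary value. -/
theorem exists_norm_testProj_le (ha : 0 < a) (han : a < n + 1) (hε : 0 < ε)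
    (hBb : ∀ v : ℂ, ε ≤ v.re → ‖B v‖ ≤ C * ((1 + ‖v‖) ^ (n + 2))⁻¹) :
    ∃ C' : ℝ, ∀ z : Space n, 0 ≤ z.2.im →
      ‖testProj a ε B z‖ ≤ C' * ((1 + ‖z.2‖) ^ (n + 1))⁻¹ := by
  have hC := const_nonneg_of_bound hBb
  have hw := integrableOn_weight (n := n) ha han
  refine ⟨‖(betaConst (n + 1) a : ℂ)⁻¹‖ * ((1 + ε⁻¹) ^ (n + 1) * (C * ∫ y in Ioi (0 : ℝ),
    y ^ ((n : ℝ) - a) * ((1 + y) ^ (n + 1))⁻¹)), fun z hz => ?_⟩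
  rw [testProj, norm_mul, mul_assoc]
  gcongr
  calc _ ≤ ∫ y in Ioi (0 : ℝ), ((1 + ε⁻¹) ^ (n + 1) * ((1 + ‖z.2‖) ^ (n + 1))⁻¹) *
        (C * (y ^ ((n : ℝ) - a) * ((1 + y) ^ (n + 1))⁻¹)) := by
        refine norm_integral_le_of_norm_le ((hw.const_mul _).const_mul _) ?_
        refine (ae_restrict_mem measurableSet_Ioi).mono fun y (hy : 0 < y) => ?_
        have h1 := norm_weight_mul_symbol_le (a := a) hε hBb hy
        rw [norm_mul, norm_mul, RCLike.norm_conj, ← norm_mul, mul_comm]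
        exact mul_le_mul (norm_inv_add_pow_le hε hz hy.le _) h1 (norm_nonneg _) (by positivity)
    _ = _ := by
        rw [integral_const_mul, integral_const_mul]; ring

theorem upperHalfSpace_subset (hε : 0 < ε) : upperHalfSpace n ⊆ {z | -ε < z.2.im} := fun z hz => by
  have : sqNorm z.1 < z.2.im := hz
  show -ε < z.2.im
  linarith [sqNorm_nonneg z.1]

theorem norm_shift_snd_ge {t : ℝ} (ht : 0 ≤ t) {u : Space n} (hu : 0 ≤ u.2.im) :
    ‖u.2‖ ≤ ‖(shift t u).2‖ := by
  rw [Complex.norm_eq_sqrt_sq_add_sq, Complex.norm_eq_sqrt_sq_add_sq]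
  apply Real.sqrt_le_sqrt
  simp [shift]
  nlinarith

theorem shift_snd_im (t : ℝ) (u : Space n) : (shift t u).2.im = u.2.im + t := by
  simp [shift]

theorem norm_testProj_shift_le {C' : ℝ} (hC' : ∀ z : Space n, 0 ≤ z.2.im →
      ‖testProj a ε B z‖ ≤ C' * ((1 + ‖z.2‖) ^ (n + 1))⁻¹) {t : ℝ} (ht : 0 ≤ t) {u : Space n}
      (hu : 0 ≤ u.2.im) : ‖testProj a ε B (shift t u)‖ ≤ C' * ((1 + ‖u.2‖) ^ (n + 1))⁻¹ := by
  have h0 := hC' (shift t u) (by rw [shift_snd_im]; linarith)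
  have hC0 : 0 ≤ C' := nonneg_of_mul_nonneg_left ((norm_nonneg _).trans h0) (by positivity)
  refine h0.trans ?_
  gcongr
  exact norm_shift_snd_ge ht hu

theorem memHardy_testProj (ha : 0 < a) (han : a < n + 1) (hε : 0 < ε)
    (hB : DifferentiableOn ℂ B {v | 0 < v.re})
    (hBb : ∀ v : ℂ, ε ≤ v.re → ‖B v‖ ≤ C * ((1 + ‖v‖) ^ (n + 2))⁻¹) :
    MemHardy 2 (testProj (n := n) a ε B) := by
  refine ⟨(differentiableOn_testProj ha han hε hB hBb).mono (upperHalfSpace_subset hε), ?_⟩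
  obtain ⟨C', hC'⟩ := exists_norm_testProj_le ha han hε hBb
  refine lt_of_le_of_lt ?_ ((memLp_inv_one_add_pow n).const_mul C').2
  refine iSup₂_le fun t ht => ?_
  rw [ENNReal.ofReal_ofNat]
  refine eLpNorm_mono_ae ?_
  filter_upwards [ae_im_nonneg n] with u hu
  exact (norm_testProj_shift_le hC' ht.le hu).trans (le_abs_self _)

theorem shift_zero (u : Space n) : shift 0 u = u := by simp [shift]

/-- The function is holomorphic on Im z_{n+1} > -ε, so it is its own boundary value, by dominated
convergence. -/
theorem isBoundaryValue_testProj (ha : 0 < a) (han : a < n + 1) (hε : 0 < ε)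
    (hB : DifferentiableOn ℂ B {v | 0 < v.re})
    (hBb : ∀ v : ℂ, ε ≤ v.re → ‖B v‖ ≤ C * ((1 + ‖v‖) ^ (n + 2))⁻¹) :
    IsBoundaryValue (testProj (n := n) a ε B) (testProj a ε B) := by
  obtain ⟨C', hC'⟩ := exists_norm_testProj_le ha han hε hBb
  have hd := differentiableOn_testProj (n := n) ha han hε hB hBb
  have hL := (memLp_inv_one_add_pow n).const_mul C'
  have hsub : {u : Space n | u.2.im = sqNorm u.1} ⊆ {z | -ε < z.2.im} := fun u hu => by
    have : u.2.im = sqNorm u.1 := hu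
    show -ε < u.2.im
    rw [this]; linarith [sqNorm_nonneg u.1]
  have hm : AEStronglyMeasurable (testProj (n := n) a ε B) (boundaryMeasure n) :=
    aestronglyMeasurable_boundary (hd.continuousOn.mono hsub)
  have hmt : ∀ t : ℝ, 0 < t → AEStronglyMeasurable (fun u => testProj (n := n) a ε B (shift t u))
      (boundaryMeasure n) := fun t ht => aestronglyMeasurable_boundary
    (continuousOn_comp_shift (hd.continuousOn.mono (upperHalfSpace_subset hε)) ht)
  have hle : ∀ t : ℝ, 0 ≤ t → ∀ᵐ u ∂(boundaryMeasure n),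
      ‖testProj a ε B (shift t u)‖ ≤ C' * ((1 + ‖u.2‖) ^ (n + 1))⁻¹ := fun t ht => by
    filter_upwards [ae_im_nonneg n] with u hu
    exact norm_testProj_shift_le hC' ht hu
  refine ⟨hL.of_le hm ?_, ?_⟩
  · filter_upwards [hle 0 le_rfl] with u hu
    rw [shift_zero] at hu
    exact hu.trans (le_abs_self _)
  · have hsq : ∀ t : ℝ, eLpNorm (fun u => testProj a ε B (shift t u) - testProj a ε B u) 2
        (boundaryMeasure n) = (∫⁻ u, ‖testProj a ε B (shift t u) - testProj a ε B u‖ₑ ^ (2 : ℝ)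
          ∂(boundaryMeasure n)) ^ (1 / 2 : ℝ) := by
      intro t
      rw [eLpNorm_eq_lintegral_rpow_enorm_toReal two_ne_zero (by simp)]
      simp
    simp_rw [hsq]
    have hlim : Tendsto (fun t : ℝ => ∫⁻ u, ‖testProj a ε B (shift t u) - testProj a ε B u‖ₑ ^ (2 : ℝ)
          ∂(boundaryMeasure n)) (𝓝[>] 0) (𝓝 (∫⁻ _, 0 ∂(boundaryMeasure n))) := by
      refine tendsto_lintegral_filter_of_dominated_convergence'
        (fun u => ‖2 * (C' * ((1 + ‖u.2‖) ^ (n + 1))⁻¹)‖ₑ ^ (2 : ℝ)) ?_ ?_ ?_ ?_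
      · filter_upwards [self_mem_nhdsWithin] with t ht
        exact ((hmt t ht).sub hm).enorm.pow_const _
      · filter_upwards [self_mem_nhdsWithin] with t ht
        filter_upwards [hle 0 le_rfl, hle t (le_of_lt ht)] with u h1 h2
        rw [shift_zero] at h1
        gcongr
        rw [← ofReal_norm, ← ofReal_norm]
        apply ENNReal.ofReal_le_ofReal
        refine (norm_sub_le _ _).trans (le_trans ?_ (le_abs_self _))
        linarith
      · have := (hL.const_mul 2).eLpNorm_ne_top
        intro h
        refine this ?_
        rw [eLpNorm_eq_lintegral_rpow_enorm_toReal two_ne_zero (by simp)]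
        simp only [ENNReal.toReal_ofNat]
        rw [h]
        simp
      · filter_upwards [ae_boundary n] with u hu
        have hc : ContinuousAt (testProj (n := n) a ε B) u := by
          refine hd.continuousOn.continuousAt (IsOpen.mem_nhds ?_ (hsub hu))
          exact isOpen_lt (by fun_prop) (by fun_prop)
        have hs : Tendsto (fun t : ℝ => shift t u) (𝓝[>] 0) (𝓝 u) := by
          have : Continuous fun t : ℝ => shift t u := by unfold shift; fun_prop
          have h := this.tendsto 0
          rw [shift_zero] at h
          exact h.mono_left nhdsWithin_le_nhds
        have h1 := ((hc.tendsto.comp hs).sub_const (testProj a ε B u)).enorm.ennrpow_const (2 : ℝ)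
        simpa [Function.comp_def] using h1
    rw [lintegral_zero] at hlim
    have := hlim.ennrpow_const (1 / 2 : ℝ)
    simpa using this

theorem kern_shift_eq (y : ℝ) (u : Space n) :
    kern n (ε + y) u = (starRingEnd ℂ) ((((y : ℂ) + ((ε : ℂ) + -I * u.2)) ^ (n + 1))⁻¹) := by
  rw [kern_eq_conj]
  congr 3
  push_cast; ring

theorem norm_kern_add_le (hε : 0 < ε) {u : Space n} (hu : 0 ≤ u.2.im) {y : ℝ} (hy : 0 < y) :
    ‖kern n (ε + y) u‖ ≤ ((min 1 ε) ^ (n + 1))⁻¹ * ((1 + y) ^ (n + 1))⁻¹ := by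
  rw [kern_shift_eq, RCLike.norm_conj]
  exact norm_inv_pow_le hy.le hε (by rw [re_add_neg_I_mul]; linarith)

/-- Both pairings with g ∈ H² equal the same integral of y^{n-a} G(w) B(2ε+y) over the poles w = (0,
i(ε+y)). For the test function, B multiplies g inside the reproducing formula and is evaluated at
the pole; for the candidate projection, that value is already there. -/
theorem isSzegoProjection_testFun (ha : 0 < a) (han : a < n + 1) (hε : 0 < ε)
    (hB : DifferentiableOn ℂ B {v | 0 < v.re})
    (hBb : ∀ v : ℂ, ε ≤ v.re → ‖B v‖ ≤ C * ((1 + ‖v‖) ^ (n + 2))⁻¹) :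
    IsSzegoProjection (n := n) (testFun a ε B) (testProj a ε B) := by
  have hC := const_nonneg_of_bound hBb
  have hf := memLp_testFun (n := n) ha hε hB hBb
  have hF := isBoundaryValue_testProj (n := n) ha han hε hB hBb
  refine ⟨hf, memHardy_testProj ha han hε hB hBb, _, hF, fun G g hG hg => ?_⟩
  set β := boundaryMeasure n with hβ
  set c : ℂ := (betaConst (n + 1) a : ℂ) with hc
  have hc0 : c ≠ 0 := by
    rw [hc]
    exact_mod_cast (betaConst_pos ha (by push_cast; exact han)).ne'
  set m : ℝ → ℂ := fun y => ((y ^ ((n : ℝ) - a) : ℝ) : ℂ) with hm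
  have hmm : Measurable m := by fun_prop
  set Bv : Space n → ℂ := fun u => B ((ε : ℂ) + -I * u.2) with hBv
  have hBvL : MemLp Bv 2 β := memLp_comp_neg_I (n := n) hε hB hBb
  have hW := integrableOn_weight (n := n) ha han
  -- At the pole (0, i(ε+y)) the variable ε - i u_{n+1} takes the value 2ε + y.
  have hreal : ∀ y : ℝ, (ε : ℂ) + -I * (((ε + y : ℝ) : ℂ) * I) = ((2 * ε + y : ℝ) : ℂ) := by
    intro y
    push_cast
    linear_combination (-((ε : ℂ) + y)) * I_sq
  -- pairing with the test function
  have hP1 : ∫ u, (starRingEnd ℂ) (testFun a ε B u) * g u ∂β =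
      c⁻¹ * ∫ y in Ioi (0 : ℝ), m y * (2 * Real.pi * fiberConst n *
        (G (0, ((ε + y : ℝ) : ℂ) * I) * B ((2 * ε + y : ℝ) : ℂ))) := by
    have h1 : ∀ᵐ u ∂β, (starRingEnd ℂ) (testFun a ε B u) * g u =
        c⁻¹ * ((g u * Bv u) * ∫ y in Ioi (0 : ℝ), m y * kern n (ε + y) u) := by
      filter_upwards [ae_im_nonneg n] with u hu
      have h2 := integral_rpow_mul_inv_pow_complex (N := n + 1) ha (by push_cast; exact han)
        (v := (ε : ℂ) + -I * u.2) (by rw [re_add_neg_I_mul]; linarith)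
      have h3 : ∫ y in Ioi (0 : ℝ), m y * kern n (ε + y) u =
          (starRingEnd ℂ) (c * ((ε : ℂ) + -I * u.2) ^ (-a : ℂ)) := by
        rw [← h2, ← integral_conj]
        refine integral_congr_ae (ae_of_all _ fun y => ?_)
        beta_reduce
        rw [map_mul, conj_ofReal, ← kern_shift_eq, hm]
        push_cast
        congr 3
        ring_nf
      rw [h3, testFun, map_mul, map_mul, conj_conj, hc, conj_ofReal, ← hc]
      field_simp
      rw [hBv]
      ring_nf
    rw [integral_congr_ae h1, integral_const_mul, integral_mul_transform (n := n) (ε := ε)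
      (φ := m) (ψ := fun u => g u * Bv u) (α := fun y => ((min 1 ε) ^ (n + 1))⁻¹ * (y ^ ((n : ℝ) - a) * ((1 + y) ^ (n + 1))⁻¹))
      (γ := fun u => ‖g u * Bv u‖) hmm.aestronglyMeasurable (hg.1.1.mul hBvL.1) (hW.const_mul _)
      (hg.1.integrable_mul hBvL).norm]
    · congr 1
      refine setIntegral_congr_fun measurableSet_Ioi fun y (hy : 0 < y) => ?_
      congr 1
      rw [← hreal y]
      rw [← integral_mul_mul_kern (B := fun w => B ((ε : ℂ) + -I * w)) (C := C) hG hg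
        (show 0 < ε + y by linarith) hε (differentiableOn_comp_neg_I hB)]
      · refine integral_congr_ae (ae_of_all _ fun u => ?_)
        simp only [hBv, mul_assoc]
      · intro w hw
        refine (norm_comp_neg_I_le hε hBb hw).trans ?_
        gcongr
        have h0 := norm_nonneg w
        calc 1 + ‖w‖ ^ 2 ≤ (1 + ‖w‖) ^ 2 := by nlinarith
          _ ≤ (1 + ‖w‖) ^ (n + 2) := pow_le_pow_right₀ (by linarith) (by omega)
    · intro y hy u hu
      have hk := norm_kern_add_le (n := n) hε hu hy
      rw [norm_mul, norm_mul, hm, Complex.norm_of_nonneg (by positivity)]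
      calc _ ≤ y ^ ((n : ℝ) - a) * (‖g u * Bv u‖ *
            (((min 1 ε) ^ (n + 1))⁻¹ * ((1 + y) ^ (n + 1))⁻¹)) := by gcongr
        _ = _ := by ring
  -- pairing with the projection
  have hP2 : ∫ u, (starRingEnd ℂ) (testProj a ε B u) * g u ∂β =
      c⁻¹ * ∫ y in Ioi (0 : ℝ), m y * (2 * Real.pi * fiberConst n *
        (G (0, ((ε + y : ℝ) : ℂ) * I) * B ((2 * ε + y : ℝ) : ℂ))) := by
    have h1 : ∀ u, (starRingEnd ℂ) (testProj a ε B u) * g u =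
        c⁻¹ * (g u * ∫ y in Ioi (0 : ℝ), (m y * B ((2 * ε + y : ℝ) : ℂ)) * kern n (ε + y) u) := by
      intro u
      have h3 : ∫ y in Ioi (0 : ℝ), (m y * B ((2 * ε + y : ℝ) : ℂ)) * kern n (ε + y) u =
          (starRingEnd ℂ) (∫ y in Ioi (0 : ℝ), ((y ^ ((n : ℝ) - a) : ℝ) *
            (starRingEnd ℂ) (B ((2 * ε + y : ℝ) : ℂ))) *
            (((y : ℂ) + ((ε : ℂ) + -I * u.2)) ^ (n + 1))⁻¹) := by
        rw [← integral_conj]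
        refine integral_congr_ae (ae_of_all _ fun y => ?_)
        beta_reduce
        rw [map_mul, map_mul, conj_ofReal, ← kern_shift_eq, hm, conj_conj]
      rw [h3, testProj, map_mul, map_inv₀, conj_ofReal]
      ring
    simp_rw [h1]
    rw [integral_const_mul, integral_mul_transform (n := n) (ε := ε)
      (φ := fun y => m y * B ((2 * ε + y : ℝ) : ℂ)) (ψ := g) (α := fun y => C * (y ^ ((n : ℝ) - a) * ((1 + y) ^ (n + 1))⁻¹))
      (γ := fun u => (1 + ε⁻¹) ^ (n + 1) * ‖g u * (((1 + ‖u.2‖) ^ (n + 1))⁻¹ : ℝ)‖)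
      (hmm.aestronglyMeasurable.mul (aestronglyMeasurable_symbol hε hB)) hg.1.1 (hW.const_mul _)
      ((hg.1.integrable_mul (memLp_inv_one_add_pow n).ofReal).norm.const_mul _)]
    · congr 1
      refine setIntegral_congr_fun measurableSet_Ioi fun y (hy : 0 < y) => ?_
      rw [integral_mul_kern hG hg (show 0 < ε + y by linarith)]
      ring
    · intro y hy u hu
      have hk := norm_inv_add_pow_le hε hu hy.le (n + 1)
      have hs := norm_weight_mul_symbol_le (a := a) hε hBb hy
      have hgn : ‖g u * (((1 + ‖u.2‖) ^ (n + 1))⁻¹ : ℝ)‖ = ‖g u‖ * ((1 + ‖u.2‖) ^ (n + 1))⁻¹ := by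
        rw [norm_mul, Complex.norm_of_nonneg (by positivity)]
      rw [hgn, norm_mul (m y * _), norm_mul (g u), kern_shift_eq, RCLike.norm_conj]
      calc _ ≤ (C * (y ^ ((n : ℝ) - a) * ((1 + y) ^ (n + 1))⁻¹)) * (‖g u‖ *
            ((1 + ε⁻¹) ^ (n + 1) * ((1 + ‖u.2‖) ^ (n + 1))⁻¹)) := by
            refine mul_le_mul hs ?_ (by positivity) (by positivity)
            gcongr
        _ = _ := by ring
  have hconjf : MemLp (fun u => (starRingEnd ℂ) (testFun a ε B u)) 2 β := hf.star
  have hconjF : MemLp (fun u => (starRingEnd ℂ) (testProj a ε B u)) 2 β := hF.1.star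
  have hsub := integral_sub (hconjf.integrable_mul hg.1) (hconjF.integrable_mul hg.1)
  simp only [Pi.mul_apply] at hsub
  rw [hP1, hP2, sub_self] at hsub
  have hfin : ∫ u, (testFun a ε B u - testProj a ε B u) * (starRingEnd ℂ) (g u) ∂β =
      (starRingEnd ℂ) (∫ u, ((starRingEnd ℂ) (testFun a ε B u) * g u -
        (starRingEnd ℂ) (testProj a ε B u) * g u) ∂β) := by
    rw [← integral_conj]
    refine integral_congr_ae (ae_of_all _ fun u => ?_)
    simp [sub_mul]
  rw [hfin, hsub, map_zero]

end

/-! ### The slowly varying factor -/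

/-- The slowly varying factor `r^τ (1+r)^{-2τ}`. -/
noncomputable def slow (τ r : ℝ) : ℝ := r ^ τ * (1 + r) ^ (-(2 * τ))

theorem profile_eq {s τ ρ : ℝ} (hρ : 0 < ρ) : profile s τ ρ = ρ ^ (-s) * slow τ ρ := by
  rw [profile, slow, sub_eq_add_neg, Real.rpow_add hρ]; ring

theorem slow_pos {τ r : ℝ} (hr : 0 < r) : 0 < slow τ r := by unfold slow; positivity

theorem slow_eq_rpow {τ r : ℝ} (hr : 0 < r) : slow τ r = (r / (1 + r) ^ 2) ^ τ := by
  rw [slow, Real.div_rpow hr.le (by positivity), ← Real.rpow_natCast (1 + r) 2,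
    ← Real.rpow_mul (by positivity), div_eq_mul_inv, ← Real.rpow_neg (by positivity)]
  norm_num

/-- The function r/(1+r)² changes by a factor of at most max(x, 1/x) when r is multiplied by x, and
`slow` is its τ-th power. -/
theorem slow_le {τ x ρ : ℝ} (hτ : 0 ≤ τ) (hx : 0 < x) (hρ : 0 < ρ) :
    slow τ (ρ * x) ≤ (max x x⁻¹) ^ τ * slow τ ρ := by
  have hm : 0 < max x x⁻¹ := lt_max_of_lt_left hx
  rw [slow_eq_rpow (by positivity), slow_eq_rpow hρ, ← Real.mul_rpow hm.le (by positivity)]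
  refine Real.rpow_le_rpow (by positivity) ?_ hτ
  rw [← mul_div_assoc, div_le_div_iff₀ (by positivity) (by positivity)]
  rcases le_total 1 x with h | h
  · have h1 : x ≤ max x x⁻¹ := le_max_left _ _
    have h2 : (1 + ρ) ^ 2 ≤ (1 + ρ * x) ^ 2 := by
      gcongr
      nlinarith
    calc ρ * x * (1 + ρ) ^ 2 ≤ ρ * max x x⁻¹ * (1 + ρ * x) ^ 2 := by gcongr
      _ = _ := by ring
  · have h1 : x⁻¹ ≤ max x x⁻¹ := le_max_right _ _
    have h2 : x * (1 + ρ) ≤ 1 + ρ * x := by nlinarith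
    calc ρ * x * (1 + ρ) ^ 2 = x⁻¹ * ρ * (x * (1 + ρ)) ^ 2 := by field_simp
      _ ≤ max x x⁻¹ * ρ * (1 + ρ * x) ^ 2 := by gcongr

theorem abs_slow_sub_le {τ x ρ : ℝ} (hτ : 0 ≤ τ) (hx : 0 < x) (hρ : 0 < ρ) :
    |slow τ (ρ * x) - slow τ ρ| ≤ ((max x x⁻¹) ^ τ - 1) * slow τ ρ := by
  have h1 := slow_le hτ hx hρ
  have h2 := slow_le (x := x⁻¹) (ρ := ρ * x) hτ (by positivity) (by positivity)
  rw [mul_assoc, mul_inv_cancel₀ hx.ne', mul_one, inv_inv, max_comm] at h2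
  have hm1 : 1 ≤ (max x x⁻¹) ^ τ := by
    refine Real.one_le_rpow ?_ hτ
    rcases le_total 1 x with h | h
    · exact le_max_of_le_left h
    · exact le_max_of_le_right ((one_le_inv₀ hx).2 h)
  have h3 := slow_pos (τ := τ) hρ
  -- From slow ρ ≤ m · slow(ρx), the upper bound read backwards, and 1/m ≥ 2 - m.
  have h4 : slow τ (ρ * x) ≥ (2 - (max x x⁻¹) ^ τ) * slow τ ρ := by
    set m := (max x x⁻¹) ^ τ
    have hm0 : 0 < m := by linarith
    have : m * slow τ (ρ * x) ≥ m * ((2 - m) * slow τ ρ) := by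
      have : m * (2 - m) ≤ 1 := by nlinarith [sq_nonneg (m - 1)]
      nlinarith
    exact le_of_mul_le_mul_left this hm0
  rw [abs_le]
  constructor <;> linarith

/-- A bound for the deviation of the limiting projection from a pure power. -/
noncomputable def deviation (n : ℕ) (s τ : ℝ) : ℝ :=
  ∫ x in Ioi (0 : ℝ), x ^ ((n : ℝ) - s) * ((max x x⁻¹) ^ τ - 1) * (2 ^ (n + 1) * ((1 + x) ^ (n + 1))⁻¹)

theorem one_le_max_inv {x : ℝ} (hx : 0 < x) : 1 ≤ max x x⁻¹ := by
  rcases le_total 1 x with h | h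
  · exact le_max_of_le_left h
  · exact le_max_of_le_right ((one_le_inv₀ hx).2 h)

theorem max_inv_rpow_le {x τ : ℝ} (hx : 0 < x) : (max x x⁻¹) ^ τ ≤ x ^ τ + x ^ (-τ) := by
  rcases max_choice x x⁻¹ with h | h <;> rw [h]
  · have : 0 ≤ x ^ (-τ) := by positivity
    linarith
  · rw [Real.inv_rpow hx.le, ← Real.rpow_neg hx.le]
    have : 0 ≤ x ^ τ := by positivity
    linarith

theorem integrableOn_deviation_bound {n : ℕ} {s τ : ℝ} (hτ : 0 ≤ τ) (hτs : τ < s)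
    (hsn : s + τ < n + 1) :
    IntegrableOn (fun x : ℝ => x ^ ((n : ℝ) - s) * (max x x⁻¹) ^ τ *
      (2 ^ (n + 1) * ((1 + x) ^ (n + 1))⁻¹)) (Ioi 0) := by
  have h1 := integrableOn_rpow_mul_inv_pow (x := (n : ℝ) - s + τ) (N := n + 1) (by linarith)
    (by push_cast; linarith)
  have h2 := integrableOn_rpow_mul_inv_pow (x := (n : ℝ) - s - τ) (N := n + 1) (by linarith)
    (by push_cast; linarith)
  refine ((h1.add h2).const_mul (2 ^ (n + 1))).mono' ?_ ?_
  · exact (by fun_prop : Measurable fun x : ℝ => x ^ ((n : ℝ) - s) * (max x x⁻¹) ^ τ *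
      (2 ^ (n + 1) * ((1 + x) ^ (n + 1))⁻¹)).aestronglyMeasurable
  · refine (ae_restrict_mem measurableSet_Ioi).mono fun x (hx : 0 < x) => ?_
    have hm : 0 < max x x⁻¹ := lt_max_of_lt_left hx
    rw [Real.norm_of_nonneg (by positivity)]
    simp only [Pi.add_apply]
    calc _ ≤ x ^ ((n : ℝ) - s) * (x ^ τ + x ^ (-τ)) * (2 ^ (n + 1) * ((1 + x) ^ (n + 1))⁻¹) := by
          gcongr; exact max_inv_rpow_le hx
      _ = _ := by
          rw [sub_eq_add_neg _ τ, Real.rpow_add hx _ τ, Real.rpow_add hx _ (-τ)]; ring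

theorem integrableOn_deviation {n : ℕ} {s τ : ℝ} (hτ : 0 ≤ τ) (hτs : τ < s)
    (hsn : s + τ < n + 1) :
    IntegrableOn (fun x : ℝ => x ^ ((n : ℝ) - s) * ((max x x⁻¹) ^ τ - 1) *
      (2 ^ (n + 1) * ((1 + x) ^ (n + 1))⁻¹)) (Ioi 0) := by
  refine (integrableOn_deviation_bound hτ hτs hsn).mono' ?_ ?_
  · exact (by fun_prop : Measurable fun x : ℝ => x ^ ((n : ℝ) - s) * ((max x x⁻¹) ^ τ - 1) *
      (2 ^ (n + 1) * ((1 + x) ^ (n + 1))⁻¹)).aestronglyMeasurable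
  · refine (ae_restrict_mem measurableSet_Ioi).mono fun x (hx : 0 < x) => ?_
    have h1 : 1 ≤ (max x x⁻¹) ^ τ := Real.one_le_rpow (one_le_max_inv hx) hτ
    have h2 : 0 ≤ (max x x⁻¹) ^ τ - 1 := by linarith
    rw [Real.norm_of_nonneg (by positivity)]
    gcongr
    linarith

/-- Dominated convergence, since max(x, 1/x)^τ → 1. The majorant uses a fixed τ₀ < min(s, n+1-s),
which keeps it integrable at 0 and at ∞. -/
theorem tendsto_deviation {n : ℕ} {s : ℝ} (hs : 0 < s) (hsn : s < n + 1) :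
    Tendsto (deviation n s) (𝓝[>] 0) (𝓝 0) := by
  obtain ⟨τ₀, hτ₀, h1⟩ := exists_between (lt_min hs (sub_pos.2 hsn))
  have h2 : τ₀ < s := h1.trans_le (min_le_left _ _)
  have h3 : s + τ₀ < n + 1 := by linarith [h1.trans_le (min_le_right _ _)]
  have key : Tendsto (deviation n s) (𝓝[>] 0) (𝓝 (∫ _ in Ioi (0 : ℝ), (0 : ℝ))) := by
    unfold deviation
    refine tendsto_integral_filter_of_dominated_convergence _ ?_ ?_
      (integrableOn_deviation_bound hτ₀.le h2 h3) ?_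
    · refine Eventually.of_forall fun τ => ?_
      exact (by fun_prop : Measurable fun x : ℝ => x ^ ((n : ℝ) - s) * ((max x x⁻¹) ^ τ - 1) *
        (2 ^ (n + 1) * ((1 + x) ^ (n + 1))⁻¹)).aestronglyMeasurable
    · filter_upwards [Ioo_mem_nhdsGT hτ₀] with τ hτ
      refine (ae_restrict_mem measurableSet_Ioi).mono fun x (hx : 0 < x) => ?_
      have h1 : 1 ≤ (max x x⁻¹) ^ τ := Real.one_le_rpow (one_le_max_inv hx) hτ.1.le
      have h2 : 0 ≤ (max x x⁻¹) ^ τ - 1 := by linarith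
      have h3 : (max x x⁻¹) ^ τ ≤ (max x x⁻¹) ^ τ₀ :=
        Real.rpow_le_rpow_of_exponent_le (one_le_max_inv hx) hτ.2.le
      rw [Real.norm_of_nonneg (by positivity)]
      gcongr
      linarith
    · refine (ae_restrict_mem measurableSet_Ioi).mono fun x (hx : 0 < x) => ?_
      have hm : 0 < max x x⁻¹ := lt_max_of_lt_left hx
      have hc : Tendsto (fun τ : ℝ => (max x x⁻¹) ^ τ) (𝓝[>] 0) (𝓝 1) := by
        have := (Real.continuous_const_rpow hm.ne').tendsto 0
        rw [Real.rpow_zero] at this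
        exact this.mono_left nhdsWithin_le_nhds
      have := ((hc.sub_const 1).const_mul (x ^ ((n : ℝ) - s))).mul_const
        (2 ^ (n + 1) * ((1 + x) ^ (n + 1))⁻¹)
      simpa using this
  simpa using key

/-- The limit, up to a constant, of the projections of the test functions. -/
noncomputable def limProj (n : ℕ) (s τ : ℝ) (v : ℂ) : ℂ :=
  ∫ y in Ioi (0 : ℝ), ((y ^ ((n : ℝ) - s) * slow τ y : ℝ) : ℂ) * (((y : ℂ) + v) ^ (n + 1))⁻¹

/-- After y = ρx with ρ = |v|, the factor slow(ρx) is replaced by slow(ρ). The main term is then the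
Beta integral c_s v^{-s} slow(ρ), and by homogeneity the error is at most `deviation` times the same
profile. -/
theorem le_norm_limProj {n : ℕ} {s τ : ℝ} (hτ : 0 ≤ τ) (hτs : τ < s) (hsn : s + τ < n + 1)
    {v : ℂ} (hv : 0 < v.re) :
    (betaConst (n + 1) s - deviation n s τ) * profile s τ ‖v‖ ≤ ‖limProj n s τ v‖ := by
  have hs : 0 < s := hτ.trans_lt hτs
  have hsn' : s < (n + 1 : ℕ) := by push_cast; linarith
  set ρ := ‖v‖ with hρ
  have hρ0 : 0 < ρ := norm_pos_iff.2 (by rintro rfl; simp at hv)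
  have hnorm : ∀ x : ℝ, 0 < x → ‖((((ρ * x : ℝ) : ℂ) + v) ^ (n + 1))⁻¹‖ ≤
      (ρ ^ (n + 1))⁻¹ * (2 ^ (n + 1) * ((1 + x) ^ (n + 1))⁻¹) := by
    intro x hx
    have h1 := norm_le_norm_ofReal_add (r := ρ * x) (v := v) (by positivity) hv.le
    have h2 := le_norm_ofReal_add (r := ρ * x) (v := v)
    -- As |v| = ρ and Re v > 0, the modulus is at least ρ and at least ρx, hence at least their
    -- mean.
    have h3 : ρ * (1 + x) / 2 ≤ ‖((ρ * x : ℝ) : ℂ) + v‖ := by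
      rw [← hρ] at h1; linarith
    rw [norm_inv, norm_pow]
    calc (‖((ρ * x : ℝ) : ℂ) + v‖ ^ (n + 1))⁻¹ ≤ ((ρ * (1 + x) / 2) ^ (n + 1))⁻¹ := by gcongr
      _ = _ := by rw [div_pow, mul_pow]; field_simp
  -- substitution `y = ρ x`
  have hsub : ∀ g : ℝ → ℂ, ∫ y in Ioi (0 : ℝ), g y = ρ * ∫ x in Ioi (0 : ℝ), g (ρ * x) := by
    intro g
    have := integral_comp_mul_left_Ioi g 0 hρ0
    rw [mul_zero] at this
    rw [this, Complex.real_smul]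
    push_cast
    rw [mul_inv_cancel_left₀ (by exact_mod_cast hρ0.ne')]
  have hbeta := integral_rpow_mul_inv_pow_complex (N := n + 1) hs hsn' hv
  have hexp : ((n + 1 : ℕ) : ℝ) - 1 - s = n - s := by push_cast; ring
  rw [hexp] at hbeta
  rw [hsub] at hbeta
  unfold limProj
  rw [hsub]
  have hJ : IntegrableOn (fun x : ℝ => (((ρ * x) ^ ((n : ℝ) - s) : ℝ) : ℂ) *
      ((((ρ * x : ℝ) : ℂ) + v) ^ (n + 1))⁻¹) (Ioi 0) := by
    refine (((integrableOn_deviation_bound (n := n) (s := s) (τ := 0) le_rfl hs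
      (by push_cast at hsn'; linarith)).const_mul (ρ ^ ((n : ℝ) - s) * (ρ ^ (n + 1))⁻¹))).mono' ?_ ?_
    · exact (by fun_prop : Measurable fun x : ℝ => (((ρ * x) ^ ((n : ℝ) - s) : ℝ) : ℂ) *
        ((((ρ * x : ℝ) : ℂ) + v) ^ (n + 1))⁻¹).aestronglyMeasurable
    · refine (ae_restrict_mem measurableSet_Ioi).mono fun x (hx : 0 < x) => ?_
      rw [norm_mul, Complex.norm_of_nonneg (by positivity), Real.mul_rpow hρ0.le hx.le,
        Real.rpow_zero, mul_one]
      calc _ ≤ ρ ^ ((n : ℝ) - s) * x ^ ((n : ℝ) - s) *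
            ((ρ ^ (n + 1))⁻¹ * (2 ^ (n + 1) * ((1 + x) ^ (n + 1))⁻¹)) := by
            gcongr; exact hnorm x hx
        _ = _ := by ring
  have hD := integrableOn_deviation hτ hτs hsn
  have hdiffb : ∀ x : ℝ, 0 < x → ‖((((ρ * x) ^ ((n : ℝ) - s) * (slow τ (ρ * x) - slow τ ρ) : ℝ)) : ℂ) *
      ((((ρ * x : ℝ) : ℂ) + v) ^ (n + 1))⁻¹‖ ≤ (ρ ^ ((n : ℝ) - s) * (ρ ^ (n + 1))⁻¹ * slow τ ρ) *
        (x ^ ((n : ℝ) - s) * ((max x x⁻¹) ^ τ - 1) * (2 ^ (n + 1) * ((1 + x) ^ (n + 1))⁻¹)) := by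
    intro x hx
    have h1 := abs_slow_sub_le hτ hx hρ0
    have h0 := slow_pos (τ := τ) hρ0
    rw [norm_mul, Complex.norm_real, Real.norm_eq_abs, abs_mul, abs_of_nonneg (by positivity),
      Real.mul_rpow hρ0.le hx.le]
    have h2 : 0 ≤ ((max x x⁻¹) ^ τ - 1) * slow τ ρ := (abs_nonneg _).trans h1
    calc _ ≤ ρ ^ ((n : ℝ) - s) * x ^ ((n : ℝ) - s) * (((max x x⁻¹) ^ τ - 1) * slow τ ρ) *
          ((ρ ^ (n + 1))⁻¹ * (2 ^ (n + 1) * ((1 + x) ^ (n + 1))⁻¹)) := by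
          gcongr; exact hnorm x hx
      _ = _ := by ring
  have hdiff : IntegrableOn (fun x : ℝ =>
      ((((ρ * x) ^ ((n : ℝ) - s) * (slow τ (ρ * x) - slow τ ρ) : ℝ)) : ℂ) *
      ((((ρ * x : ℝ) : ℂ) + v) ^ (n + 1))⁻¹) (Ioi 0) := by
    refine (hD.const_mul _).mono' ?_ ((ae_restrict_mem measurableSet_Ioi).mono hdiffb)
    unfold slow
    exact (by fun_prop : Measurable _).aestronglyMeasurable
  have hsplit : ∫ x in Ioi (0 : ℝ), ((((ρ * x) ^ ((n : ℝ) - s) * slow τ (ρ * x) : ℝ)) : ℂ) *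
      ((((ρ * x : ℝ) : ℂ) + v) ^ (n + 1))⁻¹ =
      (∫ x in Ioi (0 : ℝ), ((((ρ * x) ^ ((n : ℝ) - s) * (slow τ (ρ * x) - slow τ ρ) : ℝ)) : ℂ) *
      ((((ρ * x : ℝ) : ℂ) + v) ^ (n + 1))⁻¹) + slow τ ρ * ∫ x in Ioi (0 : ℝ),
        (((ρ * x) ^ ((n : ℝ) - s) : ℝ) : ℂ) * ((((ρ * x : ℝ) : ℂ) + v) ^ (n + 1))⁻¹ := by
    rw [← integral_const_mul, ← integral_add hdiff (hJ.const_mul _)]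
    refine integral_congr_ae (ae_of_all _ fun x => ?_)
    push_cast
    ring
  rw [hsplit, mul_add, mul_left_comm (ρ : ℂ), hbeta]
  have hrem : ‖(ρ : ℂ) * ∫ x in Ioi (0 : ℝ),
      ((((ρ * x) ^ ((n : ℝ) - s) * (slow τ (ρ * x) - slow τ ρ) : ℝ)) : ℂ) *
      ((((ρ * x : ℝ) : ℂ) + v) ^ (n + 1))⁻¹‖ ≤ deviation n s τ * profile s τ ρ := by
    rw [norm_mul, Complex.norm_of_nonneg hρ0.le]
    have h1 := norm_integral_le_of_norm_le (hD.const_mul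
      (ρ ^ ((n : ℝ) - s) * (ρ ^ (n + 1))⁻¹ * slow τ ρ))
      ((ae_restrict_mem measurableSet_Ioi).mono hdiffb)
    rw [integral_const_mul] at h1
    calc _ ≤ ρ * ((ρ ^ ((n : ℝ) - s) * (ρ ^ (n + 1))⁻¹ * slow τ ρ) * deviation n s τ) := by
          gcongr; exact h1
      _ = _ := by
          rw [profile_eq hρ0, show (n : ℝ) - s = n + -s by ring, Real.rpow_add hρ0,
            Real.rpow_natCast, pow_succ]
          field_simp
  have hmain : ‖(slow τ ρ : ℂ) * (betaConst (n + 1) s * v ^ (-s : ℂ))‖ =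
      betaConst (n + 1) s * profile s τ ρ := by
    rw [norm_mul, norm_mul, show (-s : ℂ) = ((-s : ℝ) : ℂ) by push_cast; rfl, Complex.norm_cpow_real,
      Complex.norm_of_nonneg (slow_pos hρ0).le, Complex.norm_of_nonneg (betaConst_pos hs hsn').le,
      profile_eq hρ0]
    ring
  have htri := norm_sub_le_norm_add ((slow τ ρ : ℂ) * (betaConst (n + 1) s * v ^ (-s : ℂ)))
    ((ρ : ℂ) * ∫ x in Ioi (0 : ℝ),
      ((((ρ * x) ^ ((n : ℝ) - s) * (slow τ (ρ * x) - slow τ ρ) : ℝ)) : ℂ) *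
      ((((ρ * x : ℝ) : ℂ) + v) ^ (n + 1))⁻¹)
  rw [hmain] at htri
  rw [sub_mul, add_comm ((ρ : ℂ) * _)]
  linarith

/-! ### The symbols of the test functions -/

/-- The symbol `v^d (1+v)^{-2τ} (1+εv)^{-2n-3}`. -/
noncomputable def symbol (n : ℕ) (d τ ε : ℝ) (v : ℂ) : ℂ :=
  v ^ (d : ℂ) * (1 + v) ^ ((-(2 * τ) : ℝ) : ℂ) * ((1 + ε * v) ^ (2 * n + 3))⁻¹

section

variable {n : ℕ} {d τ ε : ℝ}

theorem differentiableOn_symbol (hε : 0 ≤ ε) :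
    DifferentiableOn ℂ (symbol n d τ ε) {v | 0 < v.re} := by
  intro v hv
  have hv' : 0 < v.re := hv
  refine DifferentiableAt.differentiableWithinAt ?_
  unfold symbol
  refine DifferentiableAt.mul (DifferentiableAt.mul ?_ ?_) ?_
  · exact differentiableAt_id.cpow_const (Or.inl hv')
  · refine DifferentiableAt.cpow_const (by fun_prop) (Or.inl ?_)
    simp; linarith
  · refine DifferentiableAt.inv (by fun_prop) (pow_ne_zero _ fun h => ?_)
    have := congrArg Complex.re h
    simp at this
    nlinarith

theorem norm_symbol (v : ℂ) : ‖symbol n d τ ε v‖ =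
    ‖v‖ ^ d * ‖1 + v‖ ^ (-(2 * τ)) * (‖1 + ε * v‖ ^ (2 * n + 3))⁻¹ := by
  rw [symbol, norm_mul, norm_mul, norm_inv, norm_pow, Complex.norm_cpow_real, Complex.norm_cpow_real]

theorem one_le_norm_one_add {v : ℂ} (hv : 0 ≤ v.re) : 1 ≤ ‖1 + v‖ := by
  have := Complex.re_le_norm (1 + v)
  simp at this
  linarith

theorem norm_le_norm_one_add {v : ℂ} (hv : 0 ≤ v.re) : ‖v‖ ≤ ‖1 + v‖ := by
  have := norm_le_norm_ofReal_add (r := 1) zero_le_one hv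
  simpa using this

theorem one_le_norm_one_add_mul {v : ℂ} (hε : 0 ≤ ε) (hv : 0 ≤ v.re) : 1 ≤ ‖1 + ε * v‖ :=
  one_le_norm_one_add (by simpa using mul_nonneg hε hv)

/-- The exponent splits as 2n+3 = (n+1) + (n+2): the first part absorbs v^d, as d ≤ n+1, and the
second is the decay required of a symbol. -/
theorem exists_norm_symbol_le (hd : d ≤ n + 1) (hτ : 0 ≤ τ) (hε : 0 < ε) :
    ∃ C : ℝ, ∀ v : ℂ, ε ≤ v.re → ‖symbol n d τ ε v‖ ≤ C * ((1 + ‖v‖) ^ (n + 2))⁻¹ := by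
  refine ⟨max 1 (ε ^ d) * (1 + ε⁻¹) ^ (2 * n + 3), fun v hv => ?_⟩
  have hv0 : 0 ≤ v.re := hε.le.trans hv
  have hr : ε ≤ ‖v‖ := hv.trans (Complex.re_le_norm v)
  have hr0 : 0 < ‖v‖ := hε.trans_le hr
  rw [norm_symbol]
  have h1 : ‖v‖ ^ d ≤ max 1 (ε ^ d) * (1 + ‖v‖) ^ (n + 1) := by
    rcases le_total 0 d with h | h
    · calc ‖v‖ ^ d ≤ (1 + ‖v‖) ^ d := Real.rpow_le_rpow hr0.le (by linarith) h
        _ ≤ (1 + ‖v‖) ^ ((n + 1 : ℕ) : ℝ) :=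
          Real.rpow_le_rpow_of_exponent_le (by linarith) (by push_cast; exact hd)
        _ = 1 * (1 + ‖v‖) ^ (n + 1) := by rw [Real.rpow_natCast, one_mul]
        _ ≤ _ := by gcongr; exact le_max_left _ _
    · calc ‖v‖ ^ d ≤ ε ^ d := Real.rpow_le_rpow_of_nonpos hε hr h
        _ ≤ max 1 (ε ^ d) * 1 := by rw [mul_one]; exact le_max_right _ _
        _ ≤ _ := by gcongr; exact one_le_pow₀ (by linarith)
  have h2 : ‖1 + v‖ ^ (-(2 * τ)) ≤ 1 :=
    Real.rpow_le_one_of_one_le_of_nonpos (one_le_norm_one_add hv0) (by linarith)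
  have h3 : 1 + ‖v‖ ≤ (1 + ε⁻¹) * ‖1 + ε * v‖ := by
    have i1 := one_le_norm_one_add_mul hε.le hv0
    have i2 : ‖(ε : ℂ) * v‖ ≤ ‖1 + ε * v‖ :=
      norm_le_norm_one_add (by simpa using mul_nonneg hε.le hv0)
    rw [norm_mul, Complex.norm_of_nonneg hε.le] at i2
    have i3 : ‖v‖ ≤ ε⁻¹ * ‖1 + ε * v‖ := by
      rw [inv_mul_eq_div, le_div_iff₀ hε]; linarith
    rw [add_mul]; linarith
  have h4 : (‖1 + ε * v‖ ^ (2 * n + 3))⁻¹ ≤ (1 + ε⁻¹) ^ (2 * n + 3) * ((1 + ‖v‖) ^ (2 * n + 3))⁻¹ := by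
    have h0 : 0 < ‖1 + ε * v‖ := one_pos.trans_le (one_le_norm_one_add_mul hε.le hv0)
    rw [← div_eq_mul_inv, ← div_pow, ← inv_pow]
    gcongr
    rw [le_div_iff₀ (by positivity), inv_mul_eq_div, div_le_iff₀ h0]
    exact h3
  calc _ ≤ max 1 (ε ^ d) * (1 + ‖v‖) ^ (n + 1) * 1 *
        ((1 + ε⁻¹) ^ (2 * n + 3) * ((1 + ‖v‖) ^ (2 * n + 3))⁻¹) := by gcongr
    _ = _ := by
        rw [show 2 * n + 3 = (n + 1) + (n + 2) by ring, pow_add (1 + ‖v‖)]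
        have : (1 + ‖v‖) ^ (n + 1) ≠ 0 := by positivity
        have : (1 + ‖v‖) ^ (n + 2) ≠ 0 := by positivity
        field_simp
        ring

/-- The relation d - a = τ - s makes the modulus independent of a. The factor 4^τ comes from |1+v| ≥
(1+|u_{n+1}|)/2 raised to the power -2τ; it tends to 1 with τ and does not involve ε. -/
theorem norm_testFun_le {a s : ℝ} (hd : d = τ - s + a) (hτ : 0 ≤ τ) (hτs : τ ≤ s) (hε : 0 < ε)
    {u : Space n} (hu : 0 ≤ u.2.im) (hu0 : 0 < ‖u.2‖) :
    ‖testFun a ε (symbol n d τ ε) u‖ ≤ 4 ^ τ * profile s τ ‖u.2‖ := by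
  set v : ℂ := (ε : ℂ) + -I * u.2 with hv
  have hre : 0 ≤ v.re := by rw [hv, re_add_neg_I_mul]; linarith
  have h1 : ‖u.2‖ ≤ ‖v‖ := norm_le_norm_add_neg_I_mul hε hu
  have hv0 : 0 < ‖v‖ := hu0.trans_le h1
  have h2 : (1 + ‖u.2‖) / 2 ≤ ‖1 + v‖ := by
    have i1 := one_le_norm_one_add hre
    have i2 := norm_le_norm_one_add hre
    linarith
  have h3 : (‖1 + ε * v‖ ^ (2 * n + 3))⁻¹ ≤ 1 :=
    inv_le_one_of_one_le₀ (one_le_pow₀ (one_le_norm_one_add_mul hε.le hre))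
  rw [testFun, norm_mul, RCLike.norm_conj, ← hv, norm_symbol,
    show (-a : ℂ) = ((-a : ℝ) : ℂ) by push_cast; rfl, Complex.norm_cpow_real]
  have h4 : ‖v‖ ^ (-a) * ‖v‖ ^ d = ‖v‖ ^ (τ - s) := by
    rw [← Real.rpow_add hv0, hd]; ring_nf
  have h5 : ‖v‖ ^ (τ - s) ≤ ‖u.2‖ ^ (τ - s) := Real.rpow_le_rpow_of_nonpos hu0 h1 (by linarith)
  have h6 : ‖1 + v‖ ^ (-(2 * τ)) ≤ 4 ^ τ * (1 + ‖u.2‖) ^ (-(2 * τ)) := by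
    calc _ ≤ ((1 + ‖u.2‖) / 2) ^ (-(2 * τ)) :=
          Real.rpow_le_rpow_of_nonpos (by positivity) h2 (by linarith)
      _ = _ := by
          rw [Real.div_rpow (by positivity) (by norm_num), Real.rpow_neg (x := 2) (by norm_num),
            Real.rpow_mul (by norm_num)]
          norm_num
          ring
  calc _ = (‖v‖ ^ (-a) * ‖v‖ ^ d) * ‖1 + v‖ ^ (-(2 * τ)) * (‖1 + ε * v‖ ^ (2 * n + 3))⁻¹ := by ring
    _ ≤ ‖u.2‖ ^ (τ - s) * (4 ^ τ * (1 + ‖u.2‖) ^ (-(2 * τ))) * 1 := by rw [h4]; gcongr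
    _ = _ := by rw [profile]; ring

theorem testFun_symbol_ne_zero {a : ℝ} (hε : 0 < ε) {u : Space n} (hu : 0 ≤ u.2.im) :
    testFun a ε (symbol n d τ ε) u ≠ 0 := by
  set v : ℂ := (ε : ℂ) + -I * u.2 with hv
  have hre : 0 < v.re := by rw [hv, re_add_neg_I_mul]; linarith
  have hv0 : 0 < ‖v‖ := norm_pos_iff.2 (by intro h; rw [h] at hre; simp at hre)
  have h1 : 0 < ‖1 + v‖ := one_pos.trans_le (one_le_norm_one_add hre.le)
  have h2 : 0 < ‖1 + ε * v‖ := one_pos.trans_le (one_le_norm_one_add_mul hε.le hre.le)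
  rw [← norm_pos_iff, testFun, norm_mul, RCLike.norm_conj, ← hv, norm_symbol,
    show (-a : ℂ) = ((-a : ℝ) : ℂ) by push_cast; rfl, Complex.norm_cpow_real]
  positivity

theorem symbol_ofReal {r : ℝ} (hr : 0 ≤ r) : symbol n d τ ε (r : ℂ) =
    ((r ^ d * (1 + r) ^ (-(2 * τ)) * ((1 + ε * r) ^ (2 * n + 3))⁻¹ : ℝ) : ℂ) := by
  rw [symbol, show (1 : ℂ) + r = ((1 + r : ℝ) : ℂ) by push_cast; rfl,
    ← Complex.ofReal_cpow hr, ← Complex.ofReal_cpow (by linarith)]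
  push_cast
  rfl

/-- The symbol is real on the positive axis, so the conjugation disappears, and y^{n-a} y^d
(1+y)^{-2τ} = y^{n-s} `slow τ y` remains in the limit. The translation by t keeps v inside the right
half-plane while η k → 0. -/
theorem tendsto_testProj {a s t : ℝ} (hd : d = τ - s + a) (han : a < n + 1)
    (hτ : 0 ≤ τ) (hτs : τ < s) (hsn : s < n + 1) (ht : 0 < t) {u : Space n} (hu : 0 ≤ u.2.im) {η : ℕ → ℝ}
    (hη0 : ∀ k, 0 < η k) (hη1 : ∀ k, η k ≤ 1) (hη : Tendsto η atTop (𝓝 0)) :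
    Tendsto (fun k => testProj a (η k) (symbol n d τ (η k)) (shift t u)) atTop
      (𝓝 ((betaConst (n + 1) a : ℂ)⁻¹ * limProj n s τ ((t : ℂ) + -I * u.2))) := by
  set v : ℂ := (t : ℂ) + -I * u.2 with hv
  have hre : 0 < v.re := by rw [hv, re_add_neg_I_mul]; linarith
  have hv0 : 0 < ‖v‖ := norm_pos_iff.2 (by intro h; rw [h] at hre; simp at hre)
  have hshift : ∀ ε : ℝ, (ε : ℂ) + -I * (shift t u).2 = (ε : ℂ) + v := by
    intro ε
    simp only [shift, hv]
    linear_combination (-(t : ℂ)) * I_sq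
  unfold testProj
  refine Tendsto.const_mul _ ?_
  unfold limProj
  refine tendsto_integral_of_dominated_convergence (fun y : ℝ => (1 + ‖v‖⁻¹) ^ (n + 1) *
    (y ^ ((n : ℝ) - s + τ) * ((1 + y) ^ (n + 1))⁻¹ +
      2 ^ d * (y ^ ((n : ℝ) - a) * (1 + y) ^ (-((n : ℝ) + 1 - d))))) (fun k => ?_) ?_ (fun k => ?_) ?_
  · refine AEStronglyMeasurable.mul (AEStronglyMeasurable.mul ?_ ?_) ?_
    · exact (by fun_prop : Measurable fun y : ℝ =>
        ((y ^ ((n : ℝ) - a) : ℝ) : ℂ)).aestronglyMeasurable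
    · exact Complex.continuous_conj.comp_aestronglyMeasurable
        (aestronglyMeasurable_symbol (hη0 k) (differentiableOn_symbol (hη0 k).le))
    · exact (by fun_prop : Measurable fun y : ℝ =>
        (((y : ℂ) + ((η k : ℂ) + -I * (shift t u).2)) ^ (n + 1))⁻¹).aestronglyMeasurable
  · refine Integrable.const_mul (Integrable.add ?_ (Integrable.const_mul ?_ _)) _
    · exact integrableOn_rpow_mul_inv_pow (by linarith) (by push_cast; linarith)
    · exact integrableOn_rpow_mul_one_add_rpow (by linarith) (by linarith)
  · refine (ae_restrict_mem measurableSet_Ioi).mono fun y (hy : 0 < y) => ?_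
    have he := hη0 k
    have hr0 : 0 < 2 * η k + y := by linarith
    -- The two summands cover the two signs of d: the power increases for d ≥ 0 and decreases for d
    -- ≤ 0.
    have hs1 : (2 * η k + y) ^ d ≤ y ^ d + 2 ^ d * (1 + y) ^ d := by
      have p1 : 0 ≤ y ^ d := by positivity
      rcases le_total 0 d with h | h
      · rw [← Real.mul_rpow (by norm_num) (by linarith)]
        have : (2 * η k + y) ^ d ≤ (2 * (1 + y)) ^ d :=
          Real.rpow_le_rpow hr0.le (by linarith [hη1 k]) h
        linarith
      · have : (2 * η k + y) ^ d ≤ y ^ d := Real.rpow_le_rpow_of_nonpos hy (by linarith) h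
        have : 0 ≤ (2 : ℝ) ^ d * (1 + y) ^ d := by positivity
        linarith
    have hs2 : ‖symbol n d τ (η k) ((2 * η k + y : ℝ) : ℂ)‖ ≤ y ^ d + 2 ^ d * (1 + y) ^ d := by
      have q0 : 0 ≤ (((2 * η k + y : ℝ)) : ℂ).re := by rw [ofReal_re]; exact hr0.le
      have q1 : ‖1 + (((2 * η k + y : ℝ)) : ℂ)‖ ^ (-(2 * τ)) ≤ 1 :=
        Real.rpow_le_one_of_one_le_of_nonpos (one_le_norm_one_add q0) (by linarith)
      have q2 : (‖1 + (η k : ℂ) * (((2 * η k + y : ℝ)) : ℂ)‖ ^ (2 * n + 3))⁻¹ ≤ 1 :=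
        inv_le_one_of_one_le₀ (one_le_pow₀ (one_le_norm_one_add_mul he.le q0))
      rw [norm_symbol, Complex.norm_of_nonneg hr0.le]
      calc _ ≤ (2 * η k + y) ^ d * 1 * 1 := by gcongr
        _ ≤ _ := by linarith
    have hs3 : ‖(((y : ℂ) + ((η k : ℂ) + v)) ^ (n + 1))⁻¹‖ ≤
        (1 + ‖v‖⁻¹) ^ (n + 1) * ((1 + y) ^ (n + 1))⁻¹ := by
      have e : (y : ℂ) + ((η k : ℂ) + v) = ((y + η k : ℝ) : ℂ) + v := by push_cast; ring
      rw [e]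
      have i1 := norm_le_norm_ofReal_add (r := y + η k) (by linarith) hre.le
      have i2 := le_norm_ofReal_add (r := y + η k) (v := v)
      have i3 := one_add_le_of_le (N := y) hv0 i1 (by linarith)
      have i4 : 0 < ‖((y + η k : ℝ) : ℂ) + v‖ := hv0.trans_le i1
      rw [norm_inv, norm_pow, ← div_eq_mul_inv, ← div_pow, ← inv_pow]
      gcongr
      rw [le_div_iff₀ (by positivity), inv_mul_eq_div, div_le_iff₀ i4]
      exact i3
    rw [hshift, norm_mul, norm_mul, RCLike.norm_conj, Complex.norm_of_nonneg (by positivity)]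
    calc _ ≤ y ^ ((n : ℝ) - a) * (y ^ d + 2 ^ d * (1 + y) ^ d) *
          ((1 + ‖v‖⁻¹) ^ (n + 1) * ((1 + y) ^ (n + 1))⁻¹) := by gcongr
      _ = _ := by
          have h1y : 0 < 1 + y := by linarith
          rw [show (n : ℝ) - s + τ = ((n : ℝ) - a) + d by rw [hd]; ring, Real.rpow_add hy,
            show -((n : ℝ) + 1 - d) = d + -((n + 1 : ℕ) : ℝ) by push_cast; ring,
            Real.rpow_add h1y, Real.rpow_neg h1y.le ((n + 1 : ℕ) : ℝ), Real.rpow_natCast]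
          ring
  · refine (ae_restrict_mem measurableSet_Ioi).mono fun y (hy : 0 < y) => ?_
    have hηc : Tendsto (fun k => (η k : ℂ)) atTop (𝓝 0) := by
      have := (Complex.continuous_ofReal.tendsto 0).comp hη
      simpa [Function.comp_def] using this
    have l1 : Tendsto (fun k => 2 * η k + y) atTop (𝓝 y) := by
      simpa using (hη.const_mul 2).add_const y
    have l2 : Tendsto (fun k => (2 * η k + y) ^ d * (1 + (2 * η k + y)) ^ (-(2 * τ)) *
        ((1 + η k * (2 * η k + y)) ^ (2 * n + 3))⁻¹) atTop
        (𝓝 (y ^ d * (1 + y) ^ (-(2 * τ)) * ((1 + 0 * y) ^ (2 * n + 3))⁻¹)) := by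
      refine ((l1.rpow_const (Or.inl hy.ne')).mul ((l1.const_add 1).rpow_const
        (Or.inl (by linarith)))).mul ((((hη.mul l1).const_add 1).pow _).inv₀ (by simp))
    have l3 : Tendsto (fun k => (((y : ℂ) + ((η k : ℂ) + v)) ^ (n + 1))⁻¹) atTop
        (𝓝 ((((y : ℂ) + (0 + v)) ^ (n + 1))⁻¹)) := by
      refine (((hηc.add_const v).const_add (y : ℂ)).pow _).inv₀ (pow_ne_zero _ ?_)
      rw [zero_add]
      exact ofReal_add_ne_zero hy.le hre
    have l4 := (((Complex.continuous_ofReal.tendsto _).comp l2).const_mul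
      ((y ^ ((n : ℝ) - a) : ℝ) : ℂ)).mul l3
    refine (l4.congr fun k => ?_).trans_eq ?_
    · rw [hshift, symbol_ofReal (by linarith [hη0 k]), conj_ofReal]
      rfl
    · congr 1
      rw [zero_add, zero_mul, add_zero, one_pow, inv_one, mul_one, slow,
        show (n : ℝ) - s = (n - a) + (a - s) by ring, Real.rpow_add hy,
        show d = (a - s) + τ by rw [hd]; ring, Real.rpow_add hy]
      push_cast
      ring

end

/-! ### The lower bound for the norm -/

theorem boundaryMeasure_ne_zero (n : ℕ) : boundaryMeasure n ≠ 0 := by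
  intro h
  have h1 := congrArg (fun μ : Measure (Space n) => μ univ) h
  simp only [boundaryMeasure, Measure.map_apply (measurable_boundaryMap n) MeasurableSet.univ,
    preimage_univ, Measure.coe_zero, Pi.zero_apply] at h1
  exact IsOpen.measure_ne_zero volume isOpen_univ univ_nonempty h1

/-- For f in L² ∩ L^p, constant sequences serve as approximants in `IsCauchySzego`. -/
theorem hardyNorm_le_of_isSzegoProjection {n : ℕ} {p : ℝ} {f F : Space n → ℂ}
    (hf : MemLp f (ENNReal.ofReal p) (boundaryMeasure n))
    (hf0 : eLpNorm f (ENNReal.ofReal p) (boundaryMeasure n) ≠ 0) (hF : IsSzegoProjection f F) :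
    hardyNorm p F ≤ cauchySzegoNorm n p * eLpNorm f (ENNReal.ofReal p) (boundaryMeasure n) := by
  have h : IsCauchySzego p f F := by
    refine ⟨hf, hF.2.1.1, fun _ => f, fun _ => F, fun _ => hf, fun _ => hF, ?_, ?_⟩
    · simp
    · simp [hardyNorm]
  rw [← ENNReal.div_le_iff hf0 hf.eLpNorm_ne_top]
  exact le_iSup_of_le f (le_iSup_of_le F (le_iSup_of_le hf0 (le_iSup_of_le h le_rfl)))

section

variable {n : ℕ} {p a s τ : ℝ}

theorem eLpNorm_profile_ne_zero (hp : 0 < p) :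
    eLpNorm (fun u : Space n => profile s τ ‖u.2‖) (ENNReal.ofReal p) (boundaryMeasure n) ≠ 0 := by
  have hm : AEStronglyMeasurable (fun u : Space n => profile s τ ‖u.2‖) (boundaryMeasure n) :=
    ((measurable_profile s τ).comp (by fun_prop)).aestronglyMeasurable
  rw [Ne, eLpNorm_eq_zero_iff hm (by simpa using hp)]
  intro h
  refine boundaryMeasure_ne_zero n (ae_eq_bot.1 (eventually_false_iff_eq_bot.1 ?_))
  filter_upwards [h, ae_norm_snd_pos n] with u h1 h2
  exact (profile_pos h2).ne' h1

theorem hardyNorm_testProj_le {d ε : ℝ} (hp : 0 < p) (hs : s * p = n + 1) (hd : d = τ - s + a)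
    (ha : 0 < a) (han : a < n + 1) (hτ : 0 < τ) (hτs : τ ≤ s) (hε : 0 < ε) :
    hardyNorm p (testProj (n := n) a ε (symbol n d τ ε)) ≤ cauchySzegoNorm n p *
      (ENNReal.ofReal (4 ^ τ) *
        eLpNorm (fun u : Space n => profile s τ ‖u.2‖) (ENNReal.ofReal p) (boundaryMeasure n)) := by
  have hB := differentiableOn_symbol (n := n) (d := d) (τ := τ) hε.le
  obtain ⟨C, hC⟩ := exists_norm_symbol_le (n := n) (d := d) (by rw [hd]; linarith) hτ.le hε
  have hm : AEStronglyMeasurable (testFun (n := n) a ε (symbol n d τ ε)) (boundaryMeasure n) :=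
    aestronglyMeasurable_boundary (continuousOn_testFun hε hB)
  have hle : ∀ᵐ u ∂(boundaryMeasure n), ‖testFun a ε (symbol n d τ ε) u‖ ≤
      ‖4 ^ τ * profile s τ ‖u.2‖‖ := by
    filter_upwards [ae_im_nonneg n, ae_norm_snd_pos n] with u h1 h2
    rw [Real.norm_of_nonneg (mul_nonneg (by positivity) (profile_nonneg h2.le))]
    exact norm_testFun_le hd hτ.le hτs hε h1 h2
  have hP := memLp_profile (n := n) hp hs hτ hτs
  have hf : MemLp (testFun (n := n) a ε (symbol n d τ ε)) (ENNReal.ofReal p) (boundaryMeasure n) :=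
    (hP.const_mul (4 ^ τ)).of_le hm hle
  have hf0 : eLpNorm (testFun (n := n) a ε (symbol n d τ ε)) (ENNReal.ofReal p)
      (boundaryMeasure n) ≠ 0 := by
    rw [Ne, eLpNorm_eq_zero_iff hm (by simpa using hp)]
    intro h
    refine boundaryMeasure_ne_zero n (ae_eq_bot.1 (eventually_false_iff_eq_bot.1 ?_))
    filter_upwards [h, ae_im_nonneg n] with u h1 h2
    exact testFun_symbol_ne_zero hε h2 h1
  refine (hardyNorm_le_of_isSzegoProjection hf hf0
    (isSzegoProjection_testFun ha han hε hB hC)).trans ?_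
  gcongr
  refine (eLpNorm_mono_ae hle).trans (le_of_eq ?_)
  rw [show (fun u : Space n => 4 ^ τ * profile s τ ‖u.2‖) =
      (4 ^ τ : ℝ) • fun u : Space n => profile s τ ‖u.2‖ from rfl, eLpNorm_const_smul,
    Real.enorm_of_nonneg (by positivity)]

theorem tendsto_inv_nat_add_one : Tendsto (fun k : ℕ => ((k : ℝ) + 1)⁻¹) atTop (𝓝 0) := by
  simpa using tendsto_one_div_add_atTop_nhds_zero_nat (𝕜 := ℝ)

theorem aestronglyMeasurable_testProj_shift {d ε t : ℝ} (hd : d = τ - s + a) (hτs : τ ≤ s)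
    (hτ : 0 ≤ τ) (ha : 0 < a) (han : a < n + 1) (hε : 0 < ε) (ht : 0 < t) :
    AEStronglyMeasurable (fun u => testProj (n := n) a ε (symbol n d τ ε) (shift t u))
      (boundaryMeasure n) := by
  obtain ⟨C, hC⟩ := exists_norm_symbol_le (n := n) (d := d) (by rw [hd]; linarith) hτ hε
  exact aestronglyMeasurable_boundary (continuousOn_comp_shift
    ((differentiableOn_testProj ha han hε (differentiableOn_symbol hε.le) hC).continuousOn.mono
      (upperHalfSpace_subset hε)) ht)

/-- Fatou's lemma as ε → 0 at fixed height t. The right-hand side depends neither on ε nor on t. -/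
theorem eLpNorm_limProj_le {t : ℝ} (hp : 0 < p) (hs : s * p = n + 1)
    (ha : 0 < a) (han : a < n + 1) (hτ : 0 < τ) (hτs : τ < s) (hsn : s < n + 1) (ht : 0 < t) :
    eLpNorm (fun u : Space n => (betaConst (n + 1) a : ℂ)⁻¹ * limProj n s τ ((t : ℂ) + -I * u.2))
      (ENNReal.ofReal p) (boundaryMeasure n) ≤ cauchySzegoNorm n p *
      (ENNReal.ofReal (4 ^ τ) *
        eLpNorm (fun u : Space n => profile s τ ‖u.2‖) (ENNReal.ofReal p) (boundaryMeasure n)) := by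
  set η : ℕ → ℝ := fun k => ((k : ℝ) + 1)⁻¹ with hη
  have hη0 : ∀ k, 0 < η k := fun k => by rw [hη]; positivity
  have hη1 : ∀ k, η k ≤ 1 := fun k => inv_le_one_of_one_le₀ (by simp)
  refine (Lp.eLpNorm_lim_le_liminf_eLpNorm
    (f := fun k u => testProj a (η k) (symbol n (τ - s + a) τ (η k)) (shift t u))
    (fun k => aestronglyMeasurable_testProj_shift rfl hτs.le hτ.le ha han (hη0 k) ht) _ ?_).trans ?_
  · filter_upwards [ae_im_nonneg n] with u hu
    exact tendsto_testProj rfl han hτ.le hτs hsn ht hu hη0 hη1 tendsto_inv_nat_add_one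
  · refine liminf_le_of_le (by isBoundedDefault) fun b hb => ?_
    obtain ⟨k, hk⟩ := hb.exists
    exact hk.trans ((eLpNorm_shift_le_hardyNorm p _ ht).trans
      (hardyNorm_testProj_le hp hs rfl ha han hτ hτs.le (hη0 k)))

/-- A second use of Fatou's lemma, now for t → 0, after the pointwise lower bound `le_norm_limProj`.
The norm of the profile appears on both sides. -/
theorem ofReal_mul_eLpNorm_profile_le {κ : ℝ} (hp : 0 < p) (hs : s * p = n + 1)
    (ha : 0 < a) (han : a < n + 1) (hτ : 0 < τ) (hτs : τ < s) (hsn : s + τ < n + 1)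
    (hκ : κ = (betaConst (n + 1) s - deviation n s τ) / betaConst (n + 1) a) (hκ0 : 0 ≤ κ) :
    ENNReal.ofReal κ *
        eLpNorm (fun u : Space n => profile s τ ‖u.2‖) (ENNReal.ofReal p) (boundaryMeasure n) ≤
      cauchySzegoNorm n p * (ENNReal.ofReal (4 ^ τ) *
        eLpNorm (fun u : Space n => profile s τ ‖u.2‖) (ENNReal.ofReal p) (boundaryMeasure n)) := by
  set η : ℕ → ℝ := fun k => ((k : ℝ) + 1)⁻¹ with hη
  have hη0 : ∀ k, 0 < η k := fun k => by rw [hη]; positivity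
  have hc : 0 < betaConst (n + 1) a := betaConst_pos ha (by push_cast; exact han)
  rw [← Real.enorm_of_nonneg hκ0, ← eLpNorm_const_smul]
  refine (Lp.eLpNorm_lim_le_liminf_eLpNorm
    (f := fun k (u : Space n) => κ * profile s τ ‖(η k : ℂ) + -I * u.2‖)
    (fun k => (((measurable_profile s τ).comp (by fun_prop)).const_mul κ).aestronglyMeasurable)
    _ ?_).trans ?_
  · filter_upwards [ae_norm_snd_pos n] with u hu
    have h1 : Tendsto (fun k => ‖(η k : ℂ) + -I * u.2‖) atTop (𝓝 ‖u.2‖) := by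
      have h2 := (((Complex.continuous_ofReal.tendsto 0).comp
        tendsto_inv_nat_add_one).add_const (-I * u.2)).norm
      simpa [Function.comp_def, hη] using h2
    exact ((h1.rpow_const (Or.inl hu.ne')).mul
      ((h1.const_add 1).rpow_const (Or.inl (by positivity)))).const_mul κ
  · refine liminf_le_of_le (by isBoundedDefault) fun b hb => ?_
    obtain ⟨k, hk⟩ := hb.exists
    refine hk.trans (le_trans (eLpNorm_mono_ae ?_)
      (eLpNorm_limProj_le hp hs ha han hτ hτs (by linarith) (hη0 k)))
    filter_upwards [ae_im_nonneg n] with u hu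
    have hre : 0 < ((η k : ℂ) + -I * u.2).re := by rw [re_add_neg_I_mul]; linarith [hη0 k]
    rw [Real.norm_of_nonneg (mul_nonneg hκ0 (profile_nonneg (norm_nonneg _))), norm_mul, norm_inv,
      Complex.norm_of_nonneg hc.le, hκ, div_mul_eq_mul_div, inv_mul_eq_div]
    gcongr
    exact le_norm_limProj hτ.le hτs hsn hre

/-- Cancelling the norm of the profile needs it to be finite, which is where τ > 0 is essential: it
diverges as τ → 0. -/
theorem ofReal_sub_deviation_le (hp : 0 < p) (hs : s * p = n + 1)
    (ha : 0 < a) (han : a < n + 1) (hτ : 0 < τ) (hτs : τ < s) (hsn : s + τ < n + 1) :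
    ENNReal.ofReal ((betaConst (n + 1) s - deviation n s τ) / betaConst (n + 1) a) ≤
      cauchySzegoNorm n p * ENNReal.ofReal (4 ^ τ) := by
  rcases le_total ((betaConst (n + 1) s - deviation n s τ) / betaConst (n + 1) a) 0 with h | h
  · rw [ENNReal.ofReal_of_nonpos h]
    exact zero_le
  · have h1 := ofReal_mul_eLpNorm_profile_le hp hs ha han hτ hτs hsn rfl h
    rw [← mul_assoc] at h1
    exact (ENNReal.mul_le_mul_iff_left (eLpNorm_profile_ne_zero hp)
      (memLp_profile hp hs hτ hτs.le).eLpNorm_ne_top).1 h1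

theorem ofReal_betaConst_div_le (hp : 0 < p) (hs : s * p = n + 1)
    (ha : 0 < a) (han : a < n + 1) (hs0 : 0 < s) (hsn : s < n + 1) :
    ENNReal.ofReal (betaConst (n + 1) s / betaConst (n + 1) a) ≤ cauchySzegoNorm n p := by
  have h1 : Tendsto (fun τ => ENNReal.ofReal
      ((betaConst (n + 1) s - deviation n s τ) / betaConst (n + 1) a)) (𝓝[>] 0)
      (𝓝 (ENNReal.ofReal (betaConst (n + 1) s / betaConst (n + 1) a))) := by
    refine (ENNReal.continuous_ofReal.tendsto _).comp ?_
    simpa using ((tendsto_deviation hs0 hsn).const_sub (betaConst (n + 1) s)).div_const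
      (betaConst (n + 1) a)
  have h2 : Tendsto (fun τ : ℝ => cauchySzegoNorm n p * ENNReal.ofReal (4 ^ τ)) (𝓝[>] 0)
      (𝓝 (cauchySzegoNorm n p)) := by
    have h3 : Tendsto (fun τ : ℝ => ENNReal.ofReal (4 ^ τ)) (𝓝[>] 0) (𝓝 1) := by
      have h4 : Continuous fun τ : ℝ => ENNReal.ofReal (4 ^ τ) :=
        ENNReal.continuous_ofReal.comp (Real.continuous_const_rpow (by norm_num))
      simpa using (h4.tendsto 0).mono_left nhdsWithin_le_nhds
    simpa using ENNReal.Tendsto.const_mul (a := cauchySzegoNorm n p) h3 (Or.inl one_ne_zero)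
  refine le_of_tendsto_of_tendsto h1 h2 ?_
  have h5 : Ioo (0 : ℝ) (min s (n + 1 - s)) ∈ 𝓝[>] (0 : ℝ) :=
    Ioo_mem_nhdsGT (lt_min hs0 (by linarith))
  filter_upwards [h5] with τ hτ
  have h6 := lt_min_iff.1 hτ.2
  exact ofReal_sub_deviation_le hp hs ha han hτ.1 h6.1 (by linarith)

end

end Siegel

theorem mainTheorem5 (n : ℕ) (p q : ℝ) (hp : 1 < p) (hq : q = p / (p - 1)) :
    ENNReal.ofReal
        (Real.Gamma (((n : ℝ) + 1) / p) * Real.Gamma (((n : ℝ) + 1) / q) /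
          Real.Gamma (((n : ℝ) + 1) / 2) ^ 2) ≤
      Siegel.cauchySzegoNorm n p := by
  have hp0 : 0 < p := one_pos.trans hp
  have hn : (0 : ℝ) < n + 1 := by positivity
  -- s is the critical exponent for L^p, and a = (n+1)/2 gives the smallest denominator. The two
  -- factors Γ(n+1) cancel in the quotient, and n+1-s = (n+1)/q.
  have h := Siegel.ofReal_betaConst_div_le (n := n) (p := p) (s := (n + 1) / p) (a := (n + 1) / 2)
    hp0 (div_mul_cancel₀ _ hp0.ne') (by positivity) (by linarith) (by positivity)
    (div_lt_self hn hp)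
  convert h using 2
  have hq' : ((n : ℝ) + 1) / q = ((n + 1 : ℕ) : ℝ) - (n + 1) / p := by
    have : p - 1 ≠ 0 := by linarith
    rw [hq]; push_cast; field_simp
  have ha' : ((n + 1 : ℕ) : ℝ) - (n + 1) / 2 = ((n : ℝ) + 1) / 2 := by push_cast; ring
  have hG : Real.Gamma ((n + 1 : ℕ) : ℝ) ≠ 0 := (Real.Gamma_pos_of_pos (by positivity)).ne'
  rw [Siegel.betaConst, Siegel.betaConst, ha', ← hq', div_div_div_cancel_right₀ hG, sq]
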